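/- **Setting.** Let $M$ be a simply connected (in particular connected) smooth manifold, Hausdorff and second countable, of dimension $n\ge 3$; metrics are smooth, pseudo-Riemannian, of any signature. For a metric $g$ let $\nabla^g$ be its Levi-Civita connection, $\mathsf P^g=\frac1{n-2}\big(\mathrm{Ric}^g-\frac{\mathrm{tr}_g\mathrm{Ric}^g}{2(n-1)}g\big)$ its Schouten tensor and $\mathring{\mathsf P}^g=\mathsf P^g-\frac1n\mathrm{tr}_g(\mathsf P^g)\,g$ the trace-free part of the latter. For a $(0,3)$-tensor field $T$ define $\hat T$ by $g(\hat T(X,Y),Z)=T(X,Y,Z)$, and set $T_X=\hat T(X,\cdot)$. Write $(B_1\owedge B_2)(X,Y,Z,W)=B_1(X,Z)B_2(Y,W)+B_1(Y,W)B_2(X,Z)-B_1(X,W)B_2(Y,Z)-B_1(Y,Z)B_2(X,W)$. Let $\Pi_{\mathrm{Sym}^k_0}$ be the $g$-orthogonal projection onto totally symmetric trace-free tensors (for $k=3$ applied to the first three of four arguments). **Abundant manifolds.** $(M,g,S,t)$ is an *abundant manifold* if $g$ is locally conformally flat, $S$ is a smooth totally symmetric $g$-trace-free $(0,3)$-tensor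 field, $t\in C^\infty(M)$, and, with $\mathscr S(X,Y)=\mathrm{tr}(S_XS_Y)$, 1. $(\nabla^g)^2t=3\mathsf P^g+\frac13\big(dt^2-\frac12|dt|_g^2\,g\big)+\frac1{3(n-2)}\Big(\mathscr S+\frac{(n-6)|S|_g^2}{2(n-1)(n+2)}\,g\Big)$; 2. $\nabla^gS=\frac13\Pi_{\mathrm{Sym}^3_0}S_1$, the direction of differentiation being the fourth argument, where $S_1(X,Y,Z,\cdot)=g(S_XS_YZ,\cdot)+3S(X,Y,\cdot)\,dt(Z)+S(X,Y,Z)\,dt+\big(\frac4{n-2}\mathscr S(Y,Z)-3S(Y,Z,\mathrm{grad}_g t)\big)g(X,\cdot)$; 3. the curvature $R^S$ of $\nabla^S=\nabla^g-\hat S$ satisfies $g(R^S(X,Y)W,Z)=(\mathsf P^S\owedge g)(X,Y,Z,W)$, where $\mathsf P^S=\frac1{n-2}\big(\mathrm{Ric}^S-\frac{\mathrm{tr}_g\mathrm{Ric}^S}{2(n-1)}g\big)$ and $\mathrm{Ric}^S$ is the Ricci tensor of $\nabla^S$. **Hypersurfaces.** A *relative co-normalisation* is a pair $(f,\Xi)$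 of a smooth immersion $f:M\to\mathbb R^{n+1}$ and a nowhere vanishing smooth field $\Xi$ of covectors of $\mathbb R^{n+1}$ along $f$ annihilating $f_*TM$, together with the dual transversal field $\xi$ determined by $\langle\Xi,\xi\rangle=1$ and the tangency of all derivatives $\bar\nabla_X\xi$ (equivalently $\langle\bar\nabla_X\Xi,\xi\rangle=0$). The Gauss formula $\bar\nabla_X(f_*Y)=f_*(\nabla_XY)+G(X,Y)\,\xi$ defines its connection $\nabla$ and its metric $G$, assumed non-degenerate, and $C(X,Y,Z)=G(\nabla_XY-\nabla^G_XY,Z)$ is its cubic, which is totally symmetric. Write $(n+2)u(X)=\mathrm{tr}(Y\mapsto\hat C(X,Y))$ and $C(X,Y,Z)=U(X,Y,Z)+u(X)G(Y,Z)+u(Y)G(X,Z)+u(Z)G(X,Y)$. The co-normalisation is *abundant* if $G$ has vanishing Weyl tensor and, with $\mathscr U(X,Y)=\mathrm{tr}(U_XU_Y)$ and $\mathfrak U(X,Y,Z,W)=G(U_XU_YW,Z)$, $$\Pi_{\mathrm{Sym}^4_0}(\nabla^GU)=\Pi_{\mathrm{Sym}^4_0}[\mathfrak U+4U\otimes u],$$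 $$\nabla^Gu=\mathsf P^G+u\otimes u-\tfrac12|u|^2G+\tfrac1{n-2}\Big(\mathscr U+\tfrac{n-6}{2(n+2)(n-1)}|U|^2G\Big).$$ It *corresponds* to $(M,g,S,t)$ if $G=g$, $U=\frac13S$ and $u=\frac13dt$. Let $\bar\omega$ be a non-zero constant volume form on $\mathbb R^{n+1}$, with dual volume form $\bar\omega^*$. Put $\omega(Y_1,\dots,Y_n)=\bar\omega(f_*Y_1,\dots,f_*Y_n,\xi)$ and $\omega^*(Y_1,\dots,Y_n)=\pm\bar\omega^*(-\bar\nabla_{Y_1}\Xi,\dots,-\bar\nabla_{Y_n}\Xi,\Xi)$, the sign being chosen such that $\omega$ and $\omega^*$ define the same orientation. The co-normalisation is an *affine sphere* with respect to $\bar\omega$ if $\omega=\omega^*$ (Blaschke condition) and either $\xi=\mu\,(f-x_0)$ for a function $\mu:M\to\mathbb R$ and a point $x_0\in\mathbb R^{n+1}$, or $\xi$ is a non-zero constant vector. **Proposition.** (i) Let $(M,g,S,t)$ be an abundant manifold with $dt=0$ (that is, $u=0$) and $\mathring{\mathsf P}^g=0$. Then there is a relative co-normalisation corresponding to $(M,g,S,t)$,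 and every such co-normalisation is abundant and is an affine sphere with respect to some positive constant multiple of the standard volume form of $\mathbb R^{n+1}$. (ii) Conversely, if an abundant hypersurface co-normalisation on $M$ is an affine sphere with respect to some non-zero constant volume form on $\mathbb R^{n+1}$, then its metric $G$, which is the metric of the corresponding abundant manifold, satisfies $\mathring{\mathsf P}^G=0$. -/

import Mathlib

open scoped Manifold ContDiff

noncomputable section

namespace AbundantGeometry

/-- The model space of an `n`-dimensional manifold. -/
abbrev Eu (n : ℕ) : Type := EuclideanSpace ℝ (Fin n)

/-- The ambient space `ℝ^{n+1}` of a hypersurface. -/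
abbrev Amb (n : ℕ) : Type := EuclideanSpace ℝ (Fin (n + 1))

/-! ### Tensor calculus in local coordinates

All tensor fields below are given by their components with respect to the coordinate frame
`∂_1, …, ∂_n` on (an open subset of) `ℝ^n`. The metric `g` is a field of matrices, and
`Γ x k i j` is the coefficient `Γ^k_{ij}` of a connection, `∇_{∂_i} ∂_j = ∑_k Γ^k_{ij} ∂_k`. -/

section Local

variable {n : ℕ}

/-- Partial derivative `∂_i F` at `x`. -/
def pd {W : Type*} [NormedAddCommGroup W] [NormedSpace ℝ W] (i : Fin n) (F : Eu n → W)
    (x : Eu n) : W :=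
  fderiv ℝ F x (EuclideanSpace.single i 1)

/-- Christoffel symbols `Γ^k_{ij}` of the Levi-Civita connection of `g`. -/
def christoffel (g : Eu n → Matrix (Fin n) (Fin n) ℝ) (x : Eu n) (k i j : Fin n) : ℝ :=
  (1 / 2) * ∑ l, (g x)⁻¹ k l *
    (pd i (fun y => g y j l) x + pd j (fun y => g y i l) x - pd l (fun y => g y i j) x)

/-- Curvature of the connection `Γ`: `R(∂_i, ∂_j) ∂_k = ∑_l (curvature Γ x l k i j) ∂_l`, where
`R(X, Y) Z = ∇_X ∇_Y Z - ∇_Y ∇_X Z - ∇_{[X, Y]} Z`. -/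
def curvature (Γ : Eu n → Fin n → Fin n → Fin n → ℝ) (x : Eu n) (l k i j : Fin n) : ℝ :=
  pd i (fun y => Γ y l j k) x - pd j (fun y => Γ y l i k) x
    + ∑ m, (Γ x l i m * Γ x m j k - Γ x l j m * Γ x m i k)

/-- Ricci tensor `Ric(X, Y) = tr (Z ↦ R(Z, X) Y)` of the connection `Γ`. -/
def ricci (Γ : Eu n → Fin n → Fin n → Fin n → ℝ) (x : Eu n) (i j : Fin n) : ℝ :=
  ∑ l, curvature Γ x l j l i

/-- The `(0,4)` curvature tensor `Riem(X, Y, Z, W) = g(R(X, Y) W, Z)` of the connection `Γ`.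
With this placement of the arguments the round unit sphere has
`Riem(X, Y, Z, W) = g(X, Z) g(Y, W) - g(X, W) g(Y, Z)`. -/
def riem (g : Eu n → Matrix (Fin n) (Fin n) ℝ) (Γ : Eu n → Fin n → Fin n → Fin n → ℝ)
    (x : Eu n) (i j k l : Fin n) : ℝ :=
  ∑ m, g x k m * curvature Γ x m l i j

/-- Trace of a bilinear form `B` at a point with respect to the matrix `h` of the metric. -/
def tr2 (h : Matrix (Fin n) (Fin n) ℝ) (B : Fin n → Fin n → ℝ) : ℝ :=
  ∑ i, ∑ j, h⁻¹ i j * B i j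

/-- The Schouten-type tensor `(1/(n-2)) (Ric - tr_g(Ric)/(2(n-1)) g)` of a connection `Γ`. -/
def schoutenOf (g : Eu n → Matrix (Fin n) (Fin n) ℝ) (Γ : Eu n → Fin n → Fin n → Fin n → ℝ)
    (x : Eu n) (i j : Fin n) : ℝ :=
  (1 / ((n : ℝ) - 2)) *
    (ricci Γ x i j - tr2 (g x) (ricci Γ x) / (2 * ((n : ℝ) - 1)) * g x i j)

/-- The Schouten tensor of the metric `g`. -/
def schouten (g : Eu n → Matrix (Fin n) (Fin n) ℝ) (x : Eu n) (i j : Fin n) : ℝ :=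
  schoutenOf g (christoffel g) x i j

/-- Kulkarni-Nomizu product. -/
def kulkarniNomizu (B₁ B₂ : Fin n → Fin n → ℝ) (i j k l : Fin n) : ℝ :=
  B₁ i k * B₂ j l + B₁ j l * B₂ i k - B₁ i l * B₂ j k - B₁ j k * B₂ i l

/-- Weyl tensor of the metric `g` (for `n ≥ 3`). -/
def weyl (g : Eu n → Matrix (Fin n) (Fin n) ℝ) (x : Eu n) (i j k l : Fin n) : ℝ :=
  riem g (christoffel g) x i j k l - kulkarniNomizu (schouten g x) (g x) i j k l

/-- `raise3 h T k i j = T^k_{ij}`: the `(1,2)`-tensor `T̂` of a `(0,3)`-tensor `T`, defined by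
`g(T̂(X, Y), Z) = T(X, Y, Z)`. -/
def raise3 (h : Matrix (Fin n) (Fin n) ℝ) (T : Fin n → Fin n → Fin n → ℝ)
    (k i j : Fin n) : ℝ :=
  ∑ l, h⁻¹ k l * T i j l

/-- `𝒯(X, Y) = tr (T_X T_Y)`, where `T_X = T̂(X, ·)`. -/
def trSq (h : Matrix (Fin n) (Fin n) ℝ) (T : Fin n → Fin n → Fin n → ℝ) (i j : Fin n) : ℝ :=
  ∑ a, ∑ b, raise3 h T a i b * raise3 h T b j a

/-- `|T|²` of a `(0,3)`-tensor. -/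
def normSq3 (h : Matrix (Fin n) (Fin n) ℝ) (T : Fin n → Fin n → Fin n → ℝ) : ℝ :=
  ∑ i, ∑ j, ∑ k, ∑ a, ∑ b, ∑ c, h⁻¹ i a * h⁻¹ j b * h⁻¹ k c * T i j k * T a b c

/-- `|α|²` of a `1`-form. -/
def normSq1 (h : Matrix (Fin n) (Fin n) ℝ) (α : Fin n → ℝ) : ℝ :=
  ∑ i, ∑ j, h⁻¹ i j * α i * α j

/-- Covariant derivative of a `1`-form: `covDeriv1 Γ α x i j = (∇_{∂_i} α)(∂_j)`. -/
def covDeriv1 (Γ : Eu n → Fin n → Fin n → Fin n → ℝ) (α : Eu n → Fin n → ℝ)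
    (x : Eu n) (i j : Fin n) : ℝ :=
  pd i (fun y => α y j) x - ∑ k, Γ x k i j * α x k

/-- Covariant derivative of a `(0,3)`-tensor, the direction of differentiation being the last
argument: `covDeriv3 Γ T x i j k l = (∇_{∂_l} T)(∂_i, ∂_j, ∂_k)`. -/
def covDeriv3 (Γ : Eu n → Fin n → Fin n → Fin n → ℝ) (T : Eu n → Fin n → Fin n → Fin n → ℝ)
    (x : Eu n) (i j k l : Fin n) : ℝ :=
  pd l (fun y => T y i j k) x
    - ∑ a, (Γ x a l i * T x a j k + Γ x a l j * T x i a k + Γ x a l k * T x i j a)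

/-- Symmetrisation in the first three of four arguments. -/
def sym3 (Φ : Fin n → Fin n → Fin n → Fin n → ℝ) (i j k l : Fin n) : ℝ :=
  (1 / 6) * (Φ i j k l + Φ j k i l + Φ k i j l + Φ j i k l + Φ i k j l + Φ k j i l)

/-- Projection of `(T*M)^{⊗3} ⊗ T*M` onto `Sym³₀ ⊗ T*M`:
`Π_{Sym³₀} Φ = Π_{Sym³} Φ - (3/(n+2)) Π_{Sym³}(g ⊗ φ)` with
`φ(X, W) = tr_g ((Π_{Sym³} Φ)(·, ·, X, W))`. -/
def sym3TraceFree (h : Matrix (Fin n) (Fin n) ℝ) (Φ : Fin n → Fin n → Fin n → Fin n → ℝ)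
    (i j k l : Fin n) : ℝ :=
  sym3 Φ i j k l - (3 / ((n : ℝ) + 2)) *
    sym3 (fun a b c d => h a b * tr2 h (fun p q => sym3 Φ p q c d)) i j k l

/-- Symmetrisation in all four arguments. -/
def sym4 (Φ : Fin n → Fin n → Fin n → Fin n → ℝ) (i j k l : Fin n) : ℝ :=
  (1 / 24) * ∑ σ : Equiv.Perm (Fin 4),
    Φ (![i, j, k, l] (σ 0)) (![i, j, k, l] (σ 1)) (![i, j, k, l] (σ 2)) (![i, j, k, l] (σ 3))

/-- The symmetrised trace of a `(0,4)`-tensor, a symmetric `(0,2)`-tensor. -/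
def symTr4 (h : Matrix (Fin n) (Fin n) ℝ) (Φ : Fin n → Fin n → Fin n → Fin n → ℝ)
    (i j : Fin n) : ℝ :=
  tr2 h (fun p q => sym4 Φ p q i j)

/-- Projection of `(T*M)^{⊗4}` onto `Sym⁴₀`, the totally symmetric and trace-free tensors. -/
def sym4TraceFree (h : Matrix (Fin n) (Fin n) ℝ) (Φ : Fin n → Fin n → Fin n → Fin n → ℝ)
    (i j k l : Fin n) : ℝ :=
  sym4 (fun a b c d => Φ a b c d - (6 / ((n : ℝ) + 4)) *
    (symTr4 h Φ a b - tr2 h (symTr4 h Φ) * h a b / (2 * ((n : ℝ) + 2))) * h c d) i j k l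

/-- The tensor
`S₁(X, Y, Z) = g S_X S_Y Z + 3 S(X, Y, ·) dt(Z) + S(X, Y, Z) dt
  + ((4/(n-2)) 𝒮(Y, Z) - 3 S(Y, Z, grad t)) g(X, ·)`
at a point, with components `S₁(∂_i, ∂_j, ∂_k)(∂_l)`; `dt` is the differential of `t`. -/
def tensorS1 (h : Matrix (Fin n) (Fin n) ℝ) (S : Fin n → Fin n → Fin n → ℝ) (dt : Fin n → ℝ)
    (i j k l : Fin n) : ℝ :=
  (∑ b, h l b * ∑ a, raise3 h S b i a * raise3 h S a j k) + 3 * S i j l * dt k + S i j k * dt l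
    + ((4 / ((n : ℝ) - 2)) * trSq h S j k
        - 3 * ∑ a, ∑ b, S j k a * h⁻¹ a b * dt b) * h i l

/-- The trace `1`-form of a cubic: `(n+2) u(X) = tr (Y ↦ Ĉ(X, Y))`. -/
def cubicTrace (h : Matrix (Fin n) (Fin n) ℝ) (C : Fin n → Fin n → Fin n → ℝ)
    (i : Fin n) : ℝ :=
  (1 / ((n : ℝ) + 2)) * ∑ a, raise3 h C a i a

/-- The trace-free part `U` of a cubic:
`C(X, Y, Z) = U(X, Y, Z) + u(X) g(Y, Z) + u(Y) g(X, Z) + u(Z) g(X, Y)`. -/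
def cubicTraceFree (h : Matrix (Fin n) (Fin n) ℝ) (C : Fin n → Fin n → Fin n → ℝ)
    (i j k : Fin n) : ℝ :=
  C i j k - cubicTrace h C i * h j k - cubicTrace h C j * h i k - cubicTrace h C k * h i j

/-- `𝔘(X, Y, Z, W) = g(U_X U_Y W, Z)`. -/
def quadU (h : Matrix (Fin n) (Fin n) ℝ) (U : Fin n → Fin n → Fin n → ℝ)
    (i j k l : Fin n) : ℝ :=
  ∑ b, h k b * ∑ a, raise3 h U b i a * raise3 h U a j l

end Local

/-! ### Tensor fields on manifolds -/

section Manifold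

variable {n : ℕ} {M : Type*} [TopologicalSpace M] [ChartedSpace (Eu n) M]

/-- `e` is a smooth chart of `M`. -/
def IsChart (e : OpenPartialHomeomorph M (Eu n)) : Prop :=
  e ∈ IsManifold.maximalAtlas 𝓘(ℝ, Eu n) ∞ M

/-- The coordinate vector `∂_i` of the chart `e`, at the point with coordinates `x`. -/
def coordVec (e : OpenPartialHomeomorph M (Eu n)) (x : Eu n) (i : Fin n) :
    TangentSpace 𝓘(ℝ, Eu n) (e.symm x) :=
  mfderiv 𝓘(ℝ, Eu n) 𝓘(ℝ, Eu n) e.symm x (EuclideanSpace.single i (1 : ℝ) : Eu n)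

variable (n M) in
/-- Smooth pseudo-Riemannian metrics of arbitrary signature. -/
structure PseudoMetric where
  toFun : ∀ p : M, TangentSpace 𝓘(ℝ, Eu n) p →ₗ[ℝ] TangentSpace 𝓘(ℝ, Eu n) p →ₗ[ℝ] ℝ
  symm : ∀ p X Y, toFun p X Y = toFun p Y X
  nondegenerate : ∀ p X, (∀ Y, toFun p X Y = 0) → X = 0
  smooth : ∀ e : OpenPartialHomeomorph M (Eu n), IsChart e → ∀ i j : Fin n,
    ContDiffOn ℝ ∞ (fun x => toFun (e.symm x) (coordVec e x i) (coordVec e x j)) e.target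

variable (n M) in
/-- Smooth `(0,3)`-tensor fields. -/
structure Tensor3 where
  toFun : ∀ p : M, TangentSpace 𝓘(ℝ, Eu n) p →ₗ[ℝ] TangentSpace 𝓘(ℝ, Eu n) p →ₗ[ℝ]
    TangentSpace 𝓘(ℝ, Eu n) p →ₗ[ℝ] ℝ
  smooth : ∀ e : OpenPartialHomeomorph M (Eu n), IsChart e → ∀ i j k : Fin n,
    ContDiffOn ℝ ∞
      (fun x => toFun (e.symm x) (coordVec e x i) (coordVec e x j) (coordVec e x k)) e.target

/-- Components of a metric in a chart. -/
def PseudoMetric.comp (g : PseudoMetric n M) (e : OpenPartialHomeomorph M (Eu n)) (x : Eu n) :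
    Matrix (Fin n) (Fin n) ℝ :=
  Matrix.of fun i j => g.toFun (e.symm x) (coordVec e x i) (coordVec e x j)

/-- Components of a `(0,3)`-tensor field in a chart. -/
def Tensor3.comp (T : Tensor3 n M) (e : OpenPartialHomeomorph M (Eu n)) (x : Eu n)
    (i j k : Fin n) : ℝ :=
  T.toFun (e.symm x) (coordVec e x i) (coordVec e x j) (coordVec e x k)

/-- The differential `dt_p(X) = X(t)` of a function. -/
def dFun (t : M → ℝ) (p : M) (X : TangentSpace 𝓘(ℝ, Eu n) p) : ℝ :=
  mfderiv 𝓘(ℝ, Eu n) 𝓘(ℝ, ℝ) t p X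

/-- Components of the differential of a function in a chart. -/
def dFunComp (t : M → ℝ) (e : OpenPartialHomeomorph M (Eu n)) (x : Eu n) (i : Fin n) : ℝ :=
  pd i (fun y => t (e.symm y)) x

/-- `g` is (locally) conformally flat: around every point there is a smooth function `φ` such that
the metric `e^{2φ} g` is flat. -/
def PseudoMetric.IsConformallyFlat (g : PseudoMetric n M) : Prop :=
  ∀ p : M, ∃ (O : Set M) (φ : M → ℝ), IsOpen O ∧ p ∈ O ∧
    ContMDiffOn 𝓘(ℝ, Eu n) 𝓘(ℝ, ℝ) ∞ φ O ∧
    ∀ e : OpenPartialHomeomorph M (Eu n), IsChart e → ∀ x ∈ e.target, e.symm x ∈ O →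
      ∀ l k i j : Fin n,
        curvature (christoffel fun y => Real.exp (2 * φ (e.symm y)) • g.comp e y) x l k i j = 0

/-- `g` has vanishing Weyl tensor. -/
def PseudoMetric.IsWeylFlat (g : PseudoMetric n M) : Prop :=
  ∀ e : OpenPartialHomeomorph M (Eu n), IsChart e → ∀ x ∈ e.target, ∀ i j k l : Fin n,
    weyl (g.comp e) x i j k l = 0

/-- The trace-free part of the Schouten tensor of `g` vanishes. -/
def PseudoMetric.SchoutenTraceFreeVanishes (g : PseudoMetric n M) : Prop :=
  ∀ e : OpenPartialHomeomorph M (Eu n), IsChart e → ∀ x ∈ e.target, ∀ i j : Fin n,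
    schouten (g.comp e) x i j
      - (1 / (n : ℝ)) * tr2 (g.comp e x) (schouten (g.comp e) x) * g.comp e x i j = 0

/-- `(M, g, S, t)` is an abundant manifold. -/
structure IsAbundantManifold (g : PseudoMetric n M) (S : Tensor3 n M) (t : M → ℝ) : Prop where
  conformallyFlat : g.IsConformallyFlat
  symmetric₁₂ : ∀ p X Y Z, S.toFun p X Y Z = S.toFun p Y X Z
  symmetric₂₃ : ∀ p X Y Z, S.toFun p X Y Z = S.toFun p X Z Y
  traceFree : ∀ e : OpenPartialHomeomorph M (Eu n), IsChart e → ∀ x ∈ e.target, ∀ i : Fin n,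
    tr2 (g.comp e x) (S.comp e x i) = 0
  smooth : ContMDiff 𝓘(ℝ, Eu n) 𝓘(ℝ, ℝ) ∞ t
  /-- the Hessian of `t` -/
  hessian : ∀ e : OpenPartialHomeomorph M (Eu n), IsChart e → ∀ x ∈ e.target, ∀ i j : Fin n,
    covDeriv1 (christoffel (g.comp e)) (dFunComp t e) x i j =
      3 * schouten (g.comp e) x i j
      + (1 / 3) * (dFunComp t e x i * dFunComp t e x j
          - (1 / 2) * normSq1 (g.comp e x) (dFunComp t e x) * g.comp e x i j)
      + (1 / (3 * ((n : ℝ) - 2))) * (trSq (g.comp e x) (S.comp e x) i j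
          + ((n : ℝ) - 6) * normSq3 (g.comp e x) (S.comp e x) * g.comp e x i j
            / (2 * ((n : ℝ) - 1) * ((n : ℝ) + 2)))
  /-- the covariant derivative of `S` -/
  covDerivS : ∀ e : OpenPartialHomeomorph M (Eu n), IsChart e → ∀ x ∈ e.target,
    ∀ i j k l : Fin n,
    covDeriv3 (christoffel (g.comp e)) (S.comp e) x i j k l =
      (1 / 3) * sym3TraceFree (g.comp e x)
        (tensorS1 (g.comp e x) (S.comp e x) (dFunComp t e x)) i j k l
  /-- the curvature of the connection `∇^S = ∇^g - Ŝ` -/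
  curvatureS : ∀ e : OpenPartialHomeomorph M (Eu n), IsChart e → ∀ x ∈ e.target,
    ∀ i j k l : Fin n,
    let ΓS : Eu n → Fin n → Fin n → Fin n → ℝ := fun y c a b =>
      christoffel (g.comp e) y c a b - raise3 (g.comp e y) (S.comp e y) c a b
    riem (g.comp e) ΓS x i j k l =
      kulkarniNomizu (schoutenOf (g.comp e) ΓS x) (g.comp e x) i j k l

/-! ### Affine hypersurfaces -/

variable (n M) in
/-- A relative affine hypersurface co-normalisation `(f, Ξ)`, together with its dual relative
normalisation `(f, ξ)`: the co-normal field `Ξ` and the transversal field `ξ` determine each other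
once the fundamental form of the hypersurface is non-degenerate. -/
structure RelativeConormalisation where
  f : M → Amb n
  Ξ : M → (Amb n →L[ℝ] ℝ)
  ξ : M → Amb n
  smooth_f : ContMDiff 𝓘(ℝ, Eu n) 𝓘(ℝ, Amb n) ∞ f
  smooth_Ξ : ContMDiff 𝓘(ℝ, Eu n) 𝓘(ℝ, Amb n →L[ℝ] ℝ) ∞ Ξ
  smooth_ξ : ContMDiff 𝓘(ℝ, Eu n) 𝓘(ℝ, Amb n) ∞ ξ
  immersion : ∀ p, Function.Injective (mfderiv 𝓘(ℝ, Eu n) 𝓘(ℝ, Amb n) f p)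
  conormal : ∀ p X, Ξ p (mfderiv 𝓘(ℝ, Eu n) 𝓘(ℝ, Amb n) f p X) = 0
  dual : ∀ p, Ξ p (ξ p) = 1
  /-- the derivative of `ξ` is tangential, i.e. the `1`-form `Θ` vanishes -/
  relative : ∀ p X, ∃ Y, mfderiv 𝓘(ℝ, Eu n) 𝓘(ℝ, Amb n) ξ p X =
    mfderiv 𝓘(ℝ, Eu n) 𝓘(ℝ, Amb n) f p Y

/-- `g` and `C` are the metric and the cubic associated to the normalisation: the Gauss formula
`∂_X ∂_Y f = f_*(∇_X Y) + g(X, Y) ξ` holds with `∇ = ∇^g + Ĉ`. As `∂_1 f, …, ∂_n f, ξ` is a frame,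
this determines `g` and `C`; in particular the hypersurface is non-degenerate. -/
def RelativeConormalisation.HasMetricAndCubic (N : RelativeConormalisation n M)
    (g : PseudoMetric n M) (C : Tensor3 n M) : Prop :=
  ∀ e : OpenPartialHomeomorph M (Eu n), IsChart e → ∀ x ∈ e.target, ∀ i j : Fin n,
    pd i (pd j fun y => N.f (e.symm y)) x =
      (∑ k, (christoffel (g.comp e) x k i j + raise3 (g.comp e x) (C.comp e x) k i j) •
        pd k (fun y => N.f (e.symm y)) x)
      + g.comp e x i j • N.ξ (e.symm x)

/-- The conditions on the metric `g` and the cubic `C` of a relative co-normalisation that make it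
an abundant hypersurface co-normalisation; `u` and `U` are the trace and the trace-free part
of `C`. -/
structure SatisfiesAbundanceConditions (g : PseudoMetric n M) (C : Tensor3 n M) : Prop where
  weylFlat : g.IsWeylFlat
  condU : ∀ e : OpenPartialHomeomorph M (Eu n), IsChart e → ∀ x ∈ e.target,
    ∀ i j k l : Fin n,
    let u : Eu n → Fin n → ℝ := fun y => cubicTrace (g.comp e y) (C.comp e y)
    let U : Eu n → Fin n → Fin n → Fin n → ℝ := fun y =>
      cubicTraceFree (g.comp e y) (C.comp e y)
    sym4TraceFree (g.comp e x) (covDeriv3 (christoffel (g.comp e)) U x) i j k l =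
      sym4TraceFree (g.comp e x)
        (fun a b c d => quadU (g.comp e x) (U x) a b c d + 4 * (U x a b c * u x d)) i j k l
  condu : ∀ e : OpenPartialHomeomorph M (Eu n), IsChart e → ∀ x ∈ e.target, ∀ i j : Fin n,
    let u : Eu n → Fin n → ℝ := fun y => cubicTrace (g.comp e y) (C.comp e y)
    let U : Eu n → Fin n → Fin n → Fin n → ℝ := fun y =>
      cubicTraceFree (g.comp e y) (C.comp e y)
    covDeriv1 (christoffel (g.comp e)) u x i j =
      schouten (g.comp e) x i j + u x i * u x j
      - normSq1 (g.comp e x) (u x) / 2 * g.comp e x i j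
      + (1 / ((n : ℝ) - 2)) * (trSq (g.comp e x) (U x) i j
          + ((n : ℝ) - 6) / (2 * ((n : ℝ) + 2) * ((n : ℝ) - 1))
            * normSq3 (g.comp e x) (U x) * g.comp e x i j)

/-- `(f, Ξ)`, with associated metric `g` and cubic `C`, is an abundant hypersurface
co-normalisation. -/
def RelativeConormalisation.IsAbundant (N : RelativeConormalisation n M)
    (g : PseudoMetric n M) (C : Tensor3 n M) : Prop :=
  N.HasMetricAndCubic g C ∧ SatisfiesAbundanceConditions g C

/-- `C` is the cubic built from an abundant structure `(S, t)`, that is `U = S/3`, `u = dt/3`. -/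
def IsCubicOfStructure (g : PseudoMetric n M) (S : Tensor3 n M) (t : M → ℝ)
    (C : Tensor3 n M) : Prop :=
  ∀ p X Y Z, C.toFun p X Y Z =
    (1 / 3) * (S.toFun p X Y Z + dFun t p X * g.toFun p Y Z + dFun t p Y * g.toFun p X Z
      + dFun t p Z * g.toFun p X Y)

/-- The relative co-normalisation corresponds to `(M, g, S, t)`: its metric is `g` and its cubic
is `C = (1/3)(S(X,Y,Z) + X(t) g(Y,Z) + Y(t) g(X,Z) + Z(t) g(X,Y))`. -/
def RelativeConormalisation.CorrespondsTo (N : RelativeConormalisation n M)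
    (g : PseudoMetric n M) (S : Tensor3 n M) (t : M → ℝ) (C : Tensor3 n M) : Prop :=
  N.HasMetricAndCubic g C ∧ IsCubicOfStructure g S t C

/-- The constant volume form `c · det` on `ℝ^{n+1}`. -/
def ambientVolume (c : ℝ) (v : Fin (n + 1) → Amb n) : ℝ :=
  c * Matrix.det (Matrix.of fun i j => v i j)

/-- The volume form on the dual space of `ℝ^{n+1}` that is dual to `c · det`. -/
def ambientDualVolume (c : ℝ) (α : Fin (n + 1) → (Amb n →L[ℝ] ℝ)) : ℝ :=
  c⁻¹ * Matrix.det (Matrix.of fun i j => α i (EuclideanSpace.single j 1))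

/-- The volume form `ω(Y_1, …, Y_n) = ω̄(Y_1, …, Y_n, ξ)` induced by `ω̄ = c · det`. -/
def RelativeConormalisation.volume (N : RelativeConormalisation n M) (c : ℝ) (p : M)
    (Y : Fin n → TangentSpace 𝓘(ℝ, Eu n) p) : ℝ :=
  ambientVolume c (Fin.snoc (α := fun _ => Amb n)
    (fun i => (mfderiv 𝓘(ℝ, Eu n) 𝓘(ℝ, Amb n) N.f p (Y i) : Amb n)) (N.ξ p))

/-- The dual volume form `ω^*(Y_1, …, Y_n) = ω̄^*(GY_1, …, GY_n, Ξ)`, where `GY` is the covector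
that restricts to `G(Y, ·)` on the hypersurface and annihilates `ξ`, i.e. minus the derivative
of `Ξ` in the direction of `Y`. -/
def RelativeConormalisation.dualVolume (N : RelativeConormalisation n M) (c : ℝ) (p : M)
    (Y : Fin n → TangentSpace 𝓘(ℝ, Eu n) p) : ℝ :=
  ambientDualVolume c (Fin.snoc (α := fun _ => Amb n →L[ℝ] ℝ)
    (fun i => -(mfderiv 𝓘(ℝ, Eu n) 𝓘(ℝ, Amb n →L[ℝ] ℝ) N.Ξ p (Y i) : Amb n →L[ℝ] ℝ)) (N.Ξ p))

/-- `(f, Ξ)` is Blaschke with respect to the volume form `c · det`: `ω` and `ω^*` agree, where the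
sign `ε` of `ω^*` is the one for which both define the same orientation. One has
`ω(Y) ω^*(Y) = det G(Y_i, Y_j)`, so that `ε = 1` if `G` is positive definite. -/
def RelativeConormalisation.IsBlaschke (N : RelativeConormalisation n M) (c : ℝ) : Prop :=
  ∃ ε : ℝ, (ε = 1 ∨ ε = -1) ∧ ∀ p Y, N.volume c p Y = ε * N.dualVolume c p Y

/-- Relative spheres, proper or improper. -/
def RelativeConormalisation.IsRelativeSphere (N : RelativeConormalisation n M) : Prop :=
  (∃ (μ : M → ℝ) (x₀ : Amb n), ∀ p, N.ξ p = μ p • (N.f p - x₀)) ∨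
    ∃ c₀ : Amb n, c₀ ≠ 0 ∧ ∀ p, N.ξ p = c₀

/-- Affine spheres with respect to the volume form `c · det`. -/
def RelativeConormalisation.IsAffineSphere (N : RelativeConormalisation n M) (c : ℝ) : Prop :=
  N.IsBlaschke c ∧ N.IsRelativeSphere

end Manifold

end AbundantGeometry

end

open AbundantGeometry

open scoped Manifold ContDiff

noncomputable section

/-! For a hypersurface with transversal field ξ, the equation dξ = -λ df holds exactly when the
connection ∇ = ∇^g + Ĉ has curvature R(X,Y)Z = λ(g(Y,Z)X - g(X,Z)Y). The proof plays this equation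
off against the abundance equations.

(i) Let dt = 0 and let P^g be a multiple of g. The Hessian equation becomes algebraic: it makes
tr(S_X S_Y) a multiple of g, and its trace expresses P^g by |S|²
(`IsSphericalOn.trSq_eq_and_schouten`). The curvature of ∇^S, being a Kulkarni-Nomizu product with
g, is skew in its last two arguments. Its symmetric part therefore vanishes, which says that ∇^g S
is totally symmetric; its skew part determines the commutators [S_X, S_Y], and a Ricci contraction
shows that these also have the algebraic form of constant curvature (`IsSphericalOn.commutator`).
Hence ∇^g + Ŝ/3 has the required curvature, λ being a negative number depending only on n times
|S|², and |S|² is constant by an argument of Schur type (`IsCubicOn.pd_eq_zero_of_trSq`).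

Consequently the linear system ∇dF = g s, ds = -λ dF is integrable: its integrability conditions are
the curvature formula and the symmetry of the cubic (`jetOp_integrable`). A Picard iteration solves
it locally (`exists_fundamentalSolution`), and simple connectedness glues the local solutions
(`exists_global_section`). A solution with values in ℝ^{n+1} whose frame (dF, s) is a basis at one
point gives f = F and ξ = s. The frame stays a basis everywhere, because for a trace-free cubic the
square of its determinant V is a constant multiple of det g (`exists_volume_ratio`).

For an arbitrary corresponding co-normalisation the curvature formula forces dξ = -λ df
(`IsHypersurfaceOn.umbilic_of_curvM`), so that ξ + λf is constant. If V* is the determinant of the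
dual frame, then V V* = det g; together with V² = ρ det g this gives V = ρ V*, and rescaling the
ambient volume form yields the Blaschke condition. Abundance is read off from the equations for S
and t, since the projection to Sym⁴₀ annihilates multiples of g
(`IsMetricOn.sym4TraceFree_add_mul`).

(ii) The Blaschke condition and V V* = det g give c² V² = ± det g; differentiating yields u = 0. A
relative sphere satisfies dξ = μ df, and the Gauss equation becomes Ric^g(X,Y) = tr(C_X C_Y) -
μ(n-1) g(X,Y). Modulo multiples of g this says (n-2) P^g = tr(C_X C_Y), whereas the condition on ∇^g
u says (n-2) P^g = -tr(C_X C_Y). Hence P^g is a multiple of g (`IsHypersurfaceOn.schouten_eq`). -/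

namespace AbundantGeometry

/-! ### Homotopy operator and Picard step for flat linear systems dY = A Y. -/

section FlatSystems

open MeasureTheory Filter Topology Metric

variable {E : Type*} [NormedAddCommGroup E] [NormedSpace ℝ E] [FiniteDimensional ℝ E]
  {F : Type*} [NormedAddCommGroup F] [NormedSpace ℝ F] [CompleteSpace F]

theorem hasFDerivAt_integral_of_continuous {Φ : E → ℝ → F} {Φ' : E → ℝ → E →L[ℝ] F}
    (h : ∀ x s, HasFDerivAt (fun y => Φ y s) (Φ' x s) x)
    (hc : Continuous fun p : E × ℝ => Φ p.1 p.2)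
    (hc' : Continuous fun p : E × ℝ => Φ' p.1 p.2) (x : E) :
    HasFDerivAt (fun y => ∫ s in (0 : ℝ)..1, Φ y s) (∫ s in (0 : ℝ)..1, Φ' x s) x := by
  obtain ⟨C, hC⟩ := ((isCompact_closedBall x 1).prod
    (isCompact_Icc (a := (0 : ℝ)) (b := 1))).exists_bound_of_continuousOn hc'.continuousOn
  refine intervalIntegral.hasFDerivAt_integral_of_dominated_of_fderiv_le (bound := fun _ => C)
    (closedBall_mem_nhds x one_pos) ?_ ?_ ?_ ?_ ?_ ?_
  · exact Eventually.of_forall fun y =>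
      (hc.comp (continuous_const.prodMk continuous_id)).aestronglyMeasurable
  · exact (hc.comp (continuous_const.prodMk continuous_id)).intervalIntegrable _ _
  · exact (hc'.comp (continuous_const.prodMk continuous_id)).aestronglyMeasurable
  · refine Eventually.of_forall fun t ht y hy => hC (y, t) ⟨hy, ?_⟩
    rw [Set.uIoc_of_le zero_le_one] at ht
    exact ⟨ht.1.le, ht.2⟩
  · exact intervalIntegrable_const
  · exact Eventually.of_forall fun t _ y _ => h y t

/-- The homotopy operator of the Poincaré lemma with centre `0`. -/
def coneIntegral (η : E → E →L[ℝ] F) (x : E) : F := ∫ s in (0 : ℝ)..1, η (s • x) x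

/-- The derivative of `coneIntegral η`. -/
def coneIntegralDeriv (η : E → E →L[ℝ] F) (x : E) : E →L[ℝ] F :=
  η x + ∫ s in (0 : ℝ)..1, s • ((fderiv ℝ η (s • x)).flip x - fderiv ℝ η (s • x) x)

/-- This is the Poincaré lemma in the form d(Kη) = η - K(dη), with K the cone integral. It holds for
every η, closed or not, which is what the iteration requires: the forms A Y become closed only in
the limit. -/
theorem hasFDerivAt_coneIntegral {η : E → E →L[ℝ] F} (hη : ContDiff ℝ 1 η) (x : E) :
    HasFDerivAt (coneIntegral η) (coneIntegralDeriv η x) x := by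
  have hd : ∀ y, HasFDerivAt η (fderiv ℝ η y) y := fun y =>
    (hη.differentiable one_ne_zero y).hasFDerivAt
  have hc := hη.continuous
  have hc' : Continuous (fderiv ℝ η) := hη.continuous_fderiv one_ne_zero
  have hΦ : ∀ (y : E) (s : ℝ), HasFDerivAt (fun z => η (s • z) z)
      (s • (fderiv ℝ η (s • y)).flip y + η (s • y)) y := by
    intro y s
    have h1 : HasFDerivAt (fun z : E => s • z) (s • ContinuousLinearMap.id ℝ E) y :=
      (hasFDerivAt_id y).const_smul s
    have h2 : HasFDerivAt (fun z => η (s • z)) _ y :=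
      HasFDerivAt.comp (f := fun z : E => s • z) y (hd (s • y)) h1
    have h3 := h2.clm_apply (hasFDerivAt_id y)
    refine h3.congr_fderiv ?_
    ext v
    simp [add_comm]
  have h1 := hasFDerivAt_integral_of_continuous hΦ (by fun_prop) (by
    have : Continuous fun p : E × ℝ => (fderiv ℝ η (p.2 • p.1)).flip p.1 := by
      have h := (ContinuousLinearMap.flipₗᵢ ℝ E E F).continuous.comp
        (hc'.comp (continuous_snd.smul continuous_fst : Continuous fun p : E × ℝ => p.2 • p.1))
      exact h.clm_apply continuous_fst
    fun_prop) x
  refine h1.congr_fderiv ?_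
  have hflip : Continuous fun s : ℝ => (fderiv ℝ η (s • x)).flip x := by
    have h := (ContinuousLinearMap.flipₗᵢ ℝ E E F).continuous.comp
        (hc'.comp (continuous_id.smul continuous_const : Continuous fun s : ℝ => s • x))
    exact h.clm_apply continuous_const
  -- The integrand is the derivative of s η(s x), so the term that arises from differentiating the
  -- last argument is exchanged for the value η(x).
  have hFTC : ∫ s in (0 : ℝ)..1, (s • fderiv ℝ η (s • x) x + η (s • x)) = η x := by
    have h2 : ∀ s : ℝ, HasDerivAt (fun s : ℝ => s • η (s • x))
        (s • fderiv ℝ η (s • x) x + η (s • x)) s := by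
      intro s
      have h3 : HasDerivAt (fun s : ℝ => s • x) x s := by
        simpa using (hasDerivAt_id s).smul_const x
      have h4 := (hasDerivAt_id s).smul ((hd (s • x)).comp_hasDerivAt s h3)
      exact h4.congr_deriv (by simp)
    rw [intervalIntegral.integral_eq_sub_of_hasDerivAt (fun s _ => h2 s)
      (Continuous.intervalIntegrable (by fun_prop) _ _)]
    simp
  rw [coneIntegralDeriv]
  conv_rhs => rw [← hFTC]
  rw [← intervalIntegral.integral_add (Continuous.intervalIntegrable (by fun_prop) _ _)
    (Continuous.intervalIntegrable (by fun_prop) _ _)]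
  congr 1
  ext1 s
  rw [smul_sub]; abel

theorem contDiff_coneIntegral {η : E → E →L[ℝ] F} (hη : ContDiff ℝ 1 η) :
    ContDiff ℝ 1 (coneIntegral η) := by
  have hc := hη.continuous
  have hc' : Continuous (fderiv ℝ η) := hη.continuous_fderiv one_ne_zero
  rw [contDiff_one_iff_fderiv]
  refine ⟨fun x => (hasFDerivAt_coneIntegral hη x).differentiableAt, ?_⟩
  have : fderiv ℝ (coneIntegral η) = coneIntegralDeriv η :=
    funext fun x => (hasFDerivAt_coneIntegral hη x).fderiv
  rw [this]
  refine hc.add (intervalIntegral.continuous_parametric_intervalIntegral_of_continuous' ?_ 0 1)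
  have h : Continuous fun p : E × ℝ => (fderiv ℝ η (p.2 • p.1)).flip p.1 := by
    have h := (ContinuousLinearMap.flipₗᵢ ℝ E E F).continuous.comp
      (hc'.comp (continuous_snd.smul continuous_fst : Continuous fun p : E × ℝ => p.2 • p.1))
    exact h.clm_apply continuous_fst
  simp only [Function.uncurry_def]
  fun_prop

variable {𝔸 : Type*} [NormedRing 𝔸] [NormedAlgebra ℝ 𝔸]

/-- `formMul y a = a · y` for an `𝔸`-valued `1`-form `a`. -/
def formMul (y : 𝔸) (a : E →L[ℝ] 𝔸) : E →L[ℝ] 𝔸 :=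
  ((ContinuousLinearMap.mul ℝ 𝔸).flip y).comp a

@[simp] theorem formMul_apply (y : 𝔸) (a : E →L[ℝ] 𝔸) (v : E) : formMul y a v = a v * y := rfl

theorem norm_formMul_le (y : 𝔸) (a : E →L[ℝ] 𝔸) : ‖formMul y a‖ ≤ ‖a‖ * ‖y‖ := by
  refine ContinuousLinearMap.opNorm_le_bound _ (by positivity) fun v => ?_
  rw [formMul_apply]
  calc ‖a v * y‖ ≤ ‖a v‖ * ‖y‖ := norm_mul_le _ _
    _ ≤ (‖a‖ * ‖v‖) * ‖y‖ := by gcongr; exact a.le_opNorm v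
    _ = _ := by ring

variable [CompleteSpace 𝔸]

/-- One step of the Picard iteration for `dY = A Y`, `Y(0) = 1`. -/
def picardStep (A : E → E →L[ℝ] 𝔸) (Y : E → 𝔸) (x : E) : 𝔸 :=
  1 + coneIntegral (fun y => formMul (Y y) (A y)) x

variable {A : E → E →L[ℝ] 𝔸}

theorem contDiff_formMul {m : WithTop ℕ∞} (hA : ContDiff ℝ m A) {Y : E → 𝔸} (hY : ContDiff ℝ m Y) :
    ContDiff ℝ m (fun y => formMul (Y y) (A y)) := by
  have h : ContDiff ℝ m (fun y => (ContinuousLinearMap.mul ℝ 𝔸).flip (Y y)) :=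
    contDiff_const.clm_apply hY
  exact h.clm_comp hA

theorem contDiff_picardStep (hA : ContDiff ℝ 1 A) {Y : E → 𝔸} (hY : ContDiff ℝ 1 Y) :
    ContDiff ℝ 1 (picardStep A Y) := by
  exact contDiff_const.add (contDiff_coneIntegral (contDiff_formMul hA hY))

theorem fderiv_formMul (hA : ContDiff ℝ 1 A) {Y : E → 𝔸} (hY : ContDiff ℝ 1 Y) (x u v : E) :
    fderiv ℝ (fun y => formMul (Y y) (A y)) x u v
      = fderiv ℝ A x u v * Y x + A x v * fderiv ℝ Y x u := by
  have h1 := (hA.differentiable one_ne_zero x).hasFDerivAt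
  have h2 := (hY.differentiable one_ne_zero x).hasFDerivAt
  have h3 := (h1.clm_apply (hasFDerivAt_const v x)).mul' h2
  have h5 : DifferentiableAt ℝ (fun y => formMul (Y y) (A y)) x :=
    (contDiff_formMul hA hY).differentiable one_ne_zero x
  have h4 := (h5.hasFDerivAt.clm_apply (hasFDerivAt_const v x)).unique h3
  have h6 := DFunLike.congr_fun h4 u
  simp at h6
  rw [h6]; abel

/-- The defect of `Y` from being a solution of `dY = A Y`. -/
def flatDefect (A : E → E →L[ℝ] 𝔸) (Y : E → 𝔸) (x : E) : E →L[ℝ] 𝔸 :=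
  fderiv ℝ Y x - formMul (Y x) (A x)

/-- Flatness of the connection `d - A` on a set. -/
def IsFlatOn (A : E → E →L[ℝ] 𝔸) (s : Set E) : Prop :=
  ∀ x ∈ s, ∀ u v, fderiv ℝ A x u v - fderiv ℝ A x v u + A x v * A x u - A x u * A x v = 0

/-- Write dY = A Y + δ. In the exterior derivative of A Y flatness cancels everything that does not
contain δ, so the new defect consists of the change of Y and an integral of A ∧ δ. Thus the iterates
become solutions as they converge. -/
theorem flatDefect_picardStep (hA : ContDiff ℝ 1 A) {r : ℝ} (hflat : IsFlatOn A (ball 0 r))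
    {Y : E → 𝔸} (hY : ContDiff ℝ 1 Y) {x : E} (hx : x ∈ ball (0 : E) r) (v : E) :
    flatDefect A (picardStep A Y) x v = A x v * (Y x - picardStep A Y x)
      + ∫ s in (0 : ℝ)..1, s • (A (s • x) x * flatDefect A Y (s • x) v
          - A (s • x) v * flatDefect A Y (s • x) x) := by
  set η : E → E →L[ℝ] 𝔸 := fun y => formMul (Y y) (A y) with hη
  have hη1 : ContDiff ℝ 1 η := contDiff_formMul hA hY
  have h1 : fderiv ℝ (picardStep A Y) x = coneIntegralDeriv η x :=
    ((hasFDerivAt_coneIntegral hη1 x).const_add 1).fderiv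
  have hc' : Continuous (fderiv ℝ η) := hη1.continuous_fderiv one_ne_zero
  have hflip : Continuous fun s : ℝ => (fderiv ℝ η (s • x)).flip x := by
    have h := (ContinuousLinearMap.flipₗᵢ ℝ E E 𝔸).continuous.comp
        (hc'.comp (continuous_id.smul continuous_const : Continuous fun s : ℝ => s • x))
    exact h.clm_apply continuous_const
  rw [flatDefect, sub_apply, h1, coneIntegralDeriv, add_apply,
    ContinuousLinearMap.intervalIntegral_apply
      (Continuous.intervalIntegrable (by fun_prop) _ _)]
  have h2 : ∀ s ∈ Set.uIcc (0 : ℝ) 1,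
      (s • ((fderiv ℝ η (s • x)).flip x - fderiv ℝ η (s • x) x)) v
      = s • (A (s • x) x * flatDefect A Y (s • x) v
          - A (s • x) v * flatDefect A Y (s • x) x) := by
    intro s hs
    rw [Set.uIcc_of_le zero_le_one] at hs
    have hsx : s • x ∈ ball (0 : E) r := by
      rw [mem_ball_zero_iff] at hx ⊢
      rw [norm_smul, Real.norm_of_nonneg hs.1]
      nlinarith [hs.2, norm_nonneg x]
    have hf := hflat _ hsx v x
    simp only [smul_apply, sub_apply,
      ContinuousLinearMap.flip_apply, flatDefect, formMul_apply]
    rw [hη, fderiv_formMul hA hY, fderiv_formMul hA hY]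
    congr 1
    have hf2 : (fderiv ℝ A (s • x) v x - fderiv ℝ A (s • x) x v + A (s • x) x * A (s • x) v
      - A (s • x) v * A (s • x) x) * Y (s • x) = 0 := by rw [hf, zero_mul]
    rw [← sub_eq_zero, ← hf2]
    noncomm_ring
  rw [intervalIntegral.integral_congr h2]
  simp only [hη, formMul_apply, mul_sub]
  abel

end FlatSystems

/-! ### Convergence of the Picard iteration; smooth invertible solutions. -/

section FlatSystems

open MeasureTheory Filter Topology Metric

variable {E : Type*} [NormedAddCommGroup E] [NormedSpace ℝ E] [FiniteDimensional ℝ E]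
  {𝔸 : Type*} [NormedRing 𝔸] [NormedAlgebra ℝ 𝔸] [CompleteSpace 𝔸] {A : E → E →L[ℝ] 𝔸}

theorem norm_integral_unitInterval_le {F : Type*} [NormedAddCommGroup F] [NormedSpace ℝ F]
    {f : ℝ → F} {C : ℝ} (h : ∀ s, 0 ≤ s → s ≤ 1 → ‖f s‖ ≤ C) :
    ‖∫ s in (0 : ℝ)..1, f s‖ ≤ C := by
  have := intervalIntegral.norm_integral_le_of_norm_le_const (a := 0) (b := 1) (f := f) (C := C)
    (fun s hs => by
      rw [Set.uIoc_of_le zero_le_one] at hs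
      exact h s hs.1.le hs.2)
  simpa using this

theorem smul_mem_ball_zero {r s : ℝ} {x : E} (hx : x ∈ ball (0 : E) r) (h0 : 0 ≤ s) (h1 : s ≤ 1) :
    s • x ∈ ball (0 : E) r := by
  rw [mem_ball_zero_iff] at hx ⊢
  rw [norm_smul, Real.norm_of_nonneg h0]
  nlinarith [norm_nonneg x]

/-- The difference is the cone integral of A (Y - Z), of norm at most K r C; the smallness K r ≤ 1/4
makes the step a contraction. -/
theorem picardStep_sub (hA : ContDiff ℝ 1 A) {Y Z : E → 𝔸} (hY : ContDiff ℝ 1 Y)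
    (hZ : ContDiff ℝ 1 Z) {r K : ℝ} (hK : ∀ x ∈ ball (0 : E) r, ‖A x‖ ≤ K) (hKr : K * r ≤ 1 / 4)
    {C : ℝ} (hC : ∀ x ∈ ball (0 : E) r, ‖Y x - Z x‖ ≤ C) {x : E} (hx : x ∈ ball (0 : E) r) :
    ‖picardStep A Y x - picardStep A Z x‖ ≤ C / 4 := by
  have hYc := (contDiff_formMul hA hY).continuous
  have hZc := (contDiff_formMul hA hZ).continuous
  have hcone : ∀ {η : E → E →L[ℝ] 𝔸}, Continuous η → Continuous fun s : ℝ => η (s • x) x :=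
    fun h => (h.comp (continuous_id.smul continuous_const)).clm_apply continuous_const
  have h1 : picardStep A Y x - picardStep A Z x
      = ∫ s in (0 : ℝ)..1, A (s • x) x * (Y (s • x) - Z (s • x)) := by
    rw [picardStep, picardStep, add_sub_add_left_eq_sub, coneIntegral, coneIntegral,
      ← intervalIntegral.integral_sub (Continuous.intervalIntegrable (hcone hYc) _ _)
        (Continuous.intervalIntegrable (hcone hZc) _ _)]
    simp only [formMul_apply, mul_sub]
  rw [h1]
  refine norm_integral_unitInterval_le fun s h0 h1 => ?_
  have hsx := smul_mem_ball_zero hx h0 h1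
  have hr : ‖x‖ ≤ r := (mem_ball_zero_iff.1 hx).le
  have hK0 : 0 ≤ K := (norm_nonneg _).trans (hK x hx)
  have hC0 : 0 ≤ C := (norm_nonneg _).trans (hC x hx)
  have hr0 : 0 ≤ r := (norm_nonneg x).trans hr
  calc _ ≤ ‖A (s • x) x‖ * ‖Y (s • x) - Z (s • x)‖ := norm_mul_le _ _
    _ ≤ (K * r) * C := by
      gcongr
      · exact ((A (s • x)).le_opNorm x).trans (by gcongr; exact hK _ hsx)
      · exact hC _ hsx
    _ ≤ (1 / 4) * C := by gcongr
    _ = C / 4 := by ring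

/-- In `flatDefect_picardStep` the change of Y contributes K C and the integral at most 2 K r D,
which is at most D / 2. -/
theorem norm_flatDefect_picardStep_le (hA : ContDiff ℝ 1 A) {r K : ℝ}
    (hflat : IsFlatOn A (ball 0 r)) {Y : E → 𝔸} (hY : ContDiff ℝ 1 Y)
    (hK : ∀ x ∈ ball (0 : E) r, ‖A x‖ ≤ K) (hKr : K * r ≤ 1 / 4) {C D : ℝ}
    (hC : ∀ x ∈ ball (0 : E) r, ‖picardStep A Y x - Y x‖ ≤ C)
    (hD : ∀ x ∈ ball (0 : E) r, ‖flatDefect A Y x‖ ≤ D) {x : E} (hx : x ∈ ball (0 : E) r) :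
    ‖flatDefect A (picardStep A Y) x‖ ≤ K * C + D / 2 := by
  have hr : ‖x‖ ≤ r := (mem_ball_zero_iff.1 hx).le
  have hK0 : 0 ≤ K := (norm_nonneg _).trans (hK x hx)
  have hC0 : 0 ≤ C := (norm_nonneg _).trans (hC x hx)
  have hD0 : 0 ≤ D := (norm_nonneg _).trans (hD x hx)
  refine ContinuousLinearMap.opNorm_le_bound _ (by positivity) fun v => ?_
  rw [flatDefect_picardStep hA hflat hY hx]
  have h1 : ‖A x v * (Y x - picardStep A Y x)‖ ≤ K * ‖v‖ * C := by
    refine (norm_mul_le _ _).trans ?_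
    gcongr
    · exact ((A x).le_opNorm v).trans (by gcongr; exact hK _ hx)
    · rw [norm_sub_rev]; exact hC _ hx
  have h2 : ‖∫ s in (0 : ℝ)..1, s • (A (s • x) x * flatDefect A Y (s • x) v
          - A (s • x) v * flatDefect A Y (s • x) x)‖ ≤ D / 2 * ‖v‖ := by
    refine norm_integral_unitInterval_le fun s h0 h1 => ?_
    have hsx := smul_mem_ball_zero hx h0 h1
    have ha : ∀ w, ‖A (s • x) w‖ ≤ K * ‖w‖ := fun w =>
      ((A (s • x)).le_opNorm w).trans (by gcongr; exact hK _ hsx)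
    have hd : ∀ w, ‖flatDefect A Y (s • x) w‖ ≤ D * ‖w‖ := fun w =>
      ((flatDefect A Y (s • x)).le_opNorm w).trans (by gcongr; exact hD _ hsx)
    rw [norm_smul, Real.norm_of_nonneg h0]
    calc _ ≤ 1 * (‖A (s • x) x * flatDefect A Y (s • x) v‖
          + ‖A (s • x) v * flatDefect A Y (s • x) x‖) := by
          gcongr; exact norm_sub_le _ _
      _ ≤ 1 * ((K * ‖x‖) * (D * ‖v‖) + (K * ‖v‖) * (D * ‖x‖)) := by
          gcongr
          · exact (norm_mul_le _ _).trans (mul_le_mul (ha _) (hd _) (norm_nonneg _) (by positivity))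
          · exact (norm_mul_le _ _).trans (mul_le_mul (ha _) (hd _) (norm_nonneg _) (by positivity))
      _ = 2 * D * ‖v‖ * (K * ‖x‖) := by ring
      _ ≤ 2 * D * ‖v‖ * (1 / 4) := by
          gcongr
          exact (mul_le_mul_of_nonneg_left hr hK0).trans hKr
      _ = D / 2 * ‖v‖ := by ring
  calc _ ≤ K * ‖v‖ * C + D / 2 * ‖v‖ := (norm_add_le _ _).trans (add_le_add h1 h2)
    _ = _ := by ring

theorem picardStep_zero (A : E → E →L[ℝ] 𝔸) (Y : E → 𝔸) : picardStep A Y 0 = 1 := by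
  simp [picardStep, coneIntegral]

/-- A flat linear system has a fundamental solution on a small ball around the origin. -/
theorem exists_fundamentalSolution_of_small (hA : ContDiff ℝ 1 A) {r K : ℝ} (hr : 0 < r)
    (hflat : IsFlatOn A (ball 0 r)) (hK : ∀ x ∈ ball (0 : E) r, ‖A x‖ ≤ K)
    (hKr : K * r ≤ 1 / 4) :
    ∃ Y : E → 𝔸, Y 0 = 1 ∧ ∀ x ∈ ball (0 : E) r, HasFDerivAt Y (formMul (Y x) (A x)) x := by
  let Y : ℕ → E → 𝔸 := fun k => (picardStep A)^[k] fun _ => 1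
  have hYs : ∀ k, Y (k + 1) = picardStep A (Y k) := fun k =>
    Function.iterate_succ_apply' _ _ _
  have hYd : ∀ k, ContDiff ℝ 1 (Y k) := by
    intro k
    induction k with
    | zero => exact contDiff_const
    | succ k ih => rw [hYs]; exact contDiff_picardStep hA ih
  have hY0 : ∀ k, Y k 0 = 1 := by
    rintro (_ | k)
    · rfl
    · rw [hYs, picardStep_zero]
  set D : ℝ := ‖(1 : 𝔸)‖ with hD
  have hD0 : 0 ≤ D := norm_nonneg _
  have hK0 : 0 ≤ K := (norm_nonneg _).trans (hK 0 (mem_ball_self hr))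
  have hdiff : ∀ k, ∀ x ∈ ball (0 : E) r, ‖Y (k + 1) x - Y k x‖ ≤ D * (1 / 4) ^ k := by
    intro k
    induction k with
    | zero =>
      intro x hx
      have h1 : Y 1 x - Y 0 x = ∫ s in (0 : ℝ)..1, A (s • x) x := by
        rw [hYs]; simp [Y, picardStep, coneIntegral]
      rw [h1, pow_zero, mul_one]
      refine norm_integral_unitInterval_le fun s h0 h1 => ?_
      have hsx := smul_mem_ball_zero hx h0 h1
      have h2 : ‖A (s • x) x‖ = ‖A (s • x) x * 1‖ := by rw [mul_one]
      rw [h2]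
      calc _ ≤ ‖A (s • x) x‖ * D := norm_mul_le _ _
        _ ≤ (K * r) * D := by
          gcongr
          exact ((A (s • x)).le_opNorm x).trans
            (mul_le_mul (hK _ hsx) (mem_ball_zero_iff.1 hx).le (norm_nonneg _) hK0)
        _ ≤ 1 * D := by gcongr; linarith
        _ = D := one_mul D
    | succ k ih =>
      intro x hx
      rw [hYs (k + 1)]
      nth_rewrite 2 [hYs k]
      refine (picardStep_sub hA (hYd _) (hYd _) hK hKr ih hx).trans (le_of_eq ?_)
      rw [pow_succ]; ring
  -- The ratio 3/4 closes the induction: K D (1/4)^k plus half of 4 K D (3/4)^k is at most 3 K D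
  -- (3/4)^k, the bound for k + 1.
  have hdef : ∀ k, ∀ x ∈ ball (0 : E) r, ‖flatDefect A (Y k) x‖ ≤ 4 * K * D * (3 / 4) ^ k := by
    intro k
    induction k with
    | zero =>
      intro x hx
      have h1 : flatDefect A (Y 0) x = - formMul 1 (A x) := by
        simp [flatDefect, Y]
      rw [h1, norm_neg]
      have h2 : ‖formMul (1 : 𝔸) (A x)‖ ≤ K * D :=
        (norm_formMul_le _ _).trans (by gcongr; exact hK x hx)
      have h3 : 0 ≤ K * D := by positivity
      simp only [pow_zero, mul_one]; linarith
    | succ k ih =>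
      intro x hx
      rw [hYs]
      have h1 := norm_flatDefect_picardStep_le hA hflat (hYd k) hK hKr
        (fun y hy => by rw [← hYs]; exact hdiff k y hy) ih hx
      refine h1.trans ?_
      have h2 : ((1 : ℝ) / 4) ^ k ≤ (3 / 4) ^ k := by gcongr; norm_num
      have h3 : K * D * (1 / 4) ^ k ≤ K * D * (3 / 4) ^ k := by gcongr
      rw [pow_succ]; nlinarith
  have hlim : ∀ x, ∃ y : 𝔸, x ∈ ball (0 : E) r → Tendsto (fun k => Y k x) atTop (𝓝 y) := by
    intro x
    by_cases hx : x ∈ ball (0 : E) r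
    · obtain ⟨y, hy⟩ := cauchySeq_tendsto_of_complete
        (cauchySeq_of_le_geometric (f := fun k => Y k x) (1 / 4) D (by norm_num) fun k => by
          rw [dist_comm, dist_eq_norm]; exact hdiff k x hx)
      exact ⟨y, fun _ => hy⟩
    · exact ⟨0, fun h => absurd h hx⟩
  choose Z hZ using hlim
  have hZY : ∀ x ∈ ball (0 : E) r, ∀ k, ‖Y k x - Z x‖ ≤ D * (1 / 4) ^ k / (1 - 1 / 4) := by
    intro x hx k
    rw [← dist_eq_norm]
    exact dist_le_of_le_geometric_of_tendsto (1 / 4) D (by norm_num) (fun k => by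
      rw [dist_comm, dist_eq_norm]; exact hdiff k x hx) (hZ x hx) k
  refine ⟨Z, ?_, fun x hx => ?_⟩
  · have h0 := hZ 0 (mem_ball_self hr)
    simp only [hY0] at h0
    exact tendsto_nhds_unique h0 tendsto_const_nhds
  -- The defects tend to zero uniformly, so the derivatives of the iterates converge uniformly to A
  -- Z and the limit Z is differentiable with this derivative.
  · refine hasFDerivAt_of_tendstoUniformlyOn (f := Y) (f' := fun k => fderiv ℝ (Y k))
      (g' := fun x => formMul (Z x) (A x)) isOpen_ball ?_
      (fun k y _ => ((hYd k).differentiable one_ne_zero y).hasFDerivAt) (fun y hy => hZ y hy) hx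
    rw [Metric.tendstoUniformlyOn_iff]
    intro ε hε
    have ht : Tendsto (fun k : ℕ => 4 * K * D * (3 / 4 : ℝ) ^ k
        + K * (D * (1 / 4 : ℝ) ^ k / (1 - 1 / 4))) atTop (𝓝 0) := by
      have h1 : Tendsto (fun k : ℕ => (3 / 4 : ℝ) ^ k) atTop (𝓝 0) :=
        tendsto_pow_atTop_nhds_zero_of_lt_one (by norm_num) (by norm_num)
      have h2 : Tendsto (fun k : ℕ => (1 / 4 : ℝ) ^ k) atTop (𝓝 0) :=
        tendsto_pow_atTop_nhds_zero_of_lt_one (by norm_num) (by norm_num)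
      have h3 := (h1.const_mul (4 * K * D)).add
        (((h2.const_mul D).div_const (1 - 1 / 4)).const_mul K)
      simpa using h3
    filter_upwards [ht.eventually (gt_mem_nhds hε)] with k hk y hy
    rw [dist_comm, dist_eq_norm]
    refine lt_of_le_of_lt ?_ hk
    have h1 : fderiv ℝ (Y k) y - formMul (Z y) (A y)
        = flatDefect A (Y k) y + formMul (Y k y - Z y) (A y) := by
      ext v
      simp [flatDefect, mul_sub]
    rw [h1]
    refine (norm_add_le _ _).trans (add_le_add (hdef k y hy) ((norm_formMul_le _ _).trans ?_))
    gcongr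
    · exact hK y hy
    · exact hZY y hy k

/-- A smooth flat linear system `dY = A Y` has, near every point, a smooth invertible fundamental
solution. -/
theorem exists_fundamentalSolution {U : Set E} (hU : IsOpen U) {x₀ : E} (hx₀ : x₀ ∈ U)
    (hA : ContDiffOn ℝ ∞ A U) (hflat : IsFlatOn A U) :
    ∃ r > 0, ball x₀ r ⊆ U ∧ ∃ Y : E → 𝔸, Y x₀ = 1 ∧ ContDiffOn ℝ ∞ Y (ball x₀ r) ∧
      ∀ x ∈ ball x₀ r, HasFDerivAt Y (formMul (Y x) (A x)) x ∧ IsUnit (Y x) := by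
  obtain ⟨ρ, hρ, hρU⟩ := Metric.isOpen_iff.1 hU x₀ hx₀
  -- The cut-off makes A globally smooth and leaves it unchanged near x₀. Flatness is only kept on
  -- the small ball, where the iteration uses it.
  let χ : ContDiffBump x₀ := ⟨ρ / 4, ρ / 2, by positivity, by linarith⟩
  let A₁ : E → E →L[ℝ] 𝔸 := fun x => χ x • A x
  have hA₁ : ContDiff ℝ ∞ A₁ := by
    rw [contDiff_iff_contDiffAt]
    intro x
    by_cases hx : x ∈ ball x₀ ρ
    · exact χ.contDiff.contDiffAt.smul ((hA x (hρU hx)).contDiffAt (hU.mem_nhds (hρU hx)))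
    · have h1 : x ∉ tsupport χ := by
        rw [χ.tsupport_eq]
        intro h2
        apply hx
        rw [mem_closedBall] at h2
        rw [mem_ball]
        have h3 : χ.rOut = ρ / 2 := rfl
        linarith
      have h2 : A₁ =ᶠ[𝓝 x] fun _ => 0 := by
        filter_upwards [notMem_tsupport_iff_eventuallyEq.1 h1] with y hy
        change χ y • A y = 0
        rw [hy]; exact zero_smul ℝ (A y)
      exact contDiffAt_const.congr_of_eventuallyEq h2
  have hA₁A : ∀ x ∈ ball x₀ (ρ / 4), A₁ x = A x := fun x hx => by
    have h1 : χ x = 1 := χ.one_of_mem_closedBall (ball_subset_closedBall hx)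
    simp [A₁, h1]
  let A₂ : E → E →L[ℝ] 𝔸 := fun x => A₁ (x₀ + x)
  have hA₂ : ContDiff ℝ ∞ A₂ := hA₁.comp (contDiff_const.add contDiff_id)
  obtain ⟨K, hK0, hK⟩ : ∃ K, 0 < K ∧ ∀ x ∈ ball (0 : E) 1, ‖A₂ x‖ ≤ K := by
    obtain ⟨K, hK⟩ := (isCompact_closedBall (0 : E) 1).exists_bound_of_continuousOn
      hA₂.continuous.continuousOn
    exact ⟨max K 1, by positivity, fun x hx =>
      (hK x (ball_subset_closedBall hx)).trans (le_max_left _ _)⟩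
  obtain ⟨r, hr, hr1, hrρ, hrK⟩ : ∃ r > 0, r ≤ 1 ∧ r ≤ ρ / 4 ∧ K * r ≤ 1 / 4 := by
    refine ⟨min 1 (min (ρ / 4) (1 / (4 * K))), by positivity, min_le_left _ _,
      (min_le_right _ _).trans (min_le_left _ _), ?_⟩
    have h1 : min 1 (min (ρ / 4) (1 / (4 * K))) ≤ 1 / (4 * K) :=
      (min_le_right _ _).trans (min_le_right _ _)
    calc _ ≤ K * (1 / (4 * K)) := by gcongr
      _ = 1 / 4 := by field_simp
  have hmem : ∀ x ∈ ball (0 : E) r, x₀ + x ∈ ball x₀ (ρ / 4) := fun x hx => by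
    rw [mem_ball_zero_iff] at hx
    rw [mem_ball, dist_eq_norm, add_sub_cancel_left]
    linarith
  have hsub : ball x₀ (ρ / 4) ⊆ U := (ball_subset_ball (by linarith)).trans hρU
  have hflat₂ : IsFlatOn A₂ (ball 0 r) := by
    intro x hx u v
    have h1 : fderiv ℝ A₂ x = fderiv ℝ A (x₀ + x) := by
      have h2 : fderiv ℝ A₂ x = fderiv ℝ A₁ (x₀ + x) := fderiv_comp_add_left x₀
      rw [h2]
      exact Filter.EventuallyEq.fderiv_eq (by
        filter_upwards [isOpen_ball.mem_nhds (hmem x hx)] with y hy using hA₁A y hy)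
    have h3 : A₂ x = A (x₀ + x) := hA₁A _ (hmem x hx)
    rw [h1, h3]
    exact hflat _ (hsub (hmem x hx)) u v
  obtain ⟨Y, hY0, hY⟩ := exists_fundamentalSolution_of_small (hA₂.of_le (by simp)) hr hflat₂
    (fun x hx => hK x (ball_subset_ball hr1 hx)) hrK
  let Z : E → 𝔸 := fun x => Y (x - x₀)
  have hZ : ∀ x ∈ ball x₀ r, HasFDerivAt Z (formMul (Z x) (A x)) x := by
    intro x hx
    have hx' : x - x₀ ∈ ball (0 : E) r := by
      rwa [mem_ball_zero_iff, ← dist_eq_norm]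
    have h1 := (hY _ hx').comp x ((hasFDerivAt_id x).sub_const x₀)
    have h3 : A₂ (x - x₀) = A x := by
      have := hA₁A _ (hmem _ hx')
      simp only [A₂, add_sub_cancel] at this ⊢
      exact this
    rw [h3] at h1
    exact h1
  have hZ0 : Z x₀ = 1 := by simp [Z, hY0]
  have hcont : ContinuousAt Z x₀ := (hZ x₀ (mem_ball_self hr)).continuousAt
  have hunit : ∀ᶠ x in 𝓝 x₀, IsUnit (Z x) :=
    hcont.eventually (Units.isOpen.mem_nhds (by rw [hZ0]; exact isUnit_one))
  obtain ⟨r', hr', hr'u⟩ := Metric.eventually_nhds_iff_ball.1 hunit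
  have hm1 : ball x₀ (min r r') ⊆ ball x₀ r := ball_subset_ball (min_le_left _ _)
  have hm2 : ball x₀ (min r r') ⊆ U :=
    (hm1.trans (ball_subset_ball hrρ)).trans hsub
  refine ⟨min r r', by positivity, hm2, Z, hZ0, ?_, fun x hx => ⟨hZ x (hm1 hx),
    hr'u x (ball_subset_ball (min_le_right _ _) hx)⟩⟩
  -- Bootstrapping: the derivative A Z is as regular as Z itself, so each order of differentiability
  -- yields the next.
  rw [contDiffOn_infty]
  intro m
  induction m with
  | zero =>
    exact contDiffOn_zero.2 fun x hx => (hZ x (hm1 hx)).continuousAt.continuousWithinAt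
  | succ m ih =>
    have : ((m + 1 : ℕ) : WithTop ℕ∞) = (m : WithTop ℕ∞) + 1 := by norm_cast
    rw [this, contDiffOn_succ_iff_fderiv_of_isOpen isOpen_ball]
    refine ⟨fun x hx => (hZ x (hm1 hx)).differentiableAt.differentiableWithinAt, by simp, ?_⟩
    have h1 : ContDiffOn ℝ m (fun y => formMul (Z y) (A y)) (ball x₀ (min r r')) := by
      have h : ContDiffOn ℝ m (fun y => (ContinuousLinearMap.mul ℝ 𝔸).flip (Z y))
          (ball x₀ (min r r')) := contDiffOn_const.clm_apply ih
      exact h.clm_comp ((hA.mono hm2).of_le (by exact_mod_cast le_top))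
    exact h1.congr fun x hx => (hZ x (hm1 hx)).fderiv

end FlatSystems

/-! ### Parallel sections over a simply connected base. -/

open Filter Topology in
/-- A flat bundle over a simply connected base, given by local trivialisations `T i r : W ≃ W` whose
transition maps are locally constant, has a parallel section through every point. -/
theorem exists_parallel_section {B W ι : Type*} [TopologicalSpace B] [SimplyConnectedSpace B]
    [LocallyPathConnectedSpace B] (U : ι → Set B) (hU : ∀ i, IsOpen (U i)) (idx : B → ι)
    (hidx : ∀ x, x ∈ U (idx x)) (T : ι → B → W ≃ W)
    (hT : ∀ i j, ∀ r₀ ∈ U i ∩ U j, ∀ w, ∀ᶠ r in 𝓝 r₀,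
      (T j r).symm (T i r w) = (T j r₀).symm (T i r₀ w)) (p₀ : B) (w₀ : W) :
    ∃ σ : B → W, σ p₀ = w₀ ∧ ∀ i, ∀ r₀ ∈ U i, ∀ᶠ r in 𝓝 r₀,
      (T i r).symm (σ r) = (T i r₀).symm (σ r₀) := by
  let _ : TopologicalSpace W := ⊥
  have _ : DiscreteTopology W := ⟨rfl⟩
  let Z : FiberBundleCore ι B W :=
    { baseSet := U
      isOpen_baseSet := hU
      indexAt := idx
      mem_baseSet_at := hidx
      coordChange := fun i j r w => (T j r).symm (T i r w)
      coordChange_self := fun i x _ v => by simp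
      continuousOn_coordChange := fun i j => by
        rintro ⟨r₀, w⟩ ⟨hr, -⟩
        apply ContinuousAt.continuousWithinAt
        have h1 : ∀ᶠ p : B × W in 𝓝 (r₀, w),
            (T j p.1).symm (T i p.1 p.2) = (T j r₀).symm (T i r₀ w) := by
          have h2 : ∀ᶠ p : B × W in 𝓝 (r₀, w), p.2 = w := by
            have : Tendsto (fun p : B × W => p.2) (𝓝 (r₀, w)) (𝓝 w) := continuous_snd.tendsto _
            exact this.eventually (p := fun v => v = w) (by simp [nhds_discrete])
          have h3 : Tendsto (fun p : B × W => p.1) (𝓝 (r₀, w)) (𝓝 r₀) := continuous_fst.tendsto _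
          filter_upwards [h2, h3.eventually (hT i j r₀ hr w)] with p hp hq
          rw [hp, hq]
        exact (continuousAt_const.congr (h1.mono fun p hp => hp.symm))
      coordChange_comp := fun i j k x _ v => by simp }
  have hcov : IsCoveringMap (Bundle.TotalSpace.proj : Bundle.TotalSpace W Z.Fiber → B) :=
    FiberBundle.isCoveringMap
  obtain ⟨F, ⟨hF0, hF1⟩, -⟩ := hcov.existsUnique_continuousMap_lifts (ContinuousMap.id B) p₀
    (⟨p₀, (T (idx p₀) p₀).symm w₀⟩ : Bundle.TotalSpace W Z.Fiber) rfl
  have hproj : ∀ r, (F r).proj = r := fun r => congrFun hF1 r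
  let σ : B → W := fun r => T (idx (F r).proj) (F r).proj (F r).snd
  refine ⟨σ, ?_, fun i r₀ hr₀ => ?_⟩
  · have h : ∀ z : Bundle.TotalSpace W Z.Fiber, z = ⟨p₀, (T (idx p₀) p₀).symm w₀⟩ →
        T (idx z.proj) z.proj z.snd = w₀ := by
      rintro z rfl
      exact (T (idx p₀) p₀).apply_symm_apply w₀
    exact h _ hF0
  -- In the trivialisation with index i the lift reads (T i r).symm (σ r); being continuous with
  -- discrete values, it is locally constant.
  · have hc : ContinuousAt (fun r => ((Z.localTriv i) (F r)).2) r₀ := by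
      refine continuous_snd.continuousAt.comp (ContinuousAt.comp ?_ F.continuous.continuousAt)
      refine (Z.localTriv i).continuousOn_toFun.continuousAt ?_
      refine (Z.localTriv i).open_source.mem_nhds ?_
      rw [(Z.localTriv i).mem_source]
      change (F r₀).proj ∈ U i
      rw [hproj]; exact hr₀
    have h1 : ∀ r, ((Z.localTriv i) (F r)).2 = (T i r).symm (σ r) := fun r => by
      rw [Z.localTriv_apply]
      change (T i (F r).proj).symm (T (idx (F r).proj) (F r).proj (F r).snd) = _
      simp only [σ, hproj]
    have h2 := hc.tendsto.eventually (show {((Z.localTriv i) (F r₀)).2} ∈ 𝓝 _ by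
      simp [nhds_discrete])
    filter_upwards [h2] with r hr
    rw [← h1, ← h1]; exact hr

/-! ### Coordinate derivatives of functions and matrices. -/

section Calculus

open Filter Topology Matrix

variable {n : ℕ} {W : Type*} [NormedAddCommGroup W] [NormedSpace ℝ W]

theorem pd_congr {F G : Eu n → W} {x : Eu n} (h : F =ᶠ[𝓝 x] G) (i : Fin n) :
    pd i F x = pd i G x := by
  rw [pd, pd, h.fderiv_eq]

theorem pd_congr_on {O : Set (Eu n)} (hO : IsOpen O) {F G : Eu n → W} (h : ∀ y ∈ O, F y = G y)
    {x : Eu n} (hx : x ∈ O) (i : Fin n) : pd i F x = pd i G x :=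
  pd_congr (by filter_upwards [hO.mem_nhds hx] with y hy using h y hy) i

theorem pd_const (i : Fin n) (c : W) (x : Eu n) : pd i (fun _ => c) x = 0 := by
  simp [pd]

theorem pd_add {F G : Eu n → W} {x : Eu n} (hF : DifferentiableAt ℝ F x)
    (hG : DifferentiableAt ℝ G x) (i : Fin n) :
    pd i (fun y => F y + G y) x = pd i F x + pd i G x := by
  simp [pd, fderiv_fun_add hF hG]

theorem pd_sub {F G : Eu n → W} {x : Eu n} (hF : DifferentiableAt ℝ F x)
    (hG : DifferentiableAt ℝ G x) (i : Fin n) :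
    pd i (fun y => F y - G y) x = pd i F x - pd i G x := by
  simp [pd, fderiv_fun_sub hF hG]

theorem pd_sum {ι : Type*} {s : Finset ι} {F : ι → Eu n → W} {x : Eu n}
    (hF : ∀ a ∈ s, DifferentiableAt ℝ (F a) x) (i : Fin n) :
    pd i (fun y => ∑ a ∈ s, F a y) x = ∑ a ∈ s, pd i (F a) x := by
  simp [pd, fderiv_fun_sum hF]

theorem pd_smul {c : Eu n → ℝ} {F : Eu n → W} {x : Eu n} (hc : DifferentiableAt ℝ c x)
    (hF : DifferentiableAt ℝ F x) (i : Fin n) :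
    pd i (fun y => c y • F y) x = c x • pd i F x + pd i c x • F x := by
  simp [pd, fderiv_fun_smul hc hF]

theorem pd_mul {c d : Eu n → ℝ} {x : Eu n} (hc : DifferentiableAt ℝ c x)
    (hd : DifferentiableAt ℝ d x) (i : Fin n) :
    pd i (fun y => c y * d y) x = pd i c x * d x + c x * pd i d x := by
  have := pd_smul hc hd i
  simp only [smul_eq_mul] at this
  rw [this]; ring

theorem pd_const_smul (c : ℝ) {F : Eu n → W} {x : Eu n} (hF : DifferentiableAt ℝ F x)
    (i : Fin n) : pd i (fun y => c • F y) x = c • pd i F x := by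
  simp [pd, fderiv_fun_const_smul hF]

theorem pd_const_mul (c : ℝ) {F : Eu n → ℝ} {x : Eu n} (hF : DifferentiableAt ℝ F x)
    (i : Fin n) : pd i (fun y => c * F y) x = c * pd i F x :=
  pd_const_smul c hF i

theorem contDiffOn_pd {O : Set (Eu n)} (hO : IsOpen O) {F : Eu n → W} (hF : ContDiffOn ℝ ∞ F O)
    (i : Fin n) : ContDiffOn ℝ ∞ (pd i F) O :=
  (hF.fderiv_of_isOpen hO (by simp)).clm_apply contDiffOn_const

theorem differentiableAt_of_contDiffOn {O : Set (Eu n)} (hO : IsOpen O) {F : Eu n → W}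
    (hF : ContDiffOn ℝ ∞ F O) {x : Eu n} (hx : x ∈ O) : DifferentiableAt ℝ F x :=
  (hF.contDiffAt (hO.mem_nhds hx)).differentiableAt (by simp)

theorem pd_comm {O : Set (Eu n)} (hO : IsOpen O) {F : Eu n → W} (hF : ContDiffOn ℝ ∞ F O)
    {x : Eu n} (hx : x ∈ O) (i j : Fin n) : pd i (pd j F) x = pd j (pd i F) x := by
  have h1 := hF.contDiffAt (hO.mem_nhds hx)
  have h2 : DifferentiableAt ℝ (fderiv ℝ F) x :=
    (h1.fderiv_right (m := 1) (by norm_cast)).differentiableAt one_ne_zero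
  have h3 : ∀ v w : Eu n, fderiv ℝ (fun y => fderiv ℝ F y v) x w = fderiv ℝ (fderiv ℝ F) x w v := by
    intro v w
    rw [fderiv_clm_apply h2 (differentiableAt_const v)]
    simp
  have h4 : IsSymmSndFDerivAt ℝ F x := h1.isSymmSndFDerivAt (by simp; norm_cast)
  unfold pd
  rw [h3, h3]
  exact h4 _ _

theorem fderiv_eq_sum_pd {F : Eu n → W} {x : Eu n} (v : Eu n) :
    fderiv ℝ F x v = ∑ i, v i • pd i F x := by
  have h : v = ∑ i, v i • EuclideanSpace.single i (1 : ℝ) := by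
    ext j
    simp [Pi.single_apply]
  conv_lhs => rw [h]
  simp [pd]

/-! ### Matrix-valued functions -/

variable {α β γ : Type*}

/-- Entrywise partial derivative of a matrix-valued function. -/
def pdM (i : Fin n) (F : Eu n → Matrix α β ℝ) (x : Eu n) : Matrix α β ℝ :=
  Matrix.of fun a b => pd i (fun y => F y a b) x

/-- Entrywise smoothness of a matrix-valued function. -/
def SmoothM (O : Set (Eu n)) (F : Eu n → Matrix α β ℝ) : Prop :=
  ∀ a b, ContDiffOn ℝ ∞ (fun y => F y a b) O

@[simp] theorem pdM_apply (i : Fin n) (F : Eu n → Matrix α β ℝ) (x : Eu n) (a : α) (b : β) :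
    pdM i F x a b = pd i (fun y => F y a b) x := rfl

variable {O : Set (Eu n)} {F G : Eu n → Matrix α β ℝ} {x : Eu n}

theorem SmoothM.differentiableAt (hF : SmoothM O F) (hO : IsOpen O) (hx : x ∈ O) (a : α) (b : β) :
    DifferentiableAt ℝ (fun y => F y a b) x :=
  differentiableAt_of_contDiffOn hO (hF a b) hx

theorem SmoothM.add (hF : SmoothM O F) (hG : SmoothM O G) : SmoothM O fun y => F y + G y :=
  fun a b => (hF a b).add (hG a b)

theorem SmoothM.transpose (hF : SmoothM O F) : SmoothM O fun y => (F y)ᵀ := fun a b => hF b a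

theorem SmoothM.mul [Fintype β] {H : Eu n → Matrix β γ ℝ} (hF : SmoothM O F) (hH : SmoothM O H) :
    SmoothM O fun y => F y * H y := fun a b => by
  simp only [Matrix.mul_apply]
  exact ContDiffOn.sum fun c _ => (hF a c).mul (hH c b)

theorem SmoothM.congr (hF : SmoothM O F) (h : ∀ y ∈ O, G y = F y) : SmoothM O G :=
  fun a b => (hF a b).congr fun y hy => by rw [h y hy]

theorem SmoothM.det [Fintype α] [DecidableEq α] {F : Eu n → Matrix α α ℝ} (hF : SmoothM O F) :
    ContDiffOn ℝ ∞ (fun y => (F y).det) O := by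
  simp only [Matrix.det_apply]
  exact ContDiffOn.sum fun σ _ => (contDiffOn_prod fun c _ => hF (σ c) c).const_smul _

theorem SmoothM.inv [Fintype α] [DecidableEq α] {F : Eu n → Matrix α α ℝ} (hF : SmoothM O F)
    (hdet : ∀ y ∈ O, (F y).det ≠ 0) : SmoothM O fun y => (F y)⁻¹ := fun a b => by
  simp only [Matrix.inv_def, Ring.inverse_eq_inv', Matrix.smul_apply, smul_eq_mul,
    Matrix.adjugate_apply]
  refine (hF.det.inv hdet).mul (SmoothM.det fun c d => ?_)
  simp only [Matrix.updateRow_apply]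
  split_ifs
  · exact contDiffOn_const
  · exact hF c d

theorem pdM_congr_on (hO : IsOpen O) (h : ∀ y ∈ O, F y = G y) (hx : x ∈ O) (i : Fin n) :
    pdM i F x = pdM i G x := by
  ext a b
  exact pd_congr_on hO (fun y hy => by rw [h y hy]) hx i

theorem pdM_add (hO : IsOpen O) (hF : SmoothM O F) (hG : SmoothM O G) (hx : x ∈ O) (i : Fin n) :
    pdM i (fun y => F y + G y) x = pdM i F x + pdM i G x := by
  ext a b
  exact pd_add (hF.differentiableAt hO hx a b) (hG.differentiableAt hO hx a b) i

theorem pdM_const_smul (hO : IsOpen O) (c : ℝ) (hF : SmoothM O F) (hx : x ∈ O) (i : Fin n) :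
    pdM i (fun y => c • F y) x = c • pdM i F x := by
  ext a b
  exact pd_const_mul c (hF.differentiableAt hO hx a b) i

theorem pdM_transpose (i : Fin n) (x : Eu n) : pdM i (fun y => (F y)ᵀ) x = (pdM i F x)ᵀ := rfl

theorem pdM_mul [Fintype β] (hO : IsOpen O) {H : Eu n → Matrix β γ ℝ} (hF : SmoothM O F)
    (hH : SmoothM O H) (hx : x ∈ O) (i : Fin n) :
    pdM i (fun y => F y * H y) x = pdM i F x * H x + F x * pdM i H x := by
  ext a b
  simp only [pdM_apply, Matrix.mul_apply, Matrix.add_apply]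
  rw [pd_sum (F := fun c y => F y a c * H y c b) fun c _ =>
      (hF.differentiableAt hO hx a c).mul (hH.differentiableAt hO hx c b), ← Finset.sum_add_distrib]
  exact Finset.sum_congr rfl fun c _ =>
    pd_mul (hF.differentiableAt hO hx a c) (hH.differentiableAt hO hx c b) i

theorem pdM_comm (hO : IsOpen O) (hF : SmoothM O F) (hx : x ∈ O) (i j : Fin n) :
    pdM i (pdM j F) x = pdM j (pdM i F) x := by
  ext a b
  exact pd_comm hO (hF a b) hx i j

theorem pd_trace [Fintype α] (hO : IsOpen O) {F : Eu n → Matrix α α ℝ} (hF : SmoothM O F)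
    (hx : x ∈ O) (i : Fin n) : pd i (fun y => (F y).trace) x = (pdM i F x).trace := by
  simp only [Matrix.trace, Matrix.diag_apply]
  rw [pd_sum fun c _ => hF.differentiableAt hO hx c c]
  rfl

/-- Jacobi's formula: if `∂_i F = A F`, then `∂_i det F = tr A · det F`. -/
theorem pd_det [Fintype α] [DecidableEq α] (hO : IsOpen O) {F : Eu n → Matrix α α ℝ}
    (hF : SmoothM O F) (hx : x ∈ O) (i : Fin n) (A : Matrix α α ℝ) (hA : pdM i F x = A * F x) :
    pd i (fun y => (F y).det) x = A.trace * (F x).det := by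
  -- The determinant is differentiated as a multilinear function of the rows; replacing row a by row
  -- a of A F multiplies it by the diagonal entry A a a.
  let D : ContinuousMultilinearMap ℝ (fun _ : α => α → ℝ) ℝ :=
    { (Matrix.detRowAlternating (n := α) (R := ℝ)).toMultilinearMap with
      cont := by
        change Continuous fun m : α → α → ℝ => Matrix.det m
        exact continuous_id.matrix_det }
  have hrow : ∀ a, HasFDerivAt (fun y => F y a) (fderiv ℝ (fun y => F y a) x) x := fun a =>
    (differentiableAt_pi.2 fun b => hF.differentiableAt hO hx a b).hasFDerivAt
  have h1 : HasFDerivAt (fun y => D fun a => F y a) _ x := HasFDerivAt.multilinear_comp D hrow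
  have h2 : ∀ a, fderiv ℝ (fun y => F y a) x (EuclideanSpace.single i 1)
      = ∑ c, A a c • F x c := by
    intro a
    have h3 := hasFDerivAt_pi'.1 (hrow a)
    ext b
    have h4 := (h3 b).fderiv
    have h5 : pdM i F x a b = ∑ c, A a c * F x c b := by rw [hA, Matrix.mul_apply]
    rw [pdM_apply, pd, h4] at h5
    simpa using h5
  have h6 : pd i (fun y => (F y).det) x
      = ∑ a, D (Function.update (fun a => F x a) a (∑ c, A a c • F x c)) := by
    change fderiv ℝ (fun y => D fun a => F y a) x (EuclideanSpace.single i 1) = _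
    rw [h1.fderiv, _root_.sum_apply]
    exact Finset.sum_congr rfl fun a _ => by rw [← h2]; rfl
  rw [h6]
  rw [Matrix.trace, Finset.sum_mul]
  refine Finset.sum_congr rfl fun a _ => ?_
  have := Matrix.det_updateRow_sum (F x) a (A a)
  rw [smul_eq_mul] at this
  rw [Matrix.diag_apply, ← this]
  rfl

end Calculus

/-! ### Levi-Civita connection and curvature as matrices. -/

section Connections

open Filter Topology Matrix

variable {n : ℕ}

/-- The matrix of `∇_{∂_i}` in the coordinate frame. -/
def conM (Γ : Eu n → Fin n → Fin n → Fin n → ℝ) (i : Fin n) (x : Eu n) :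
    Matrix (Fin n) (Fin n) ℝ :=
  Matrix.of fun k j => Γ x k i j

/-- The curvature endomorphism `R(∂_i, ∂_j)` of the connection with matrices `Γ`. -/
def curvM (Γ : Fin n → Eu n → Matrix (Fin n) (Fin n) ℝ) (i j : Fin n) (x : Eu n) :
    Matrix (Fin n) (Fin n) ℝ :=
  pdM i (Γ j) x - pdM j (Γ i) x + Γ i x * Γ j x - Γ j x * Γ i x

theorem curvature_eq_curvM (Γ : Eu n → Fin n → Fin n → Fin n → ℝ) (x : Eu n) (l k i j : Fin n) :
    curvature Γ x l k i j = curvM (conM Γ) i j x l k := by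
  simp only [curvature, curvM, conM, Matrix.sub_apply, Matrix.add_apply, pdM_apply,
    Matrix.of_apply, Matrix.mul_apply, Finset.sum_sub_distrib]
  ring

theorem curvM_congr_on {O : Set (Eu n)} (hO : IsOpen O)
    {Γ Γ' : Fin n → Eu n → Matrix (Fin n) (Fin n) ℝ} (h : ∀ i, ∀ y ∈ O, Γ i y = Γ' i y)
    {x : Eu n} (hx : x ∈ O) (i j : Fin n) : curvM Γ i j x = curvM Γ' i j x := by
  rw [curvM, curvM, pdM_congr_on hO (h j) hx, pdM_congr_on hO (h i) hx, h i x hx, h j x hx]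

/-- A metric, given by its components on an open set. -/
structure IsMetricOn (O : Set (Eu n)) (g : Eu n → Matrix (Fin n) (Fin n) ℝ) : Prop where
  isOpen : IsOpen O
  smooth : SmoothM O g
  symm : ∀ x ∈ O, (g x)ᵀ = g x
  det_ne : ∀ x ∈ O, (g x).det ≠ 0

variable {O : Set (Eu n)} {g : Eu n → Matrix (Fin n) (Fin n) ℝ} {x : Eu n}

namespace IsMetricOn

theorem isUnit_det (hg : IsMetricOn O g) (hx : x ∈ O) : IsUnit (g x).det :=
  isUnit_iff_ne_zero.2 (hg.det_ne x hx)

theorem mul_inv (hg : IsMetricOn O g) (hx : x ∈ O) : g x * (g x)⁻¹ = 1 :=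
  Matrix.mul_nonsing_inv _ (hg.isUnit_det hx)

theorem inv_mul (hg : IsMetricOn O g) (hx : x ∈ O) : (g x)⁻¹ * g x = 1 :=
  Matrix.nonsing_inv_mul _ (hg.isUnit_det hx)

theorem mul_inv_cancel_left (hg : IsMetricOn O g) (hx : x ∈ O) (B : Matrix (Fin n) (Fin n) ℝ) :
    g x * ((g x)⁻¹ * B) = B := by
  rw [← Matrix.mul_assoc, hg.mul_inv hx, Matrix.one_mul]

theorem inv_mul_cancel_left (hg : IsMetricOn O g) (hx : x ∈ O) (B : Matrix (Fin n) (Fin n) ℝ) :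
    (g x)⁻¹ * (g x * B) = B := by
  rw [← Matrix.mul_assoc, hg.inv_mul hx, Matrix.one_mul]

theorem mul_left_cancel (hg : IsMetricOn O g) (hx : x ∈ O) {A B : Matrix (Fin n) (Fin n) ℝ}
    (h : g x * A = g x * B) : A = B := by
  rw [← hg.inv_mul_cancel_left hx A, h, hg.inv_mul_cancel_left hx]

theorem symm_apply (hg : IsMetricOn O g) (hx : x ∈ O) (i j : Fin n) : g x i j = g x j i := by
  conv_lhs => rw [← hg.symm x hx]
  rfl

theorem inv_symm (hg : IsMetricOn O g) (hx : x ∈ O) : ((g x)⁻¹)ᵀ = (g x)⁻¹ := by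
  rw [Matrix.transpose_nonsing_inv, hg.symm x hx]

theorem inv_symm_apply (hg : IsMetricOn O g) (hx : x ∈ O) (i j : Fin n) :
    (g x)⁻¹ i j = (g x)⁻¹ j i := by
  conv_lhs => rw [← hg.inv_symm hx]
  rfl

theorem smooth_inv (hg : IsMetricOn O g) : SmoothM O fun y => (g y)⁻¹ := hg.smooth.inv hg.det_ne

end IsMetricOn

/-- Christoffel symbols of the first kind, as matrices: `(lowChr g i x)_{lj} = Γ_{l,ij}`. -/
def lowChr (g : Eu n → Matrix (Fin n) (Fin n) ℝ) (i : Fin n) (x : Eu n) :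
    Matrix (Fin n) (Fin n) ℝ :=
  Matrix.of fun l j => (1 / 2) *
    (pd i (fun y => g y j l) x + pd j (fun y => g y i l) x - pd l (fun y => g y i j) x)

theorem conM_christoffel (g : Eu n → Matrix (Fin n) (Fin n) ℝ) (i : Fin n) (x : Eu n) :
    conM (christoffel g) i x = (g x)⁻¹ * lowChr g i x := by
  ext k j
  simp only [conM, christoffel, lowChr, Matrix.of_apply, Matrix.mul_apply, Finset.mul_sum]
  exact Finset.sum_congr rfl fun l _ => by ring

/-- The matrices of the Levi-Civita connection. -/
abbrev LC (g : Eu n → Matrix (Fin n) (Fin n) ℝ) (i : Fin n) (x : Eu n) :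
    Matrix (Fin n) (Fin n) ℝ := conM (christoffel g) i x

namespace IsMetricOn

theorem pd_symm (hg : IsMetricOn O g) (hx : x ∈ O) (i j k : Fin n) :
    pd i (fun y => g y j k) x = pd i (fun y => g y k j) x :=
  pd_congr_on hg.isOpen (fun _ hy => hg.symm_apply hy j k) hx i

theorem mul_LC (hg : IsMetricOn O g) (hx : x ∈ O) (i : Fin n) : g x * LC g i x = lowChr g i x := by
  rw [LC, conM_christoffel, hg.mul_inv_cancel_left hx]

theorem smooth_LC (hg : IsMetricOn O g) (i : Fin n) : SmoothM O (LC g i) := by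
  have h : SmoothM O (lowChr g i) := fun l j =>
    contDiffOn_const.mul (((contDiffOn_pd hg.isOpen (hg.smooth j l) i).add
      (contDiffOn_pd hg.isOpen (hg.smooth i l) j)).sub (contDiffOn_pd hg.isOpen (hg.smooth i j) l))
  exact (hg.smooth_inv.mul h).congr fun y _ => conM_christoffel g i y

theorem christoffel_symm (hg : IsMetricOn O g) (hx : x ∈ O) (k i j : Fin n) :
    christoffel g x k i j = christoffel g x k j i := by
  simp only [christoffel]
  congr 1
  refine Finset.sum_congr rfl fun l _ => ?_
  rw [hg.pd_symm hx l i j]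
  ring

theorem pdM_eq (hg : IsMetricOn O g) (hx : x ∈ O) (i : Fin n) :
    pdM i g x = g x * LC g i x + (LC g i x)ᵀ * g x := by
  have h : (LC g i x)ᵀ * g x = (g x * LC g i x)ᵀ := by
    rw [Matrix.transpose_mul, hg.symm x hx]
  rw [h, hg.mul_LC hx]
  ext a b
  simp only [pdM_apply, Matrix.add_apply, Matrix.transpose_apply, lowChr, Matrix.of_apply]
  rw [hg.pd_symm hx i b a]
  ring

/-- The curvature endomorphisms of the Levi-Civita connection are skew. -/
theorem curvM_skew (hg : IsMetricOn O g) (hx : x ∈ O) (i j : Fin n) :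
    (g x * curvM (LC g) i j x)ᵀ = -(g x * curvM (LC g) i j x) := by
  have hO := hg.isOpen
  -- This is metric compatibility differentiated once more. Since the second derivatives of g
  -- commute, exchanging i and j leaves exactly g R + (g R)ᵀ = 0.
  have hd : ∀ i j, pdM j (pdM i g) x
      = (g x * LC g j x + (LC g j x)ᵀ * g x) * LC g i x + g x * pdM j (LC g i) x
        + ((pdM j (LC g i) x)ᵀ * g x + (LC g i x)ᵀ * (g x * LC g j x + (LC g j x)ᵀ * g x)) := by
    intro i j
    rw [pdM_congr_on hO (fun y hy => hg.pdM_eq hy i) hx,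
      pdM_add hO (hg.smooth.mul (hg.smooth_LC i)) ((hg.smooth_LC i).transpose.mul hg.smooth) hx,
      pdM_mul hO hg.smooth (hg.smooth_LC i) hx,
      pdM_mul hO (hg.smooth_LC i).transpose hg.smooth hx, pdM_transpose, hg.pdM_eq hx]
  have h1 := hd i j
  rw [pdM_comm hO hg.smooth hx, hd j i] at h1
  have hs := hg.symm x hx
  rw [curvM]
  simp only [Matrix.transpose_mul, Matrix.transpose_add, Matrix.transpose_sub, hs]
  rw [← sub_eq_zero] at h1 ⊢
  rw [← h1]
  noncomm_ring

end IsMetricOn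

/-- The covariant derivative of a field of bilinear forms, without the term that differentiates
the frame vector labelling the field. -/
def covM (Γ : Fin n → Eu n → Matrix (Fin n) (Fin n) ℝ) (i : Fin n)
    (B : Eu n → Matrix (Fin n) (Fin n) ℝ) (x : Eu n) : Matrix (Fin n) (Fin n) ℝ :=
  pdM i B x - (Γ i x)ᵀ * B x - B x * Γ i x

/-- Lowering an index commutes with the Levi-Civita derivative. -/
theorem IsMetricOn.covM_mul (hg : IsMetricOn O g) (hx : x ∈ O) {T : Eu n → Matrix (Fin n) (Fin n) ℝ}
    (hT : SmoothM O T) (i : Fin n) :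
    covM (LC g) i (fun y => g y * T y) x
      = g x * (pdM i T x + LC g i x * T x - T x * LC g i x) := by
  rw [covM, pdM_mul hg.isOpen hg.smooth hT hx, hg.pdM_eq hx]
  noncomm_ring

/-- The curvature of a connection that differs from the Levi-Civita connection by a tensor. -/
theorem IsMetricOn.mul_curvM_add (hg : IsMetricOn O g) (hx : x ∈ O)
    {T : Fin n → Eu n → Matrix (Fin n) (Fin n) ℝ} (hT : ∀ i, SmoothM O (T i)) (i j : Fin n) :
    g x * curvM (fun k y => LC g k y + T k y) i j x
      = g x * curvM (LC g) i j x + (covM (LC g) i (fun y => g y * T j y) x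
          - covM (LC g) j (fun y => g y * T i y) x)
        + (g x * T i x * T j x - g x * T j x * T i x) := by
  -- `covM` may omit the term for the frame label: for a torsion-free connection it is symmetric in
  -- i and j and would cancel in the difference.
  have hO := hg.isOpen
  rw [hg.covM_mul hx (hT j), hg.covM_mul hx (hT i), curvM, curvM,
    pdM_add hO (hg.smooth_LC j) (hT j) hx, pdM_add hO (hg.smooth_LC i) (hT i) hx]
  noncomm_ring

/-- The Kulkarni-Nomizu product as a matrix in the last two indices. -/
def knM (B : Fin n → Fin n → ℝ) (h : Matrix (Fin n) (Fin n) ℝ) (i j : Fin n) :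
    Matrix (Fin n) (Fin n) ℝ :=
  Matrix.of fun k l => kulkarniNomizu B (fun a b => h a b) i j k l

theorem riem_eq (g : Eu n → Matrix (Fin n) (Fin n) ℝ) (Γ : Eu n → Fin n → Fin n → Fin n → ℝ)
    (x : Eu n) (i j k l : Fin n) : riem g Γ x i j k l = (g x * curvM (conM Γ) i j x) k l := by
  simp only [riem, curvature_eq_curvM, Matrix.mul_apply]

/-- This skewness makes `IsMetricOn.cubic_of_skew` applicable to any curvature of Kulkarni-Nomizu
form. -/
theorem knM_transpose (B : Fin n → Fin n → ℝ) (h : Matrix (Fin n) (Fin n) ℝ) (i j : Fin n) :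
    (knM B h i j)ᵀ = -knM B h i j := by
  ext k l
  simp only [knM, kulkarniNomizu, Matrix.transpose_apply, Matrix.of_apply, Matrix.neg_apply]
  ring

theorem ricci_eq (Γ : Eu n → Fin n → Fin n → Fin n → ℝ) (x : Eu n) (i j : Fin n) :
    ricci Γ x i j = ∑ l, curvM (conM Γ) l i x l j := by
  simp only [ricci, curvature_eq_curvM]

end Connections

/-! ### Conformally flat metrics and the Schouten tensor. -/

section Conformal

open Filter Topology Matrix

variable {n : ℕ} {O : Set (Eu n)} {g : Eu n → Matrix (Fin n) (Fin n) ℝ} {x : Eu n}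

theorem IsMetricOn.sum_inv_mul (hg : IsMetricOn O g) (hx : x ∈ O) (i j : Fin n) :
    ∑ a, (g x)⁻¹ i a * g x a j = if i = j then 1 else 0 := by
  rw [← Matrix.mul_apply, hg.inv_mul hx, Matrix.one_apply]

theorem IsMetricOn.sum_mul_inv (hg : IsMetricOn O g) (hx : x ∈ O) (i j : Fin n) :
    ∑ a, g x i a * (g x)⁻¹ a j = if i = j then 1 else 0 := by
  rw [← Matrix.mul_apply, hg.mul_inv hx, Matrix.one_apply]

theorem IsMetricOn.tr2_self (hg : IsMetricOn O g) (hx : x ∈ O) :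
    tr2 (g x) (fun i j => g x i j) = n := by
  have h : ∀ i, ∑ j, (g x)⁻¹ i j * g x i j = 1 := fun i => by
    simp only [hg.symm_apply hx i]
    rw [hg.sum_inv_mul hx, if_pos rfl]
  simp [tr2, h]

theorem tr2_add (h : Matrix (Fin n) (Fin n) ℝ) (B C : Fin n → Fin n → ℝ) :
    tr2 h (fun i j => B i j + C i j) = tr2 h B + tr2 h C := by
  simp [tr2, mul_add, Finset.sum_add_distrib]

theorem tr2_smul (h : Matrix (Fin n) (Fin n) ℝ) (c : ℝ) (B : Fin n → Fin n → ℝ) :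
    tr2 h (fun i j => c * B i j) = c * tr2 h B := by
  simp only [tr2, Finset.mul_sum]
  exact Finset.sum_congr rfl fun i _ => Finset.sum_congr rfl fun j _ => by ring

theorem tr2_congr {h : Matrix (Fin n) (Fin n) ℝ} {B C : Fin n → Fin n → ℝ}
    (hBC : ∀ i j, B i j = C i j) : tr2 h B = tr2 h C := by
  simp only [tr2, hBC]

/-- The Ricci contraction of a Kulkarni-Nomizu product with the metric. -/
theorem IsMetricOn.contract_kn (hg : IsMetricOn O g) (hx : x ∈ O) {B : Fin n → Fin n → ℝ}
    {K : Fin n → Fin n → Matrix (Fin n) (Fin n) ℝ}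
    (hK : ∀ i j, g x * K i j = knM B (g x) i j) (i j : Fin n) :
    ∑ l, K l i l j = ((n : ℝ) - 2) * B i j + tr2 (g x) B * g x i j := by
  have h1 : ∀ l i, K l i = (g x)⁻¹ * knM B (g x) l i := fun l i => by
    rw [← hK, hg.inv_mul_cancel_left hx]
  have h2 : ∀ l k, (g x)⁻¹ l k * kulkarniNomizu B (fun a b => g x a b) l i k j
      = (g x)⁻¹ l k * B l k * g x i j + B i j * ((g x)⁻¹ l k * g x k l)
        - B l j * ((g x)⁻¹ l k * g x k i) - (g x j l * (g x)⁻¹ l k) * B i k := by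
    intro l k
    rw [kulkarniNomizu, hg.symm_apply hx l k, hg.symm_apply hx i k, hg.symm_apply hx l j]
    ring
  have h3 : ∑ l, ∑ k, (g x j l * (g x)⁻¹ l k) * B i k = B i j := by
    rw [Finset.sum_comm]
    simp [← Finset.sum_mul, hg.sum_mul_inv hx]
  simp only [h1, Matrix.mul_apply, knM, Matrix.of_apply, h2, Finset.sum_sub_distrib,
    Finset.sum_add_distrib, h3]
  simp only [← Finset.mul_sum, ← Finset.sum_mul, hg.sum_inv_mul hx]
  simp [tr2]
  ring

/-- If the curvature is a Kulkarni-Nomizu product with the metric, the other factor is the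
Schouten-type tensor. -/
theorem IsMetricOn.eq_schoutenOf (hg : IsMetricOn O g) (hx : x ∈ O) (hn : 3 ≤ n)
    {Γ : Eu n → Fin n → Fin n → Fin n → ℝ} {B : Fin n → Fin n → ℝ}
    (hK : ∀ i j, g x * curvM (conM Γ) i j x = knM B (g x) i j) (i j : Fin n) :
    B i j = schoutenOf g Γ x i j := by
  have hn' : (3 : ℝ) ≤ n := by exact_mod_cast hn
  -- For n ≥ 3 the map B ↦ (n - 2) B + tr(B) g is invertible, and the Schouten formula is its
  -- inverse.
  have h1 : ∀ i j, ricci Γ x i j = ((n : ℝ) - 2) * B i j + tr2 (g x) B * g x i j := fun i j => by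
    rw [ricci_eq, hg.contract_kn hx hK]
  have h2 : tr2 (g x) (ricci Γ x) = (2 * (n : ℝ) - 2) * tr2 (g x) B := by
    rw [tr2_congr h1, tr2_add, tr2_smul, tr2_smul _ _ fun i j => g x i j, hg.tr2_self hx]
    ring
  rw [schoutenOf, h2, h1]
  have h3 : (n : ℝ) - 2 ≠ 0 := by linarith
  have h4 : (n : ℝ) - 1 ≠ 0 := by linarith
  field_simp
  ring

theorem IsMetricOn.conformal (hg : IsMetricOn O g) {φ : Eu n → ℝ} (hφ : ContDiffOn ℝ ∞ φ O) :
    IsMetricOn O fun y => Real.exp (2 * φ y) • g y where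
  isOpen := hg.isOpen
  smooth := fun a b => ((contDiffOn_const.mul hφ).exp).mul (hg.smooth a b)
  symm := fun y hy => by rw [Matrix.transpose_smul, hg.symm y hy]
  det_ne := fun y hy => by
    rw [Matrix.det_smul]
    exact mul_ne_zero (pow_ne_zero _ (Real.exp_pos _).ne') (hg.det_ne y hy)

/-- The difference of the Levi-Civita connections of `e^{2φ} g` and `g`, with lowered index. -/
def conformalLow (g : Eu n → Matrix (Fin n) (Fin n) ℝ) (φ : Eu n → ℝ) (i : Fin n) (x : Eu n) :
    Matrix (Fin n) (Fin n) ℝ :=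
  Matrix.of fun k j => pd i φ x * g x k j + g x k i * pd j φ x - pd k φ x * g x i j

theorem IsMetricOn.lowChr_conformal (hg : IsMetricOn O g) {φ : Eu n → ℝ}
    (hφ : ContDiffOn ℝ ∞ φ O) (hx : x ∈ O) (i : Fin n) :
    lowChr (fun y => Real.exp (2 * φ y) • g y) i x
      = Real.exp (2 * φ x) • (lowChr g i x + conformalLow g φ i x) := by
  have hd := differentiableAt_of_contDiffOn hg.isOpen hφ hx
  have he : ∀ a, pd a (fun y => Real.exp (2 * φ y)) x = Real.exp (2 * φ x) * (2 * pd a φ x) := by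
    intro a
    have h := ((hd.hasFDerivAt.const_mul 2).exp).fderiv
    simp [pd, h]
  have hp : ∀ a b c, pd a (fun y => Real.exp (2 * φ y) * g y b c) x
      = Real.exp (2 * φ x) * (2 * pd a φ x * g x b c + pd a (fun y => g y b c) x) := by
    intro a b c
    have h := pd_mul (i := a) ((hd.const_mul 2).exp) (hg.smooth.differentiableAt hg.isOpen hx b c)
    rw [h, he]
    ring
  ext l j
  simp only [lowChr, conformalLow, Matrix.of_apply, Matrix.smul_apply, Matrix.add_apply,
    smul_eq_mul]
  simp only [hp]
  rw [hg.symm_apply hx j l, hg.symm_apply hx i l]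
  ring

theorem IsMetricOn.LC_conformal (hg : IsMetricOn O g) {φ : Eu n → ℝ}
    (hφ : ContDiffOn ℝ ∞ φ O) (hx : x ∈ O) (i : Fin n) :
    LC (fun y => Real.exp (2 * φ y) • g y) i x = LC g i x + (g x)⁻¹ * conformalLow g φ i x := by
  apply hg.mul_left_cancel hx
  rw [Matrix.mul_add, hg.mul_LC hx, hg.mul_inv_cancel_left hx]
  have h := (hg.conformal hφ).mul_LC hx i
  rw [hg.lowChr_conformal hφ hx, Matrix.smul_mul] at h
  exact smul_right_injective _ (Real.exp_pos _).ne' h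

/-- The tensor `∇dφ - dφ ⊗ dφ + |dφ|²/2 g`. -/
def conformalTensor (g : Eu n → Matrix (Fin n) (Fin n) ℝ) (φ : Eu n → ℝ) (x : Eu n)
    (i j : Fin n) : ℝ :=
  pd i (pd j φ) x - ∑ a, christoffel g x a i j * pd a φ x - pd i φ x * pd j φ x
    + (∑ a, pd a φ x * ∑ b, (g x)⁻¹ a b * pd b φ x) / 2 * g x i j

/-- The derivatives of g are rewritten through the connection. What survives are two terms with the
Hessian of φ and terms symmetric in i and j, which disappear from the curvature. -/
theorem IsMetricOn.covM_conformalLow (hg : IsMetricOn O g) {φ : Eu n → ℝ}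
    (hφ : ContDiffOn ℝ ∞ φ O) (hx : x ∈ O) (i j k l : Fin n) :
    covM (LC g) i (conformalLow g φ j) x k l
      = pd i (pd j φ) x * g x k l + (∑ a, g x k a * christoffel g x a i j) * pd l φ x
        + g x k j * (pd i (pd l φ) x - ∑ a, christoffel g x a i l * pd a φ x)
        - (pd i (pd k φ) x - ∑ a, christoffel g x a i k * pd a φ x) * g x j l
        - pd k φ x * ∑ a, g x l a * christoffel g x a i j := by
  have hd : ∀ a, DifferentiableAt ℝ (pd a φ) x := fun a =>
    differentiableAt_of_contDiffOn hg.isOpen (contDiffOn_pd hg.isOpen hφ a) hx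
  have hgd := fun a b => hg.smooth.differentiableAt hg.isOpen hx a b
  have hpg : ∀ a b, pd i (fun y => g y a b) x
      = ∑ c, g x a c * christoffel g x c i b + ∑ c, g x b c * christoffel g x c i a := by
    intro a b
    have h := congrFun (congrFun (hg.pdM_eq hx i) a) b
    simp only [pdM_apply, Matrix.add_apply, Matrix.mul_apply, Matrix.transpose_apply, conM,
      Matrix.of_apply] at h
    rw [h]
    congr 1
    exact Finset.sum_congr rfl fun c _ => by rw [hg.symm_apply hx c b]; ring
  have hp : pd i (fun y => conformalLow g φ j y k l) x
      = (pd i (pd j φ) x * g x k l + pd j φ x * pd i (fun y => g y k l) x)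
        + (pd i (fun y => g y k j) x * pd l φ x + g x k j * pd i (pd l φ) x)
        - (pd i (pd k φ) x * g x j l + pd k φ x * pd i (fun y => g y j l) x) := by
    simp only [conformalLow, Matrix.of_apply]
    rw [pd_sub (F := fun y => pd j φ y * g y k l + g y k j * pd l φ y)
        (G := fun y => pd k φ y * g y j l)
        (((hd j).mul (hgd k l)).add ((hgd k j).mul (hd l))) ((hd k).mul (hgd j l)),
      pd_add (F := fun y => pd j φ y * g y k l) (G := fun y => g y k j * pd l φ y)
        ((hd j).mul (hgd k l)) ((hgd k j).mul (hd l)), pd_mul (hd j) (hgd k l),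
      pd_mul (hgd k j) (hd l), pd_mul (hd k) (hgd j l)]
  have h1 : ((LC g i x)ᵀ * conformalLow g φ j x) k l
      = pd j φ x * ∑ c, g x l c * christoffel g x c i k
        + (∑ c, g x j c * christoffel g x c i k) * pd l φ x
        - (∑ a, christoffel g x a i k * pd a φ x) * g x j l := by
    simp only [Matrix.mul_apply, Matrix.transpose_apply, conM, Matrix.of_apply, conformalLow,
      Finset.mul_sum, Finset.sum_mul]
    rw [← Finset.sum_add_distrib, ← Finset.sum_sub_distrib]
    exact Finset.sum_congr rfl fun c _ => by
      rw [hg.symm_apply hx c l, hg.symm_apply hx c j]; ring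
  have h2 : (conformalLow g φ j x * LC g i x) k l
      = pd j φ x * ∑ c, g x k c * christoffel g x c i l
        + g x k j * (∑ a, christoffel g x a i l * pd a φ x)
        - pd k φ x * ∑ c, g x j c * christoffel g x c i l := by
    simp only [Matrix.mul_apply, conM, Matrix.of_apply, conformalLow,
      Finset.mul_sum]
    rw [← Finset.sum_add_distrib, ← Finset.sum_sub_distrib]
    exact Finset.sum_congr rfl fun c _ => by ring
  rw [covM, Matrix.sub_apply, Matrix.sub_apply, pdM_apply, hp, h1, h2, hpg, hpg, hpg]
  ring

theorem IsMetricOn.conformalLow_mul (hg : IsMetricOn O g) (φ : Eu n → ℝ) (hx : x ∈ O)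
    (i j k l : Fin n) :
    (conformalLow g φ i x * ((g x)⁻¹ * conformalLow g φ j x)) k l
      = pd i φ x * (pd j φ x * g x k l + g x k j * pd l φ x - pd k φ x * g x j l)
        + g x k i * (2 * pd j φ x * pd l φ x
          - (∑ a, pd a φ x * ∑ b, (g x)⁻¹ a b * pd b φ x) * g x j l)
        - pd k φ x * (pd j φ x * g x i l + g x i j * pd l φ x - pd i φ x * g x j l) := by
  set v : Fin n → ℝ := fun a => ∑ b, (g x)⁻¹ a b * pd b φ x with hv
  have hT : (g x)⁻¹ * conformalLow g φ j x = Matrix.of fun a l =>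
      pd j φ x * (if a = l then 1 else 0) + (if a = j then 1 else 0) * pd l φ x
        - v a * g x j l := by
    ext a l
    simp only [Matrix.mul_apply, conformalLow, Matrix.of_apply, hv]
    rw [← hg.sum_inv_mul hx, ← hg.sum_inv_mul hx, Finset.mul_sum, Finset.sum_mul, Finset.sum_mul,
      ← Finset.sum_add_distrib, ← Finset.sum_sub_distrib]
    exact Finset.sum_congr rfl fun c _ => by ring
  have hgv : ∀ k, ∑ a, g x k a * v a = pd k φ x := by
    intro k
    have h : g x *ᵥ ((g x)⁻¹ *ᵥ fun b => pd b φ x) = fun b => pd b φ x := by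
      rw [Matrix.mulVec_mulVec, hg.mul_inv hx, Matrix.one_mulVec]
    exact congrFun h k
  have h1 : ∀ a, conformalLow g φ i x k a * (pd j φ x * (if a = l then 1 else 0)
      + (if a = j then 1 else 0) * pd l φ x - v a * g x j l)
      = (if a = l then pd j φ x * conformalLow g φ i x k a else 0)
        + (if a = j then conformalLow g φ i x k a * pd l φ x else 0)
        - g x j l * (pd i φ x * (g x k a * v a) + g x k i * (pd a φ x * v a)
          - pd k φ x * (g x i a * v a)) := by
    intro a
    simp only [conformalLow, Matrix.of_apply]
    split_ifs <;> ring
  rw [hT]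
  simp only [Matrix.mul_apply, Matrix.of_apply, h1, Finset.sum_sub_distrib, Finset.sum_add_distrib,
    ← Finset.mul_sum, hgv, Finset.sum_ite_eq', Finset.mem_univ, if_true]
  simp only [conformalLow, Matrix.of_apply]
  ring

/-- If `e^{2φ} g` is flat at a point, the curvature of `g` is a Kulkarni-Nomizu product. -/
theorem IsMetricOn.curvM_of_conformal_flat (hg : IsMetricOn O g) {φ : Eu n → ℝ}
    (hφ : ContDiffOn ℝ ∞ φ O) (hx : x ∈ O)
    (hflat : ∀ l k i j, curvature (christoffel fun y => Real.exp (2 * φ y) • g y) x l k i j = 0)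
    (i j : Fin n) :
    g x * curvM (LC g) i j x = knM (conformalTensor g φ x) (g x) i j := by
  have hO := hg.isOpen
  have hlow : ∀ i, SmoothM O (conformalLow g φ i) := fun i k l =>
    (((contDiffOn_pd hO hφ i).mul (hg.smooth k l)).add
      ((hg.smooth k i).mul (contDiffOn_pd hO hφ l))).sub
      ((contDiffOn_pd hO hφ k).mul (hg.smooth i l))
  have hT : ∀ i, SmoothM O fun y => (g y)⁻¹ * conformalLow g φ i y := fun i =>
    hg.smooth_inv.mul (hlow i)
  have h0 : curvM (LC fun y => Real.exp (2 * φ y) • g y) i j x = 0 := by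
    ext l k
    rw [← curvature_eq_curvM]
    exact hflat l k i j
  have h1 := hg.mul_curvM_add hx hT i j
  -- The rescaled metric is flat at x, so the curvature of g is minus the terms in φ;
  -- antisymmetrised, these form a Kulkarni-Nomizu product.
  rw [← curvM_congr_on hO (fun i y hy => hg.LC_conformal hφ hy i) hx, h0, Matrix.mul_zero] at h1
  have hcov : ∀ i j, covM (LC g) i (fun y => g y * ((g y)⁻¹ * conformalLow g φ j y)) x
      = covM (LC g) i (conformalLow g φ j) x := by
    intro i j
    rw [covM, covM, pdM_congr_on hO (fun y hy => hg.mul_inv_cancel_left hy _) hx,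
      hg.mul_inv_cancel_left hx]
  rw [hcov, hcov, hg.mul_inv_cancel_left hx, hg.mul_inv_cancel_left hx] at h1
  ext k l
  have h2 := congrFun (congrFun h1 k) l
  simp only [Matrix.add_apply, Matrix.sub_apply, hg.covM_conformalLow hφ hx,
    hg.conformalLow_mul φ hx, Matrix.zero_apply] at h2
  simp only [knM, kulkarniNomizu, Matrix.of_apply, conformalTensor]
  rw [pd_comm hO hφ hx j i] at h2
  simp only [hg.christoffel_symm hx _ j i, hg.symm_apply hx j i] at h2
  rw [hg.symm_apply hx k i, hg.symm_apply hx k j] at h2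
  linarith

end Conformal

/-! ### Cubic forms T and the connections ∇^g + T̂. -/

section Cubics

open Filter Topology Matrix

variable {n : ℕ} {O : Set (Eu n)} {g : Eu n → Matrix (Fin n) (Fin n) ℝ} {x : Eu n}

/-- The matrix of the bilinear form `T(∂_i, ·, ·)`. -/
def lowM (T : Eu n → Fin n → Fin n → Fin n → ℝ) (i : Fin n) (x : Eu n) :
    Matrix (Fin n) (Fin n) ℝ :=
  Matrix.of fun j k => T x i j k

/-- A smooth totally symmetric cubic form, given by its components on an open set. -/
structure IsCubicOn (O : Set (Eu n)) (T : Eu n → Fin n → Fin n → Fin n → ℝ) : Prop where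
  smooth : ∀ i j k, ContDiffOn ℝ ∞ (fun y => T y i j k) O
  symm₁₂ : ∀ x ∈ O, ∀ i j k, T x i j k = T x j i k
  symm₂₃ : ∀ x ∈ O, ∀ i j k, T x i j k = T x i k j

variable {T : Eu n → Fin n → Fin n → Fin n → ℝ}

theorem IsCubicOn.smoothM (hT : IsCubicOn O T) (i : Fin n) : SmoothM O (lowM T i) :=
  fun j k => hT.smooth i j k

theorem IsCubicOn.transpose (hT : IsCubicOn O T) (hx : x ∈ O) (i : Fin n) :
    (lowM T i x)ᵀ = lowM T i x := by
  ext j k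
  exact hT.symm₂₃ x hx i k j

theorem IsCubicOn.smul (hT : IsCubicOn O T) (c : ℝ) :
    IsCubicOn O fun y i j k => c * T y i j k where
  smooth := fun i j k => contDiffOn_const.mul (hT.smooth i j k)
  symm₁₂ := fun x hx i j k => by rw [hT.symm₁₂ x hx]
  symm₂₃ := fun x hx i j k => by rw [hT.symm₂₃ x hx]

theorem lowM_smul (c : ℝ) (i : Fin n) (x : Eu n) :
    lowM (fun y i j k => c * T y i j k) i x = c • lowM T i x := rfl

theorem IsCubicOn.raise3_eq (hT : IsCubicOn O T) (hx : x ∈ O) (k i j : Fin n) :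
    raise3 (g x) (T x) k i j = ((g x)⁻¹ * lowM T i x) k j := by
  simp only [raise3, Matrix.mul_apply, lowM, Matrix.of_apply]
  exact Finset.sum_congr rfl fun l _ => by rw [hT.symm₂₃ x hx i j l]

/-- The endomorphism `T_i`. -/
def raiseM (g : Eu n → Matrix (Fin n) (Fin n) ℝ) (T : Eu n → Fin n → Fin n → Fin n → ℝ)
    (i : Fin n) (x : Eu n) : Matrix (Fin n) (Fin n) ℝ := (g x)⁻¹ * lowM T i x

theorem IsCubicOn.smooth_raiseM (hT : IsCubicOn O T) (hg : IsMetricOn O g) (i : Fin n) :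
    SmoothM O (raiseM g T i) := hg.smooth_inv.mul (hT.smoothM i)

theorem IsCubicOn.raiseM_symm (hT : IsCubicOn O T) (hx : x ∈ O) (k i j : Fin n) :
    raiseM g T i x k j = raiseM g T j x k i := by
  simp only [raiseM, Matrix.mul_apply, lowM, Matrix.of_apply]
  refine Finset.sum_congr rfl fun l _ => ?_
  rw [hT.symm₂₃ x hx i l j, hT.symm₁₂ x hx i j l, hT.symm₂₃ x hx j i l]

theorem IsMetricOn.mul_raiseM (hg : IsMetricOn O g) (hx : x ∈ O) (i : Fin n) :
    g x * raiseM g T i x = lowM T i x := hg.mul_inv_cancel_left hx _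

theorem IsCubicOn.trSq_eq (hT : IsCubicOn O T) (hx : x ∈ O) (i j : Fin n) :
    trSq (g x) (T x) i j = (raiseM g T i x * raiseM g T j x).trace := by
  simp only [trSq, hT.raise3_eq hx, Matrix.trace, Matrix.diag_apply, Matrix.mul_apply, raiseM]

/-- Evaluates the factor whenever tr(T_X T_Y) = κ g: taking the trace gives |T|² = nκ. Apart from
one use of the symmetry of T and of the inverse metric, the sums are only reordered. -/
theorem IsCubicOn.normSq3_eq (hT : IsCubicOn O T) (hg : IsMetricOn O g) (hx : x ∈ O) :
    normSq3 (g x) (T x) = tr2 (g x) (trSq (g x) (T x)) := by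
  simp only [normSq3, tr2, trSq, raise3, Finset.mul_sum, Finset.sum_mul]
  refine Finset.sum_congr rfl fun i _ => ?_
  have h1 : ∀ j, (∑ k, ∑ a, ∑ b, ∑ c, (g x)⁻¹ i a * (g x)⁻¹ j b * (g x)⁻¹ k c * T x i j k * T x a b c)
      = ∑ a, ∑ k, ∑ b, ∑ c, (g x)⁻¹ i a * (g x)⁻¹ j b * (g x)⁻¹ k c * T x i j k * T x a b c :=
    fun j => Finset.sum_comm
  simp only [h1]
  rw [Finset.sum_comm]
  refine Finset.sum_congr rfl fun a _ => ?_
  have h2 : ∀ j, (∑ k, ∑ b, ∑ c, (g x)⁻¹ i a * (g x)⁻¹ j b * (g x)⁻¹ k c * T x i j k * T x a b c)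
      = ∑ c, ∑ k, ∑ b, (g x)⁻¹ i a * (g x)⁻¹ j b * (g x)⁻¹ k c * T x i j k * T x a b c := by
    intro j
    rw [Finset.sum_comm]
    refine (Finset.sum_congr rfl fun b _ => Finset.sum_comm).trans ?_
    rw [Finset.sum_comm]
    exact Finset.sum_congr rfl fun c _ => Finset.sum_comm
  simp only [h2]
  rw [Finset.sum_comm]
  refine Finset.sum_congr rfl fun c _ => Finset.sum_congr rfl fun j _ => ?_
  rw [Finset.sum_comm]
  refine Finset.sum_congr rfl fun b _ => Finset.sum_congr rfl fun k _ => ?_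
  rw [hg.inv_symm_apply hx k c, hT.symm₂₃ x hx a b c]
  ring

theorem IsCubicOn.trace_raiseM (hT : IsCubicOn O T) (hg : IsMetricOn O g) (hx : x ∈ O)
    (i : Fin n) : (raiseM g T i x).trace = tr2 (g x) (T x i) := by
  simp only [Matrix.trace, Matrix.diag_apply, raiseM, Matrix.mul_apply, lowM, Matrix.of_apply, tr2]
  exact Finset.sum_congr rfl fun a _ => Finset.sum_congr rfl fun b _ => by
    rw [hT.symm₂₃ x hx i b a]

/-- The Ricci contraction of the commutator of a trace-free cubic. -/
theorem IsCubicOn.contract_commutator (hT : IsCubicOn O T) (hx : x ∈ O)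
    (htr : ∀ i, (raiseM g T i x).trace = 0) (i j : Fin n) :
    ∑ l, (raiseM g T l x * raiseM g T i x - raiseM g T i x * raiseM g T l x) l j
      = -trSq (g x) (T x) i j := by
  rw [hT.trSq_eq hx]
  simp only [Matrix.sub_apply, Finset.sum_sub_distrib, Matrix.mul_apply, Matrix.trace,
    Matrix.diag_apply]
  -- By the symmetry of T the contraction of the first product contains the trace of T_a and
  -- vanishes; the second product contributes tr(T_i T_j).
  have h1 : ∑ l, ∑ a, raiseM g T l x l a * raiseM g T i x a j = 0 := by
    rw [Finset.sum_comm]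
    refine Finset.sum_eq_zero fun a _ => ?_
    have h2 : ∑ l, raiseM g T l x l a = (raiseM g T a x).trace := by
      simp only [Matrix.trace, Matrix.diag_apply]
      exact Finset.sum_congr rfl fun l _ => hT.raiseM_symm hx l l a
    rw [← Finset.sum_mul, h2, htr, zero_mul]
  rw [h1, zero_sub]
  congr 1
  exact Finset.sum_congr rfl fun l _ => Finset.sum_congr rfl fun a _ => by
    rw [hT.raiseM_symm hx a l j]

theorem covM_smul (hg : IsMetricOn O g) {B : Eu n → Matrix (Fin n) (Fin n) ℝ} (hB : SmoothM O B)
    (hx : x ∈ O) (c : ℝ) (i : Fin n) :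
    covM (LC g) i (fun y => c • B y) x = c • covM (LC g) i B x := by
  rw [covM, covM, pdM_const_smul hg.isOpen c hB hx]
  simp [smul_sub]

/-- The curvature of the connection `∇ = ∇^g + T̂`, split into its skew and symmetric parts. -/
theorem IsMetricOn.curvM_add_cubic (hg : IsMetricOn O g) (hT : IsCubicOn O T) (hx : x ∈ O)
    (i j : Fin n) :
    g x * curvM (fun k y => LC g k y + raiseM g T k y) i j x
      = g x * curvM (LC g) i j x
        + (covM (LC g) i (lowM T j) x - covM (LC g) j (lowM T i) x)
        + g x * (raiseM g T i x * raiseM g T j x - raiseM g T j x * raiseM g T i x) := by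
  rw [hg.mul_curvM_add hx (fun i => hT.smooth_raiseM hg i)]
  have hcov : ∀ i j, covM (LC g) i (fun y => g y * raiseM g T j y) x
      = covM (LC g) i (lowM T j) x := by
    intro i j
    rw [covM, covM, pdM_congr_on hg.isOpen (fun y hy => hg.mul_raiseM hy j) hx, hg.mul_raiseM hx]
  rw [hcov, hcov]
  noncomm_ring

/-- In `IsMetricOn.curvM_add_cubic` the Riemann tensor and the commutator are skew in the last two
arguments, while the derivative term is symmetric. If the sum is skew, the symmetric part vanishes,
and one curvature identity splits into a Codazzi equation for T and an algebraic formula for the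
commutators. Both the curvature condition on ∇^S and the Gauss equation are exploited in this way.
-/
theorem IsMetricOn.cubic_of_skew (hg : IsMetricOn O g) (hT : IsCubicOn O T) (hx : x ∈ O)
    {i j : Fin n} (hskew : (g x * curvM (fun k y => LC g k y + raiseM g T k y) i j x)ᵀ
      = -(g x * curvM (fun k y => LC g k y + raiseM g T k y) i j x)) :
    covM (LC g) i (lowM T j) x = covM (LC g) j (lowM T i) x ∧
    g x * curvM (fun k y => LC g k y + raiseM g T k y) i j x
      = g x * curvM (LC g) i j x
        + g x * (raiseM g T i x * raiseM g T j x - raiseM g T j x * raiseM g T i x) := by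
  have hcovT : ∀ i j, (covM (LC g) i (lowM T j) x)ᵀ = covM (LC g) i (lowM T j) x := by
    intro i j
    have h1 : (pdM i (lowM T j) x)ᵀ = pdM i (lowM T j) x := by
      rw [← pdM_transpose]
      exact pdM_congr_on hg.isOpen (fun y hy => hT.transpose hy j) hx i
    simp only [covM, Matrix.transpose_sub, Matrix.transpose_mul, Matrix.transpose_transpose,
      hT.transpose hx, h1]
    abel
  -- Every T_i is self-adjoint with respect to g, so the commutators are skew.
  have hcomm : (g x * (raiseM g T i x * raiseM g T j x - raiseM g T j x * raiseM g T i x))ᵀ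
      = -(g x * (raiseM g T i x * raiseM g T j x - raiseM g T j x * raiseM g T i x)) := by
    rw [Matrix.mul_sub, ← Matrix.mul_assoc, ← Matrix.mul_assoc, hg.mul_raiseM hx,
      hg.mul_raiseM hx]
    simp only [raiseM, Matrix.transpose_sub, Matrix.transpose_mul, hT.transpose hx,
      hg.inv_symm hx, Matrix.mul_assoc]
    abel
  have h1 := hg.curvM_add_cubic hT hx i j
  have h2 := congrArg Matrix.transpose h1
  rw [hskew, Matrix.transpose_add, Matrix.transpose_add, Matrix.transpose_sub, hcovT, hcovT,
    hcomm, hg.curvM_skew hx, h1] at h2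
  have h3 : covM (LC g) i (lowM T j) x - covM (LC g) j (lowM T i) x = 0 := by
    have h4 : (2 : ℝ) • (covM (LC g) i (lowM T j) x - covM (LC g) j (lowM T i) x) = 0 := by
      rw [two_smul]
      rw [← sub_eq_zero] at h2
      rw [← neg_eq_zero, ← h2]
      abel
    exact (smul_eq_zero.1 h4).resolve_left two_ne_zero
  exact ⟨sub_eq_zero.1 h3, by rw [h1, h3, add_zero]⟩

end Cubics

/-! ### A Schur lemma for trace-free cubics. -/

section Schur

open Filter Topology Matrix

variable {n : ℕ} {O : Set (Eu n)} {g : Eu n → Matrix (Fin n) (Fin n) ℝ} {x : Eu n}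
  {T : Eu n → Fin n → Fin n → Fin n → ℝ}

/-- The covariant derivative of the endomorphism-valued form `T̂`. -/
def covRaise (g : Eu n → Matrix (Fin n) (Fin n) ℝ) (T : Eu n → Fin n → Fin n → Fin n → ℝ)
    (i j : Fin n) (x : Eu n) : Matrix (Fin n) (Fin n) ℝ :=
  pdM i (raiseM g T j) x + LC g i x * raiseM g T j x - raiseM g T j x * LC g i x
    - ∑ a, christoffel g x a i j • raiseM g T a x

theorem IsCubicOn.mul_covRaise (hT : IsCubicOn O T) (hg : IsMetricOn O g) (hx : x ∈ O)
    (i j : Fin n) : g x * covRaise g T i j x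
      = covM (LC g) i (lowM T j) x - ∑ a, christoffel g x a i j • lowM T a x := by
  have h := hg.covM_mul hx (hT.smooth_raiseM hg j) i
  rw [covM, pdM_congr_on hg.isOpen (fun y hy => hg.mul_raiseM hy j) hx, hg.mul_raiseM hx] at h
  rw [covRaise, Matrix.mul_sub, ← h, Matrix.mul_sum]
  simp only [Matrix.mul_smul, hg.mul_raiseM hx]
  rfl

theorem IsCubicOn.mul_covRaise_apply (hT : IsCubicOn O T) (hg : IsMetricOn O g) (hx : x ∈ O)
    (i j k l : Fin n) : (g x * covRaise g T i j x) k l = covDeriv3 (christoffel g) T x j k l i := by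
  rw [hT.mul_covRaise hg hx]
  simp only [covM, covDeriv3, Matrix.sub_apply, pdM_apply, Matrix.mul_apply, Matrix.sum_apply,
    Matrix.smul_apply, smul_eq_mul, lowM, conM, Matrix.of_apply, Matrix.transpose_apply,
    Finset.sum_add_distrib]
  have : ∑ a, christoffel g x a i l * T x j k a = ∑ a, T x j k a * christoffel g x a i l :=
    Finset.sum_congr rfl fun a _ => mul_comm _ _
  rw [this]
  ring

theorem IsCubicOn.covDeriv3_symm₁₂ (hT : IsCubicOn O T) (hg : IsMetricOn O g) (hx : x ∈ O)
    (i j k l : Fin n) :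
    covDeriv3 (christoffel g) T x i j k l = covDeriv3 (christoffel g) T x j i k l := by
  simp only [covDeriv3]
  rw [pd_congr_on hg.isOpen (fun y hy => hT.symm₁₂ y hy i j k) hx]
  congr 1
  refine Finset.sum_congr rfl fun a _ => ?_
  rw [hT.symm₁₂ x hx a j k, hT.symm₁₂ x hx i a k, hT.symm₁₂ x hx i j a]
  ring

theorem IsCubicOn.covDeriv3_symm₂₃ (hT : IsCubicOn O T) (hg : IsMetricOn O g) (hx : x ∈ O)
    (i j k l : Fin n) :
    covDeriv3 (christoffel g) T x i j k l = covDeriv3 (christoffel g) T x i k j l := by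
  simp only [covDeriv3]
  rw [pd_congr_on hg.isOpen (fun y hy => hT.symm₂₃ y hy i j k) hx]
  congr 1
  refine Finset.sum_congr rfl fun a _ => ?_
  rw [hT.symm₂₃ x hx a j k, hT.symm₂₃ x hx i a k, hT.symm₂₃ x hx i j a]
  ring

theorem IsCubicOn.covRaise_symm (hT : IsCubicOn O T) (hg : IsMetricOn O g) (hx : x ∈ O)
    (i j : Fin n) (h : covM (LC g) i (lowM T j) x = covM (LC g) j (lowM T i) x) :
    covRaise g T i j x = covRaise g T j i x := by
  apply hg.mul_left_cancel hx
  rw [hT.mul_covRaise hg hx, hT.mul_covRaise hg hx, h]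
  simp only [hg.christoffel_symm hx _ i j]

/-- The trace argument behind Schur's lemma for cubics. -/
theorem eq_zero_of_cyclic_trace (hg : IsMetricOn O g) (hx : x ∈ O) (hn : 3 ≤ n)
    {B : Fin n → Fin n → Fin n → ℝ} {σ : Fin n → ℝ} (hB : ∀ i j k, B i j k = B j i k)
    (hσ : ∀ i j k, B i j k + B i k j = σ i * g x j k)
    (htr : ∀ k, ∑ i, ∑ j, (g x)⁻¹ i j * B i j k = 0) (i : Fin n) : σ i = 0 := by
  -- Contracting `hσ` in j and k gives 2t = nσ; contracting it in i and j, where `htr` removes one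
  -- term, gives t = σ. Hence (n - 2)σ = 0.
  set t : Fin n → ℝ := fun i => ∑ j, ∑ k, (g x)⁻¹ j k * B i j k with ht
  have ht' : ∀ i, ∑ j, ∑ k, (g x)⁻¹ j k * B i k j = t i := by
    intro i
    rw [Finset.sum_comm]
    exact Finset.sum_congr rfl fun j _ => Finset.sum_congr rfl fun k _ => by
      rw [hg.inv_symm_apply hx k j]
  have h1 : ∀ i, 2 * t i = n * σ i := by
    intro i
    have h2 : tr2 (g x) (fun j k => B i j k + B i k j) = tr2 (g x) fun j k => σ i * g x j k :=
      tr2_congr fun j k => hσ i j k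
    rw [tr2_add, tr2_smul (B := fun j k => g x j k), hg.tr2_self hx] at h2
    have h3 : tr2 (g x) (fun j k => B i j k) = t i := rfl
    have h4 : tr2 (g x) (fun j k => B i k j) = t i := ht' i
    rw [h3, h4] at h2
    linarith
  have h5 : t i = σ i := by
    have h6 : ∑ k, ∑ j, (g x)⁻¹ k j * (B k j i + B k i j) = σ i := by
      simp only [hσ]
      rw [Finset.sum_congr rfl fun k _ => Finset.sum_congr rfl fun j _ => show
        (g x)⁻¹ k j * (σ k * g x j i) = σ k * ((g x)⁻¹ k j * g x j i) by ring]
      simp [← Finset.mul_sum, hg.sum_inv_mul hx]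
    simp only [mul_add, Finset.sum_add_distrib, htr, zero_add] at h6
    rw [← h6]
    exact Finset.sum_congr rfl fun j _ => Finset.sum_congr rfl fun k _ => by rw [hB i j k]
  have h7 := h1 i
  rw [h5] at h7
  have h8 : (3 : ℝ) ≤ n := by exact_mod_cast hn
  have h9 : ((n : ℝ) - 2) * σ i = 0 := by linarith
  exact (mul_eq_zero.1 h9).resolve_left (by linarith)

/-- A trace-free cubic with totally symmetric covariant derivative and `tr (T_X T_Y) = s g(X, Y)`
has constant `s`. -/
theorem IsCubicOn.pd_eq_zero_of_trSq (hT : IsCubicOn O T) (hg : IsMetricOn O g) (hn : 3 ≤ n)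
    (htr : ∀ y ∈ O, ∀ i, (raiseM g T i y).trace = 0)
    (hcov : ∀ y ∈ O, ∀ i j, covM (LC g) i (lowM T j) y = covM (LC g) j (lowM T i) y)
    {s : Eu n → ℝ} (hs : ContDiffOn ℝ ∞ s O)
    (htrSq : ∀ y ∈ O, ∀ i j, trSq (g y) (T y) i j = s y * g y i j) (hx : x ∈ O) (i : Fin n) :
    pd i s x = 0 := by
  have hO := hg.isOpen
  have hR := fun j => hT.smooth_raiseM hg j
  set D := fun i j => covRaise g T i j x with hD
  have hDsymm : ∀ i j, D i j = D j i := fun i j => hT.covRaise_symm hg hx i j (hcov x hx i j)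
  have hDtr : ∀ i j, (D i j).trace = 0 := by
    intro i j
    have h1 : (pdM i (raiseM g T j) x).trace = 0 := by
      rw [← pd_trace hO (hR j) hx, pd_congr_on hO (fun y hy => htr y hy j) hx, pd_const]
    simp only [hD, covRaise, Matrix.trace_sub, Matrix.trace_add, h1, Matrix.trace_sum,
      Matrix.trace_smul, htr x hx, smul_zero, Finset.sum_const_zero]
    rw [Matrix.trace_mul_comm]
    ring
  -- The Codazzi symmetry of the derivative and the symmetry of T together generate all permutations
  -- of the four indices.
  have htotal : ∀ i j k l, (g x * D i j) k l = (g x * D k l) i j := by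
    intro i j k l
    have e := hT.mul_covRaise_apply hg hx
    have s12 := hT.covDeriv3_symm₁₂ hg hx
    have s23 := hT.covDeriv3_symm₂₃ hg hx
    have s14 : ∀ i j k l, covDeriv3 (christoffel g) T x j k l i
        = covDeriv3 (christoffel g) T x i k l j := fun i j k l => by
      rw [← e, ← e]
      exact congrArg (fun A => (g x * A) k l) (hDsymm i j)
    simp only [hD, e]
    rw [s12 j k l i, s14 i k j l, s23 i j l k, s12 i l j k]
  -- This is the covariant derivative of tr(T_j T_k) = s g_jk; the Levi-Civita terms cancel since ∇g
  -- = 0 and the trace is cyclic.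
  have hB : ∀ i j k, (D i j * raiseM g T k x).trace + (D i k * raiseM g T j x).trace
      = pd i s x * g x j k := by
    intro i j k
    have h1 : pd i (fun y => (raiseM g T j y * raiseM g T k y).trace) x
        = pd i s x * g x j k + s x * pd i (fun y => g y j k) x := by
      rw [pd_congr_on hO (fun y hy => by rw [← hT.trSq_eq hy, htrSq y hy]) hx]
      exact pd_mul (differentiableAt_of_contDiffOn hO hs hx) (hg.smooth.differentiableAt hO hx j k) i
    rw [pd_trace hO ((hR j).mul (hR k)) hx, pdM_mul hO (hR j) (hR k) hx] at h1
    have h2 : ∀ j k, (D i j * raiseM g T k x).trace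
        = (pdM i (raiseM g T j) x * raiseM g T k x).trace
          + (LC g i x * (raiseM g T j x * raiseM g T k x)).trace
          - (LC g i x * (raiseM g T k x * raiseM g T j x)).trace
          - s x * ∑ a, christoffel g x a i j * g x a k := by
      intro j k
      simp only [hD, covRaise, Matrix.sub_mul, Matrix.add_mul, Matrix.sum_mul, Matrix.smul_mul,
        Matrix.trace_sub, Matrix.trace_add, Matrix.trace_sum, Matrix.trace_smul, ← hT.trSq_eq hx,
        htrSq x hx, smul_eq_mul, Finset.mul_sum]
      congr 1
      · congr 1
        · rw [Matrix.mul_assoc]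
        · rw [Matrix.mul_assoc, Matrix.trace_mul_comm, Matrix.mul_assoc]
      · exact Finset.sum_congr rfl fun a _ => by ring
    have h3 : pd i (fun y => g y j k) x
        = ∑ a, christoffel g x a i k * g x a j + ∑ a, christoffel g x a i j * g x a k := by
      have h := congrFun (congrFun (hg.pdM_eq hx i) j) k
      simp only [pdM_apply, Matrix.add_apply, Matrix.mul_apply, Matrix.transpose_apply, conM,
        Matrix.of_apply] at h
      rw [h]
      congr 1
      exact Finset.sum_congr rfl fun c _ => by rw [hg.symm_apply hx c j]; ring
    rw [h2, h2, ← sub_eq_zero]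
    rw [h3, Matrix.trace_add] at h1
    rw [Matrix.trace_mul_comm (pdM i (raiseM g T k) x)]
    linear_combination h1
  refine eq_zero_of_cyclic_trace hg hx hn (B := fun i j k => (D i j * raiseM g T k x).trace)
    (fun i j k => by simp only [hDsymm i j]) hB (fun k => ?_) i
  -- By total symmetry the divergence of T is the derivative of its trace, which is zero.
  have h4 : ∑ i, ∑ j, (g x)⁻¹ i j • D i j = 0 := by
    apply hg.mul_left_cancel hx
    ext k l
    simp only [Matrix.mul_sum, Matrix.mul_smul, Matrix.sum_apply, Matrix.smul_apply, smul_eq_mul,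
      Matrix.mul_zero, Matrix.zero_apply]
    rw [Finset.sum_congr rfl fun i _ => Finset.sum_congr rfl fun j _ => by
      rw [htotal i j k l]]
    have h5 := hDtr k l
    rw [← hg.inv_mul_cancel_left hx (D k l)] at h5
    simp only [Matrix.trace, Matrix.diag_apply] at h5
    rw [← h5]
    refine Finset.sum_congr rfl fun i _ => ?_
    rw [Matrix.mul_apply]
    refine Finset.sum_congr rfl fun j _ => ?_
    congr 1
    have e := hT.mul_covRaise_apply hg hx
    simp only [hD, e]
    exact hT.covDeriv3_symm₂₃ hg hx l i j k
  have h6 : ∑ i, ∑ j, (g x)⁻¹ i j * (D i j * raiseM g T k x).trace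
      = ((∑ i, ∑ j, (g x)⁻¹ i j • D i j) * raiseM g T k x).trace := by
    simp only [Matrix.sum_mul, Matrix.smul_mul, Matrix.trace_sum, Matrix.trace_smul, smul_eq_mul]
  rw [h6, h4, Matrix.zero_mul, Matrix.trace_zero]

end Schur

/-! ### Abundant structures with dt = 0 and Schouten tensor proportional to g. -/

section SphericalStructures

open Filter Topology Matrix

variable {n : ℕ} {O : Set (Eu n)} {g : Eu n → Matrix (Fin n) (Fin n) ℝ} {x : Eu n}
  {S : Eu n → Fin n → Fin n → Fin n → ℝ}

/-- An abundant structure with `dt = 0` and trace-free part of the Schouten tensor zero, in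
coordinates. -/
structure IsSphericalOn (O : Set (Eu n)) (g : Eu n → Matrix (Fin n) (Fin n) ℝ)
    (S : Eu n → Fin n → Fin n → Fin n → ℝ) : Prop where
  metric : IsMetricOn O g
  cubic : IsCubicOn O S
  traceFree : ∀ x ∈ O, ∀ i, tr2 (g x) (S x i) = 0
  weyl : ∀ x ∈ O, ∀ i j, g x * curvM (LC g) i j x = knM (schouten g x) (g x) i j
  schouten_eq : ∀ x ∈ O, ∀ i j,
    schouten g x i j = (1 / (n : ℝ)) * tr2 (g x) (schouten g x) * g x i j
  hessian : ∀ x ∈ O, ∀ i j, 3 * schouten g x i j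
      + (1 / (3 * ((n : ℝ) - 2))) * (trSq (g x) (S x) i j
        + ((n : ℝ) - 6) * normSq3 (g x) (S x) * g x i j
          / (2 * ((n : ℝ) - 1) * ((n : ℝ) + 2))) = 0
  curvatureS : ∀ x ∈ O, ∃ Q : Fin n → Fin n → ℝ, ∀ i j,
    g x * curvM (fun k y => LC g k y - raiseM g S k y) i j x = knM Q (g x) i j

theorem raiseM_smul (c : ℝ) (i : Fin n) (x : Eu n) :
    raiseM g (fun y i j k => c * S y i j k) i x = c • raiseM g S i x := by
  rw [raiseM, lowM_smul, Matrix.mul_smul, raiseM]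

namespace IsSphericalOn

theorem trace_raiseM (h : IsSphericalOn O g S) (hx : x ∈ O) (i : Fin n) :
    (raiseM g S i x).trace = 0 := by
  rw [h.cubic.trace_raiseM h.metric hx, h.traceFree x hx]

/-- The only term of the Hessian equation that is not already a multiple of g is tr(S_X S_Y), so it
equals κ g, and its trace gives κ = |S|²/n. Inserting this value leaves a linear equation for the
trace of the Schouten tensor, solved after cancelling n - 2. -/
theorem trSq_eq_and_schouten (h : IsSphericalOn O g S) (hn : 3 ≤ n) (hx : x ∈ O) (i j : Fin n) :
    trSq (g x) (S x) i j = normSq3 (g x) (S x) / n * g x i j ∧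
    schouten g x i j = -(normSq3 (g x) (S x) / n * (3 * n + 2)
      / (18 * ((n : ℝ) - 1) * ((n : ℝ) + 2))) * g x i j := by
  have hn' : (3 : ℝ) ≤ n := by exact_mod_cast hn
  have n0 : (n : ℝ) ≠ 0 := by linarith
  have n1 : (n : ℝ) - 1 ≠ 0 := by linarith
  have n2 : (n : ℝ) - 2 ≠ 0 := by linarith
  have n3 : (n : ℝ) + 2 ≠ 0 := by linarith
  set N := normSq3 (g x) (S x) with hN
  set τ := tr2 (g x) (schouten g x) with hτ
  set κ := -9 * ((n : ℝ) - 2) * (1 / n * τ) - ((n : ℝ) - 6) * N / (2 * ((n : ℝ) - 1) * ((n : ℝ) + 2))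
    with hκ
  have h1 : ∀ i j, trSq (g x) (S x) i j = κ * g x i j := by
    intro i j
    have h2 := h.hessian x hx i j
    rw [h.schouten_eq x hx] at h2
    rw [← hτ, ← hN] at h2
    have h3 : (1 / (3 * ((n : ℝ) - 2))) * (trSq (g x) (S x) i j - κ * g x i j) = 0 := by
      rw [← h2, hκ]
      field_simp
      ring
    have h4 := (mul_eq_zero.1 h3).resolve_left (by
      apply div_ne_zero one_ne_zero
      exact mul_ne_zero three_ne_zero n2)
    linarith
  have h5 : N = κ * n := by
    rw [hN, h.cubic.normSq3_eq h.metric hx, tr2_congr h1, tr2_smul (B := fun i j => g x i j),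
      h.metric.tr2_self hx]
  refine ⟨by rw [h1, h5]; field_simp, ?_⟩
  rw [h.schouten_eq x hx, ← hτ]
  congr 1
  have h6 : κ = -9 * ((n : ℝ) - 2) * (1 / n * τ)
      - ((n : ℝ) - 6) * (κ * n) / (2 * ((n : ℝ) - 1) * ((n : ℝ) + 2)) := by rw [← h5]
  rw [h5]
  field_simp
  field_simp at h6
  have h7 : ((n : ℝ) - 2) * (τ * (18 * (n - 1) * (n + 2)) + n * κ * (3 * n + 2)) = 0 := by
    linear_combination h6
  have h8 := (mul_eq_zero.1 h7).resolve_left n2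
  linear_combination h8

/-- The commutators of a spherical structure and the symmetry of its covariant derivative. -/
theorem commutator (h : IsSphericalOn O g S) (hn : 3 ≤ n) (hx : x ∈ O) (i j : Fin n) :
    covM (LC g) i (lowM S j) x = covM (LC g) j (lowM S i) x ∧
    g x * (raiseM g S i x * raiseM g S j x - raiseM g S j x * raiseM g S i x)
      = knM (fun a b => -(normSq3 (g x) (S x) / n / (2 * ((n : ℝ) - 1))) * g x a b) (g x) i j := by
  have hn' : (3 : ℝ) ≤ n := by exact_mod_cast hn
  have n0 : (n : ℝ) ≠ 0 := by linarith
  have n1 : (n : ℝ) - 1 ≠ 0 := by linarith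
  have n2 : (n : ℝ) - 2 ≠ 0 := by linarith
  obtain ⟨Q, hQ⟩ := h.curvatureS x hx
  have hg := h.metric
  -- ∇^S is of the form ∇^g + T̂ with T = -S. The sign drops out of the commutators and is harmless
  -- in the Codazzi equation.
  have hneg := h.cubic.smul (-1)
  have hcon : ∀ i j, curvM (fun k y => LC g k y + raiseM g (fun y i j k => -1 * S y i j k) k y) i j x
      = curvM (fun k y => LC g k y - raiseM g S k y) i j x := fun i j =>
    curvM_congr_on hg.isOpen (fun k y _ => by
      rw [raiseM_smul, neg_one_smul, sub_eq_add_neg]) hx i j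
  have h1 := fun i j => hg.cubic_of_skew hneg hx (i := i) (j := j)
    (by rw [hcon, hQ, knM_transpose])
  have hcov : ∀ i j, covM (LC g) i (lowM (fun y i j k => -1 * S y i j k) j) x
      = -1 • covM (LC g) i (lowM S j) x := by
    intro i j
    have := covM_smul hg (h.cubic.smoothM j) hx (-1) i
    rw [neg_one_smul] at this ⊢
    exact this
  refine ⟨by
    have h0 := (h1 i j).1
    rw [hcov, hcov, neg_one_smul, neg_one_smul] at h0
    exact neg_injective h0, ?_⟩
  have h2 : ∀ i j, g x * (raiseM g S i x * raiseM g S j x - raiseM g S j x * raiseM g S i x)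
      = knM (fun a b => Q a b - schouten g x a b) (g x) i j := by
    intro i j
    have h3 := (h1 i j).2
    rw [hcon, hQ, h.weyl x hx, raiseM_smul, raiseM_smul, Matrix.smul_mul, Matrix.smul_mul,
      Matrix.mul_smul, Matrix.mul_smul, smul_smul, smul_smul] at h3
    norm_num at h3
    rw [← sub_eq_iff_eq_add'] at h3
    rw [← h3]
    ext k l
    simp only [knM, kulkarniNomizu, Matrix.sub_apply, Matrix.of_apply]
    ring
  set Q' := fun a b => Q a b - schouten g x a b with hQ'
  -- The contraction of the commutators is the known tensor -tr(S_i S_j). Its trace yields tr Q',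
  -- and then the equation itself yields Q'.
  have h4 : ∀ i j, -trSq (g x) (S x) i j = ((n : ℝ) - 2) * Q' i j + tr2 (g x) Q' * g x i j := by
    intro i j
    rw [← h.cubic.contract_commutator hx (fun i => h.trace_raiseM hx i)]
    exact hg.contract_kn hx h2 i j
  have h5 : -normSq3 (g x) (S x) = (2 * (n : ℝ) - 2) * tr2 (g x) Q' := by
    have h6 : tr2 (g x) (fun i j => (-1) * trSq (g x) (S x) i j)
        = tr2 (g x) fun i j => ((n : ℝ) - 2) * Q' i j + tr2 (g x) Q' * g x i j :=
      tr2_congr fun i j => by rw [← h4]; ring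
    rw [tr2_smul, tr2_add, tr2_smul, tr2_smul (B := fun i j => g x i j), hg.tr2_self hx] at h6
    rw [h.cubic.normSq3_eq hg hx]
    linear_combination h6
  have h7 : Q' = fun a b => -(normSq3 (g x) (S x) / n / (2 * ((n : ℝ) - 1))) * g x a b := by
    ext a b
    have h8 := h4 a b
    rw [(h.trSq_eq_and_schouten hn hx a b).1] at h8
    have h9 : tr2 (g x) Q' = -normSq3 (g x) (S x) / (2 * ((n : ℝ) - 1)) := by
      rw [eq_div_iff (mul_ne_zero two_ne_zero n1)]
      linear_combination -h5
    rw [h9] at h8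
    have h10 : ((n : ℝ) - 2) * (Q' a b
        - -(normSq3 (g x) (S x) / n / (2 * ((n : ℝ) - 1))) * g x a b) = 0 := by
      have h11 : ((n : ℝ) - 2) * Q' a b = -(normSq3 (g x) (S x) / n * g x a b)
        - -normSq3 (g x) (S x) / (2 * ((n : ℝ) - 1)) * g x a b := by linear_combination -h8
      rw [mul_sub, h11]
      field_simp
      ring
    have h12 := (mul_eq_zero.1 h10).resolve_left n2
    linarith
  rw [h2, h7]

end IsSphericalOn

/-- The constant `λ` with shape operator `λ · id`, as a function of `|S|²`. -/
def sphereConst (n : ℕ) (N : ℝ) : ℝ :=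
  -(N / n * (4 * (n + 1)) / (9 * ((n : ℝ) - 1) * ((n : ℝ) + 2)))

namespace IsSphericalOn

/-- The curvature of the connection `∇^g + Ŝ/3`. -/
theorem curvM_eq (h : IsSphericalOn O g S) (hn : 3 ≤ n) (hx : x ∈ O) (i j a b : Fin n) :
    curvM (fun k y => LC g k y + raiseM g (fun y i j k => 1 / 3 * S y i j k) k y) i j x a b
      = sphereConst n (normSq3 (g x) (S x))
        * (g x j b * (if a = i then 1 else 0) - g x i b * (if a = j then 1 else 0)) := by
  have hn' : (3 : ℝ) ≤ n := by exact_mod_cast hn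
  have n0 : (n : ℝ) ≠ 0 := by linarith
  have n1 : (n : ℝ) - 1 ≠ 0 := by linarith
  have n3 : (n : ℝ) + 2 ≠ 0 := by linarith
  have hg := h.metric
  have hc := h.cubic.smul (1 / 3)
  have hcov : ∀ i j, covM (LC g) i (lowM (fun y i j k => 1 / 3 * S y i j k) j) x
      = (1 / 3 : ℝ) • covM (LC g) i (lowM S j) x := fun i j =>
    covM_smul hg (h.cubic.smoothM j) hx (1 / 3) i
  -- The derivative terms cancel by the Codazzi equation, and the Schouten factor is added to 1/9 of
  -- the commutator factor. The product of g with itself doubles the coefficient: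
  -- 2((3n+2)/(18(n-1)(n+2)) + 1/(18(n-1))) = 4(n+1)/(9(n-1)(n+2)), as in `sphereConst`.
  have h1 := hg.curvM_add_cubic hc hx i j
  rw [hcov, hcov, (h.commutator hn hx i j).1, sub_self, add_zero, h.weyl x hx, raiseM_smul,
    raiseM_smul, Matrix.smul_mul, Matrix.smul_mul, Matrix.mul_smul, Matrix.mul_smul, smul_smul,
    smul_smul, ← smul_sub, Matrix.mul_smul, (h.commutator hn hx i j).2] at h1
  have h2 : curvM (fun k y => LC g k y + raiseM g (fun y i j k => 1 / 3 * S y i j k) k y) i j x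
      = Matrix.of fun a b => sphereConst n (normSq3 (g x) (S x))
        * (g x j b * (if a = i then 1 else 0) - g x i b * (if a = j then 1 else 0)) := by
    apply hg.mul_left_cancel hx
    rw [h1]
    ext k l
    have h3 : ∀ a, g x k a * (sphereConst n (normSq3 (g x) (S x))
        * (g x j l * (if a = i then 1 else 0) - g x i l * (if a = j then 1 else 0)))
        = (if a = i then sphereConst n (normSq3 (g x) (S x)) * g x j l * g x k a else 0)
          - (if a = j then sphereConst n (normSq3 (g x) (S x)) * g x i l * g x k a else 0) := by
      intro a
      split_ifs <;> ring
    simp only [knM, kulkarniNomizu, Matrix.add_apply, Matrix.smul_apply, Matrix.of_apply,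
      Matrix.mul_apply, h3, Finset.sum_sub_distrib, Finset.sum_ite_eq', Finset.mem_univ, if_true,
      (h.trSq_eq_and_schouten hn hx _ _).2, smul_eq_mul]
    rw [sphereConst]
    rw [hg.symm_apply hx k i, hg.symm_apply hx k j]
    field_simp
    ring
  rw [h2, Matrix.of_apply]

theorem smooth_normSq3 (h : IsSphericalOn O g S) :
    ContDiffOn ℝ ∞ (fun y => normSq3 (g y) (S y)) O := by
  have hi := h.metric.smooth_inv
  have hS := h.cubic.smooth
  unfold normSq3
  refine ContDiffOn.sum fun i _ => ContDiffOn.sum fun j _ => ContDiffOn.sum fun k _ =>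
    ContDiffOn.sum fun a _ => ContDiffOn.sum fun b _ => ContDiffOn.sum fun c _ => ?_
  exact ((((hi i a).mul (hi j b)).mul (hi k c)).mul (hS i j k)).mul (hS a b c)

theorem pd_normSq3 (h : IsSphericalOn O g S) (hn : 3 ≤ n) (hx : x ∈ O) (i : Fin n) :
    pd i (fun y => normSq3 (g y) (S y)) x = 0 := by
  have hn' : (3 : ℝ) ≤ n := by exact_mod_cast hn
  have h1 := h.cubic.pd_eq_zero_of_trSq h.metric hn (fun y hy => h.trace_raiseM hy)
    (fun y hy i j => (h.commutator hn hy i j).1)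
    (s := fun y => (1 / n : ℝ) * normSq3 (g y) (S y)) (contDiffOn_const.mul h.smooth_normSq3)
    (fun y hy i j => by rw [(h.trSq_eq_and_schouten hn hy i j).1]; ring) hx i
  rw [pd_const_mul _ (differentiableAt_of_contDiffOn h.metric.isOpen h.smooth_normSq3 hx)] at h1
  exact (mul_eq_zero.1 h1).resolve_left (by positivity)

end IsSphericalOn

end SphericalStructures

/-! ### Structure equations of hypersurfaces. -/

section Hypersurfaces

open Filter Topology Matrix

variable {n : ℕ} {O : Set (Eu n)} {g : Eu n → Matrix (Fin n) (Fin n) ℝ} {x : Eu n}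
  {C : Eu n → Fin n → Fin n → Fin n → ℝ}

/-- The matrices of the connection `∇^g + Ĉ`. -/
def hypCon (g : Eu n → Matrix (Fin n) (Fin n) ℝ) (C : Eu n → Fin n → Fin n → Fin n → ℝ)
    (i : Fin n) (x : Eu n) : Matrix (Fin n) (Fin n) ℝ :=
  LC g i x + Matrix.of fun k j => raise3 (g x) (C x) k i j

/-- A map `F` and a vector field `ξ` along it that satisfy the Gauss formula with metric `g` and
cubic `C`. -/
structure IsGaussOn (O : Set (Eu n)) (g : Eu n → Matrix (Fin n) (Fin n) ℝ)
    (C : Eu n → Fin n → Fin n → Fin n → ℝ) (F ξ : Eu n → Amb n) : Prop where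
  metric : IsMetricOn O g
  smoothC : ∀ i j k, ContDiffOn ℝ ∞ (fun y => C y i j k) O
  smoothF : ContDiffOn ℝ ∞ F O
  smoothξ : ContDiffOn ℝ ∞ ξ O
  relative : ∀ x ∈ O, ∀ i, ∃ a : Fin n → ℝ, pd i ξ x = ∑ k, a k • pd k F x
  gauss : ∀ x ∈ O, ∀ i j, pd i (pd j F) x = (∑ k, hypCon g C i x k j • pd k F x) + g x i j • ξ x

/-- A relative hypersurface normalisation in coordinates, with metric `g` and cubic `C`. -/
structure IsHypersurfaceOn (O : Set (Eu n)) (g : Eu n → Matrix (Fin n) (Fin n) ℝ)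
    (C : Eu n → Fin n → Fin n → Fin n → ℝ) (F ξ : Eu n → Amb n)
    (Ξ : Eu n → (Amb n →L[ℝ] ℝ)) : Prop extends IsGaussOn O g C F ξ where
  smoothΞ : ContDiffOn ℝ ∞ Ξ O
  immersion : ∀ x ∈ O, ∀ a : Fin n → ℝ, ∑ i, a i • pd i F x = 0 → a = 0
  conormal : ∀ x ∈ O, ∀ i, Ξ x (pd i F x) = 0
  dual : ∀ x ∈ O, Ξ x (ξ x) = 1

theorem IsMetricOn.sum_mul_raise3 (hg : IsMetricOn O g) (hx : x ∈ O)
    (T : Fin n → Fin n → Fin n → ℝ) (i j l : Fin n) :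
    ∑ k, g x l k * raise3 (g x) T k i j = T i j l := by
  have h : g x *ᵥ ((g x)⁻¹ *ᵥ fun l => T i j l) = fun l => T i j l := by
    rw [Matrix.mulVec_mulVec, hg.mul_inv hx, Matrix.one_mulVec]
  exact congrFun h l

theorem hypCon_eq (hC : IsCubicOn O C) (hx : x ∈ O) (i : Fin n) :
    hypCon g C i x = LC g i x + raiseM g C i x := by
  ext k j
  simp only [hypCon, Matrix.add_apply, Matrix.of_apply, hC.raise3_eq hx, raiseM]

variable {F ξ : Eu n → Amb n} {Ξ : Eu n → (Amb n →L[ℝ] ℝ)}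

theorem IsGaussOn.smooth_hypCon (h : IsGaussOn O g C F ξ) (i : Fin n) : SmoothM O (hypCon g C i) :=
  (h.metric.smooth_LC i).add fun k j => by
    simp only [Matrix.of_apply, raise3]
    exact ContDiffOn.sum fun l _ => (h.metric.smooth_inv k l).mul (h.smoothC i j l)

namespace IsHypersurfaceOn

theorem frame_unique (h : IsHypersurfaceOn O g C F ξ Ξ) (hx : x ∈ O) {a a' : Fin n → ℝ} {b b' : ℝ}
    (he : ∑ i, a i • pd i F x + b • ξ x = ∑ i, a' i • pd i F x + b' • ξ x) :
    a = a' ∧ b = b' := by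
  have h1 := congrArg (Ξ x) he
  simp only [map_add, map_sum, map_smul, h.conormal x hx, h.dual x hx, smul_eq_mul,
    mul_zero, Finset.sum_const_zero, zero_add, mul_one] at h1
  refine ⟨?_, h1⟩
  rw [h1, add_left_inj, ← sub_eq_zero, ← Finset.sum_sub_distrib] at he
  have h2 := h.immersion x hx (a - a') (by simpa [sub_smul] using he)
  exact sub_eq_zero.1 h2

theorem pd_gauss (h : IsHypersurfaceOn O g C F ξ Ξ) (hx : x ∈ O) {B : Fin n → Fin n → ℝ}
    (hB : ∀ i, pd i ξ x = ∑ k, B i k • pd k F x) (l i j : Fin n) :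
    pd l (pd i (pd j F)) x
      = ∑ m, ((pdM l (hypCon g C i) x + hypCon g C l x * hypCon g C i x) m j
          + g x i j * B l m) • pd m F x
        + (∑ k, hypCon g C i x k j * g x l k + pd l (fun y => g y i j) x) • ξ x := by
  have hO := h.metric.isOpen
  have hd := fun k => differentiableAt_of_contDiffOn hO (contDiffOn_pd hO h.smoothF k) hx
  have hc := fun k => (h.smooth_hypCon i).differentiableAt hO hx k j
  have hg := h.metric.smooth.differentiableAt hO hx i j
  have hξ := differentiableAt_of_contDiffOn hO h.smoothξ hx
  rw [pd_congr_on hO (fun y hy => h.gauss y hy i j) hx,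
    pd_add (F := fun y => ∑ k, hypCon g C i y k j • pd k F y) (G := fun y => g y i j • ξ y)
      (DifferentiableAt.fun_sum fun k _ => (hc k).smul (hd k)) (hg.smul hξ),
    pd_sum (F := fun k y => hypCon g C i y k j • pd k F y) fun k _ => (hc k).smul (hd k),
    pd_smul hg hξ, hB l]
  simp only [pd_smul (hc _) (hd _), h.gauss x hx l, smul_add, Finset.smul_sum,
    Finset.sum_add_distrib, smul_smul, add_smul, Matrix.add_apply, pdM_apply, Matrix.mul_apply,
    Finset.sum_smul]
  rw [Finset.sum_comm]
  simp only [mul_comm (hypCon g C i x _ j)]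
  abel

/-- Third derivatives of F commute. In the frame formed by ∂F and ξ the tangential part of this
identity is the Gauss equation and the transversal part the Codazzi equation. -/
theorem structure_equations (h : IsHypersurfaceOn O g C F ξ Ξ) (hx : x ∈ O)
    {B : Fin n → Fin n → ℝ} (hB : ∀ i, pd i ξ x = ∑ k, B i k • pd k F x) (l i j : Fin n) :
    (∀ m, curvM (hypCon g C) l i x m j = g x l j * B i m - g x i j * B l m) ∧
    ∑ k, hypCon g C i x k j * g x l k + pd l (fun y => g y i j) x
      = ∑ k, hypCon g C l x k j * g x i k + pd i (fun y => g y l j) x := by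
  have hO := h.metric.isOpen
  have h1 := pd_comm hO (contDiffOn_pd hO h.smoothF j) hx l i
  rw [h.pd_gauss hx hB, h.pd_gauss hx hB] at h1
  have h2 := h.frame_unique hx h1
  refine ⟨fun m => ?_, h2.2⟩
  have h3 := congrFun h2.1 m
  simp only [curvM, Matrix.sub_apply, Matrix.add_apply] at h3 ⊢
  linarith

theorem hypCon_symm (h : IsHypersurfaceOn O g C F ξ Ξ) (hx : x ∈ O) (i j k : Fin n) :
    hypCon g C i x k j = hypCon g C j x k i := by
  have h1 := pd_comm h.metric.isOpen h.smoothF hx i j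
  rw [h.gauss x hx, h.gauss x hx] at h1
  exact congrFun (h.frame_unique hx h1).1 k

/-- The symmetry of C is a consequence of the Gauss formula and need not be assumed. Symmetry of the
second derivatives of F gives the first two arguments; the Codazzi equation, with the derivatives of
g expressed by the Levi-Civita connection, gives the third. -/
theorem cubic (h : IsHypersurfaceOn O g C F ξ Ξ) : IsCubicOn O C := by
  have hg := h.metric
  have h12 : ∀ x ∈ O, ∀ i j k, C x i j k = C x j i k := by
    intro x hx i j l
    rw [← hg.sum_mul_raise3 hx (C x) i j l, ← hg.sum_mul_raise3 hx (C x) j i l]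
    refine Finset.sum_congr rfl fun k _ => ?_
    have h1 := h.hypCon_symm hx i j k
    simp only [hypCon, Matrix.add_apply, Matrix.of_apply, conM] at h1
    rw [hg.christoffel_symm hx k i j] at h1
    rw [add_left_cancel h1]
  refine ⟨h.smoothC, h12, fun x hx j i l => ?_⟩
  choose B hB using h.relative x hx
  have h1 := (h.structure_equations hx hB l i j).2
  have h2 : ∀ i l j, ∑ k, hypCon g C i x k j * g x l k = (g x * LC g i x) l j + C x i j l := by
    intro i l j
    rw [← hg.sum_mul_raise3 hx (C x) i j l, Matrix.mul_apply, ← Finset.sum_add_distrib]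
    exact Finset.sum_congr rfl fun k _ => by
      simp only [hypCon, Matrix.add_apply, Matrix.of_apply]; ring
  have h3 : ∀ l i j, pd l (fun y => g y i j) x
      = (g x * LC g l x) i j + (g x * LC g l x) j i := by
    intro l i j
    have h := congrFun (congrFun (hg.pdM_eq hx l) i) j
    rw [pdM_apply] at h
    rw [h, Matrix.add_apply]
    congr 1
    have h4 : (LC g l x)ᵀ * g x = (g x * LC g l x)ᵀ := by
      rw [Matrix.transpose_mul, hg.symm x hx]
    rw [h4, Matrix.transpose_apply]
  have h5 : (g x * LC g l x) j i = (g x * LC g i x) j l := by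
    simp only [Matrix.mul_apply, conM, Matrix.of_apply, hg.christoffel_symm hx _ l i]
  rw [h2, h2, h3, h3, h5] at h1
  have h6 : C x i j l = C x l j i := by linarith
  rw [h12 x hx j i l, h6, h12 x hx l j i]

theorem curvM_eq (h : IsHypersurfaceOn O g C F ξ Ξ) (hx : x ∈ O) (l i : Fin n) :
    curvM (hypCon g C) l i x = curvM (fun k y => LC g k y + raiseM g C k y) l i x :=
  curvM_congr_on h.metric.isOpen (fun k _ hy => hypCon_eq h.cubic hy k) hx l i

end IsHypersurfaceOn

/-! ### The induced volume forms -/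

/-- The matrix with rows `∂_1 F, …, ∂_n F, ξ`. -/
def frameMatrix (F ξ : Eu n → Amb n) (x : Eu n) : Matrix (Fin (n + 1)) (Fin (n + 1)) ℝ :=
  Matrix.of fun a b => (Fin.snoc (α := fun _ => Amb n) (fun i => pd i F x) (ξ x) : Fin (n + 1) → Amb n) a b

/-- The matrix with rows `-∂_1 Ξ, …, -∂_n Ξ, Ξ`. -/
def dualFrameMatrix (Ξ : Eu n → (Amb n →L[ℝ] ℝ)) (x : Eu n) :
    Matrix (Fin (n + 1)) (Fin (n + 1)) ℝ :=
  Matrix.of fun a b => (Fin.snoc (α := fun _ => Amb n →L[ℝ] ℝ) (fun i => -pd i Ξ x) (Ξ x) :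
    Fin (n + 1) → (Amb n →L[ℝ] ℝ)) a (EuclideanSpace.single b 1)

theorem pd_apply_amb {F : Eu n → Amb n} (hF : DifferentiableAt ℝ F x) (i : Fin n)
    (b : Fin (n + 1)) : pd i (fun y => F y b) x = pd i F x b := by
  have h := ((EuclideanSpace.proj (𝕜 := ℝ) b).hasFDerivAt.comp x hF.hasFDerivAt).fderiv
  have h2 : (fun y => F y b) = (EuclideanSpace.proj (𝕜 := ℝ) b) ∘ F := rfl
  rw [pd, h2, h]
  rfl

theorem IsGaussOn.smooth_frameMatrix (h : IsGaussOn O g C F ξ) : SmoothM O (frameMatrix F ξ) := by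
  intro a b
  have hp : ∀ {G : Eu n → Amb n}, ContDiffOn ℝ ∞ G O → ContDiffOn ℝ ∞ (fun y => G y b) O :=
    fun hG => (EuclideanSpace.proj (𝕜 := ℝ) b).contDiff.comp_contDiffOn hG
  refine Fin.lastCases ?_ (fun i => ?_) a
  · simpa [frameMatrix] using hp h.smoothξ
  · simpa [frameMatrix] using hp (contDiffOn_pd h.metric.isOpen h.smoothF i)

/-- The frame satisfies a linear equation whose diagonal blocks are the matrix of ∇ and 0, the
latter because the derivative of ξ is tangential. Jacobi's formula only sees the trace. -/
theorem IsGaussOn.pd_det_frameMatrix (h : IsGaussOn O g C F ξ) (hx : x ∈ O) (l : Fin n) :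
    pd l (fun y => (frameMatrix F ξ y).det) x
      = (hypCon g C l x).trace * (frameMatrix F ξ x).det := by
  have hO := h.metric.isOpen
  obtain ⟨b, hb⟩ := h.relative x hx l
  let A : Matrix (Fin (n + 1)) (Fin (n + 1)) ℝ := Matrix.of fun a c =>
    (Fin.snoc (α := fun _ => Fin (n + 1) → ℝ)
      (fun i => Fin.snoc (α := fun _ => ℝ) (fun k => hypCon g C l x k i) (g x l i))
      (Fin.snoc (α := fun _ => ℝ) b 0) : Fin (n + 1) → Fin (n + 1) → ℝ) a c
  have hA : pdM l (frameMatrix F ξ) x = A * frameMatrix F ξ x := by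
    ext a c
    rw [pdM_apply, Matrix.mul_apply, Fin.sum_univ_castSucc]
    refine Fin.lastCases ?_ (fun i => ?_) a
    · simp only [frameMatrix, Matrix.of_apply, Fin.snoc_last, Fin.snoc_castSucc, A]
      rw [pd_apply_amb (differentiableAt_of_contDiffOn hO h.smoothξ hx), hb]
      simp
    · simp only [frameMatrix, Matrix.of_apply, Fin.snoc_last, Fin.snoc_castSucc, A]
      rw [pd_apply_amb (differentiableAt_of_contDiffOn hO (contDiffOn_pd hO h.smoothF i) hx),
        h.gauss x hx]
      simp
  rw [pd_det hO h.smooth_frameMatrix hx l A hA]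
  congr 1
  simp [Matrix.trace, Fin.sum_univ_castSucc, A]

namespace IsHypersurfaceOn

/-- Pairing the frame with the dual frame gives a block triangular matrix with blocks g and 1:
differentiating Ξ(∂_i F) = 0 and Ξ(ξ) = 1 moves the derivative from Ξ to ∂_i F and ξ. In terms of
volumes this is ω ω* = det g. -/
theorem det_frameMatrix_mul (h : IsHypersurfaceOn O g C F ξ Ξ) (hx : x ∈ O) :
    (frameMatrix F ξ x).det * (dualFrameMatrix Ξ x).det = (g x).det := by
  have hO := h.metric.isOpen
  have hΞ := differentiableAt_of_contDiffOn hO h.smoothΞ hx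
  have hpair : ∀ {G : Eu n → Amb n} {c : ℝ}, ContDiffOn ℝ ∞ G O → (∀ y ∈ O, Ξ y (G y) = c) →
      ∀ k, -(pd k Ξ x (G x)) = Ξ x (pd k G x) := by
    intro G c hG hc k
    have h1 : pd k (fun y => Ξ y (G y)) x = 0 := by
      rw [pd_congr_on hO hc hx, pd_const]
    rw [pd, fderiv_clm_apply hΞ (differentiableAt_of_contDiffOn hO hG hx)] at h1
    simp only [_root_.add_apply, ContinuousLinearMap.comp_apply, ContinuousLinearMap.flip_apply] at h1
    simp only [pd]
    linarith
  have hsum : ∀ (α : Amb n →L[ℝ] ℝ) (v : Amb n),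
      ∑ b, v b * α (EuclideanSpace.single b 1) = α v := by
    intro α v
    have h1 : v = ∑ b, v b • EuclideanSpace.single b (1 : ℝ) := by
      ext j
      simp [Pi.single_apply]
    conv_rhs => rw [h1]
    simp
  rw [← Matrix.det_transpose (dualFrameMatrix Ξ x), ← Matrix.det_mul]
  have hM : ∀ a c, (frameMatrix F ξ x * (dualFrameMatrix Ξ x)ᵀ) a c
      = (Fin.snoc (α := fun _ => Amb n →L[ℝ] ℝ) (fun i => -pd i Ξ x) (Ξ x) :
          Fin (n + 1) → (Amb n →L[ℝ] ℝ)) c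
        ((Fin.snoc (α := fun _ => Amb n) (fun i => pd i F x) (ξ x) : Fin (n + 1) → Amb n) a) := by
    intro a c
    rw [← hsum]
    rfl
  have hgξ : ∀ k, Ξ x (pd k ξ x) = 0 := by
    intro k
    obtain ⟨b, hb⟩ := h.relative x hx k
    rw [hb]
    simp [h.conormal x hx]
  rw [Matrix.det_succ_row _ (Fin.last n), Fin.sum_univ_castSucc]
  have h1 : ∀ k : Fin n, (frameMatrix F ξ x * (dualFrameMatrix Ξ x)ᵀ) (Fin.last n) k.castSucc
      = 0 := by
    intro k
    rw [hM, Fin.snoc_castSucc, Fin.snoc_last, _root_.neg_apply, hpair h.smoothξ h.dual, hgξ]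
  have h2 : (frameMatrix F ξ x * (dualFrameMatrix Ξ x)ᵀ) (Fin.last n) (Fin.last n) = 1 := by
    rw [hM, Fin.snoc_last, Fin.snoc_last, h.dual x hx]
  have h3 : (frameMatrix F ξ x * (dualFrameMatrix Ξ x)ᵀ).submatrix (Fin.last n).succAbove
      (Fin.last n).succAbove = g x := by
    ext i k
    rw [Matrix.submatrix_apply, Fin.succAbove_last, hM, Fin.snoc_castSucc, Fin.snoc_castSucc,
      _root_.neg_apply, hpair (contDiffOn_pd hO h.smoothF i) (fun y hy => h.conormal y hy i),
      h.gauss x hx]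
    simp [h.conormal x hx, h.dual x hx, h.metric.symm_apply hx k i]
  simp only [h1, h2, h3, mul_zero, zero_mul, Finset.sum_const_zero, zero_add, mul_one]
  rw [← two_mul, pow_mul]
  simp

theorem det_frameMatrix_ne_zero (h : IsHypersurfaceOn O g C F ξ Ξ) (hx : x ∈ O) :
    (frameMatrix F ξ x).det ≠ 0 := fun h0 =>
  h.metric.det_ne x hx (by rw [← h.det_frameMatrix_mul hx, h0, zero_mul])

end IsHypersurfaceOn

theorem IsMetricOn.pd_det_eq (hg : IsMetricOn O g) (hx : x ∈ O) (l : Fin n) :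
    pd l (fun y => (g y).det) x = 2 * (LC g l x).trace * (g x).det := by
  have h1 : pdM l g x = (g x * LC g l x * (g x)⁻¹ + (LC g l x)ᵀ) * g x := by
    rw [hg.pdM_eq hx, Matrix.add_mul, Matrix.mul_assoc (g x * LC g l x), hg.inv_mul hx,
      Matrix.mul_one]
  rw [pd_det hg.isOpen hg.smooth hx l _ h1, Matrix.trace_add, Matrix.trace_mul_comm,
    hg.inv_mul_cancel_left hx, Matrix.trace_transpose]
  ring

theorem trace_hypCon (g : Eu n → Matrix (Fin n) (Fin n) ℝ)
    (C : Eu n → Fin n → Fin n → Fin n → ℝ) (l : Fin n) (x : Eu n) :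
    (hypCon g C l x).trace = (LC g l x).trace + ((n : ℝ) + 2) * cubicTrace (g x) (C x) l := by
  rw [hypCon, Matrix.trace_add, cubicTrace, ← mul_assoc, mul_one_div_cancel (by positivity),
    one_mul]
  rfl

end Hypersurfaces

/-! ### Apolarity, umbilicity and the Schouten tensor of affine spheres. -/

section LocalSpheres

open Filter Topology Matrix

variable {n : ℕ} {O : Set (Eu n)} {g : Eu n → Matrix (Fin n) (Fin n) ℝ} {x : Eu n}
  {C : Eu n → Fin n → Fin n → Fin n → ℝ} {F ξ : Eu n → Amb n} {Ξ : Eu n → (Amb n →L[ℝ] ℝ)}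

/-- For a trace-free cubic, `V² / det g` is locally constant, where `V` is the volume of the
frame. -/
theorem IsGaussOn.pd_volume_ratio (h : IsGaussOn O g C F ξ)
    (hx : x ∈ O) (l : Fin n) (hu : cubicTrace (g x) (C x) l = 0) :
    pd l (fun y => (frameMatrix F ξ y).det * (frameMatrix F ξ y).det * ((g y).det)⁻¹) x = 0 := by
  have hO := h.metric.isOpen
  have hV := differentiableAt_of_contDiffOn hO h.smooth_frameMatrix.det hx
  have hG := differentiableAt_of_contDiffOn hO h.metric.smooth.det hx
  have hG0 := h.metric.det_ne x hx
  have hinv : pd l (fun y => ((g y).det)⁻¹) x = -(2 * (LC g l x).trace) * ((g x).det)⁻¹ := by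
    have h1 : pd l (fun y => (g y).det * ((g y).det)⁻¹) x = 0 := by
      rw [pd_congr_on hO (fun y hy => mul_inv_cancel₀ (h.metric.det_ne y hy)) hx, pd_const]
    rw [pd_mul (d := fun y => ((g y).det)⁻¹) hG (hG.inv hG0), h.metric.pd_det_eq hx] at h1
    field_simp
    field_simp at h1
    linarith
  rw [pd_mul (c := fun y => (frameMatrix F ξ y).det * (frameMatrix F ξ y).det)
    (d := fun y => ((g y).det)⁻¹) (hV.mul hV) (hG.inv hG0), pd_mul hV hV, hinv,
    h.pd_det_frameMatrix hx, trace_hypCon, hu]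
  ring

namespace IsHypersurfaceOn

/-- The Blaschke condition makes the cubic trace-free (apolarity). -/
theorem cubicTrace_eq_zero (h : IsHypersurfaceOn O g C F ξ Ξ) {c ε : ℝ} (hc : c ≠ 0)
    (hB : ∀ y ∈ O, c * (frameMatrix F ξ y).det = ε * (c⁻¹ * (dualFrameMatrix Ξ y).det))
    (hx : x ∈ O) (l : Fin n) : cubicTrace (g x) (C x) l = 0 := by
  have hO := h.metric.isOpen
  set V := fun y => (frameMatrix F ξ y).det with hV
  have hVd : DifferentiableAt ℝ V x := differentiableAt_of_contDiffOn hO h.smooth_frameMatrix.det hx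
  -- The dual determinant is eliminated through its product formula with V. After differentiation
  -- the Levi-Civita traces on both sides agree and only the trace of the cubic remains.
  have h1 : ∀ y ∈ O, c ^ 2 * (V y * V y) = ε * (g y).det := by
    intro y hy
    rw [← h.det_frameMatrix_mul hy]
    have h2 := hB y hy
    have h3 : c * (c * V y) = ε * (dualFrameMatrix Ξ y).det := by
      rw [hV]
      simp only
      rw [h2]
      field_simp
    calc _ = (c * (c * V y)) * V y := by ring
      _ = _ := by rw [h3]; ring
  have h2 := pd_congr_on hO h1 hx l
  rw [pd_const_mul (F := fun y => V y * V y) _ (hVd.mul hVd), pd_mul hVd hVd,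
    pd_const_mul _ (differentiableAt_of_contDiffOn hO h.metric.smooth.det hx),
    h.pd_det_frameMatrix hx, h.metric.pd_det_eq hx, trace_hypCon] at h2
  have h3 : c ^ 2 * (V x * V x) * (2 * (((n : ℝ) + 2) * cubicTrace (g x) (C x) l)) = 0 := by
    have h4 : ε * (2 * (LC g l x).trace * (g x).det) = 2 * (LC g l x).trace * (c ^ 2 * (V x * V x)) := by
      rw [h1 x hx]; ring
    rw [h4] at h2
    simp only [hV] at h2 ⊢
    linear_combination h2
  have hV0 : V x ≠ 0 := h.det_frameMatrix_ne_zero hx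
  have h5 := (mul_eq_zero.1 h3).resolve_left (by positivity)
  have h6 := (mul_eq_zero.1 h5).resolve_left two_ne_zero
  exact (mul_eq_zero.1 h6).resolve_left (by positivity)

/-- The Gauss equation of an umbilic hypersurface with trace-free cubic. -/
theorem ricci_eq_of_umbilic (h : IsHypersurfaceOn O g C F ξ Ξ) (hx : x ∈ O)
    (htr : ∀ i, (raiseM g C i x).trace = 0) {μ : ℝ} (hξ : ∀ i, pd i ξ x = μ • pd i F x)
    (i j : Fin n) :
    ricci (christoffel g) x i j
      = trSq (g x) (C x) i j - μ * ((n : ℝ) - 1) * g x i j := by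
  have hg := h.metric
  have hB : ∀ i, pd i ξ x = ∑ k, (if k = i then μ else 0) • pd k F x := fun i => by
    rw [hξ]
    simp
  -- An umbilic shape operator gives curvature of constant-curvature type; the half in -μ/2
  -- compensates the doubling in the product of g with itself.
  have h1 : ∀ l i, g x * curvM (fun k y => LC g k y + raiseM g C k y) l i x
      = knM (fun a b => -μ / 2 * g x a b) (g x) l i := by
    intro l i
    ext k j
    have h2 : ∀ m, curvM (fun k y => LC g k y + raiseM g C k y) l i x m j
        = (if m = i then μ * g x l j else 0) - (if m = l then μ * g x i j else 0) := by
      intro m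
      rw [← h.curvM_eq hx, (h.structure_equations hx hB l i j).1 m]
      split_ifs <;> ring
    rw [Matrix.mul_apply]
    simp only [h2, mul_sub, mul_ite, mul_zero, Finset.sum_sub_distrib, Finset.sum_ite_eq',
      Finset.mem_univ, if_true, knM, kulkarniNomizu, Matrix.of_apply]
    rw [hg.symm_apply hx k i, hg.symm_apply hx k l]
    ring
  have h3 : ∀ l i, g x * curvM (LC g) l i x + g x * (raiseM g C l x * raiseM g C i x
      - raiseM g C i x * raiseM g C l x) = knM (fun a b => -μ / 2 * g x a b) (g x) l i := by
    intro l i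
    rw [← h1 l i]
    exact ((hg.cubic_of_skew h.cubic hx (by rw [h1, knM_transpose])).2).symm
  have h4 := hg.contract_kn hx (K := fun l i => curvM (LC g) l i x + (raiseM g C l x * raiseM g C i x
      - raiseM g C i x * raiseM g C l x)) (fun l i => by rw [Matrix.mul_add, h3]) i j
  simp only [Matrix.add_apply, Finset.sum_add_distrib] at h4
  rw [h.cubic.contract_commutator hx htr, ← ricci_eq, tr2_smul (B := fun i j => g x i j),
    hg.tr2_self hx] at h4
  linear_combination h4

/-- An abundant affine sphere has vanishing trace-free Schouten tensor. -/
theorem schouten_eq (h : IsHypersurfaceOn O g C F ξ Ξ) (hn : 3 ≤ n)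
    (hu : ∀ y ∈ O, ∀ i, cubicTrace (g y) (C y) i = 0) (hx : x ∈ O) {μ : ℝ}
    (hξ : ∀ i, pd i ξ x = μ • pd i F x)
    (hcond : ∀ i j, covDeriv1 (christoffel g) (fun y => cubicTrace (g y) (C y)) x i j =
      schouten g x i j + cubicTrace (g x) (C x) i * cubicTrace (g x) (C x) j
      - normSq1 (g x) (cubicTrace (g x) (C x)) / 2 * g x i j
      + (1 / ((n : ℝ) - 2)) * (trSq (g x) (cubicTraceFree (g x) (C x)) i j
          + ((n : ℝ) - 6) / (2 * ((n : ℝ) + 2) * ((n : ℝ) - 1))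
            * normSq3 (g x) (cubicTraceFree (g x) (C x)) * g x i j)) (i j : Fin n) :
    schouten g x i j - (1 / (n : ℝ)) * tr2 (g x) (schouten g x) * g x i j = 0 := by
  have hn' : (3 : ℝ) ≤ n := by exact_mod_cast hn
  have n0 : (n : ℝ) ≠ 0 := by linarith
  have n2 : (n : ℝ) - 2 ≠ 0 := by linarith
  have hg := h.metric
  have htr : ∀ i, (raiseM g C i x).trace = 0 := by
    intro i
    have h1 := hu x hx i
    rw [cubicTrace] at h1
    have h2 := (mul_eq_zero.1 h1).resolve_left (by positivity)
    rw [← h2]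
    simp only [Matrix.trace, Matrix.diag_apply, h.cubic.raise3_eq hx]
    rfl
  have hC : cubicTraceFree (g x) (C x) = C x := by
    ext i j k
    simp [cubicTraceFree, hu x hx]
  have hcov : ∀ i j, covDeriv1 (christoffel g) (fun y => cubicTrace (g y) (C y)) x i j = 0 := by
    intro i j
    simp only [covDeriv1, hu x hx, mul_zero, Finset.sum_const_zero, sub_zero]
    rw [pd_congr_on hg.isOpen (fun y hy => hu y hy j) hx, pd_const]
  have hnorm : normSq1 (g x) (cubicTrace (g x) (C x)) = 0 := by simp [normSq1, hu x hx]
  -- Modulo multiples of g, the Gauss equation gives (n-2) P = tr(C_X C_Y) and `hcond` gives (n-2) P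
  -- = -tr(C_X C_Y), so 2P is a multiple of g.
  have hP : ∃ κ, ∀ i j, schouten g x i j = κ * g x i j := by
    set κ₁ := -(μ * ((n : ℝ) - 1)) - tr2 (g x) (ricci (christoffel g) x) / (2 * ((n : ℝ) - 1))
      with hκ₁
    set κ₂ := ((n : ℝ) - 6) / (2 * ((n : ℝ) + 2) * ((n : ℝ) - 1)) * normSq3 (g x) (C x) with hκ₂
    refine ⟨1 / ((n : ℝ) - 2) * (κ₁ - κ₂) / 2, fun i j => ?_⟩
    have h1 := hcond i j
    rw [hcov, hu x hx, hu x hx, hnorm, hC, ← hκ₂] at h1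
    have h2 : schouten g x i j = 1 / ((n : ℝ) - 2) * (trSq (g x) (C x) i j + κ₁ * g x i j) := by
      rw [schouten, schoutenOf, h.ricci_eq_of_umbilic hx htr hξ i j, hκ₁]
      ring
    have h3 : trSq (g x) (C x) i j = ((n : ℝ) - 2) * schouten g x i j - κ₁ * g x i j := by
      rw [h2]; field_simp; ring
    rw [h3] at h1
    have e : 1 / ((n : ℝ) - 2) * ((n : ℝ) - 2) = 1 := by field_simp
    linear_combination (-1 / 2 : ℝ) * h1 - schouten g x i j / 2 * e
  obtain ⟨κ, hκ⟩ := hP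
  rw [tr2_congr hκ, tr2_smul (B := fun i j => g x i j), hg.tr2_self hx, hκ]
  field_simp
  ring

/-- If the curvature of the induced connection is that of a sphere, the hypersurface is umbilic. -/
theorem umbilic_of_curvM (h : IsHypersurfaceOn O g C F ξ Ξ) (hn : 3 ≤ n) (hx : x ∈ O) {k : ℝ}
    (hk : ∀ i j a b, curvM (hypCon g C) i j x a b
      = k * (g x j b * (if a = i then 1 else 0) - g x i b * (if a = j then 1 else 0)))
    (i : Fin n) : pd i ξ x = (-k) • pd i F x := by
  choose B hB using h.relative x hx
  have hg := h.metric
  set B' : Fin n → Fin n → ℝ := fun i m => B i m + k * (if m = i then 1 else 0) with hB'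
  -- B' are the coefficients of dξ + k dF, and the relation says that the Gauss equation and `hk`
  -- describe the same curvature. Contracting l and j gives n B' = B'.
  have h1 : ∀ l i j m, g x l j * B' i m = g x i j * B' l m := by
    intro l i j m
    have h2 := (h.structure_equations hx hB l i j).1 m
    rw [hk] at h2
    simp only [hB']
    linear_combination -h2
  have h3 : ∀ i m, B' i m = 0 := by
    intro i m
    have h4 : ∑ l, ∑ j, (g x)⁻¹ l j * (g x l j * B' i m) = n * B' i m := by
      have := hg.tr2_self hx
      rw [tr2] at this
      rw [← this]
      simp only [Finset.sum_mul]
      exact Finset.sum_congr rfl fun l _ => Finset.sum_congr rfl fun j _ => by ring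
    have h5 : ∑ l, ∑ j, (g x)⁻¹ l j * (g x l j * B' i m) = B' i m := by
      rw [Finset.sum_congr rfl fun l _ => Finset.sum_congr rfl fun j _ => show
        (g x)⁻¹ l j * (g x l j * B' i m) = B' l m * ((g x)⁻¹ l j * g x j i) by
          rw [h1, hg.symm_apply hx i j]; ring]
      simp [← Finset.mul_sum, hg.sum_inv_mul hx]
    have h6 : ((n : ℝ) - 1) * B' i m = 0 := by linarith
    have hn' : (3 : ℝ) ≤ n := by exact_mod_cast hn
    exact (mul_eq_zero.1 h6).resolve_left (by linarith)
  rw [hB]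
  have h7 : ∀ m, B i m = if m = i then -k else 0 := by
    intro m
    have := h3 i m
    simp only [hB'] at this
    split_ifs at this ⊢ <;> linarith
  simp [h7]

end IsHypersurfaceOn

end LocalSpheres

/-! ### Passing from the manifold to coordinates. -/

section Charts

open Filter Topology Matrix

variable {n : ℕ} {M : Type*} [TopologicalSpace M] [ChartedSpace (Eu n) M]
  [IsManifold 𝓘(ℝ, Eu n) ∞ M] {e e' : OpenPartialHomeomorph M (Eu n)} {x : Eu n}
  {W : Type*} [NormedAddCommGroup W] [NormedSpace ℝ W]

theorem IsChart.mdifferentiableAt_symm (he : IsChart e) (hx : x ∈ e.target) :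
    MDifferentiableAt 𝓘(ℝ, Eu n) 𝓘(ℝ, Eu n) e.symm x :=
  ((contMDiffOn_symm_of_mem_maximalAtlas he).contMDiffAt (e.open_target.mem_nhds hx)).mdifferentiableAt
    (by simp)

theorem IsChart.mdifferentiableAt (he : IsChart e) {p : M} (hp : p ∈ e.source) :
    MDifferentiableAt 𝓘(ℝ, Eu n) 𝓘(ℝ, Eu n) e p :=
  ((contMDiffOn_of_mem_maximalAtlas he).contMDiffAt (e.open_source.mem_nhds hp)).mdifferentiableAt
    (by simp)

theorem isChart_chartAt (p : M) : IsChart (chartAt (Eu n) p) :=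
  IsManifold.chart_mem_maximalAtlas p

theorem IsChart.contDiffOn_comp_symm (he : IsChart e) {f : M → W} {s : Set M}
    (hf : ContMDiffOn 𝓘(ℝ, Eu n) 𝓘(ℝ, W) ∞ f s) :
    ContDiffOn ℝ ∞ (fun y => f (e.symm y)) (e.target ∩ e.symm ⁻¹' s) := by
  rw [← contMDiffOn_iff_contDiffOn]
  exact hf.comp ((contMDiffOn_symm_of_mem_maximalAtlas he).mono Set.inter_subset_left)
    fun y hy => hy.2

theorem IsChart.contDiffOn_comp_symm' (he : IsChart e) {f : M → W}
    (hf : ContMDiff 𝓘(ℝ, Eu n) 𝓘(ℝ, W) ∞ f) :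
    ContDiffOn ℝ ∞ (fun y => f (e.symm y)) e.target := by
  have h := he.contDiffOn_comp_symm (s := Set.univ) hf.contMDiffOn
  simpa using h

theorem IsChart.contMDiffAt_of_comp_symm (he : IsChart e) {f : M → W} {p : M} (hp : p ∈ e.source)
    (hf : ContDiffAt ℝ ∞ (fun y => f (e.symm y)) (e p)) :
    ContMDiffAt 𝓘(ℝ, Eu n) 𝓘(ℝ, W) ∞ f p := by
  have h1 : ContMDiffAt 𝓘(ℝ, Eu n) 𝓘(ℝ, W) ∞ (fun y => f (e.symm y)) (e p) :=
    contMDiffAt_iff_contDiffAt.2 hf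
  have h2 := h1.comp p
    ((contMDiffOn_of_mem_maximalAtlas he).contMDiffAt (e.open_source.mem_nhds hp))
  refine h2.congr_of_eventuallyEq ?_
  filter_upwards [e.open_source.mem_nhds hp] with q hq
  simp [e.left_inv hq]

theorem IsChart.mfderiv_coordVec (he : IsChart e) (hx : x ∈ e.target) {f : M → W}
    (hf : MDifferentiableAt 𝓘(ℝ, Eu n) 𝓘(ℝ, W) f (e.symm x)) (i : Fin n) :
    mfderiv 𝓘(ℝ, Eu n) 𝓘(ℝ, W) f (e.symm x) (coordVec e x i)
      = pd i (fun y => f (e.symm y)) x := by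
  have h1 := mfderiv_comp x hf (he.mdifferentiableAt_symm hx)
  rw [pd, ← mfderiv_eq_fderiv]
  change _ = mfderiv 𝓘(ℝ, Eu n) 𝓘(ℝ, W) (f ∘ e.symm) x _
  rw [h1]
  rfl

theorem IsChart.mfderiv_symm_comp (he : IsChart e) (hx : x ∈ e.target)
    (X : TangentSpace 𝓘(ℝ, Eu n) (e.symm x)) :
    (mfderiv 𝓘(ℝ, Eu n) 𝓘(ℝ, Eu n) e.symm x
      (mfderiv 𝓘(ℝ, Eu n) 𝓘(ℝ, Eu n) e (e.symm x) X : Eu n) :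
        TangentSpace 𝓘(ℝ, Eu n) (e.symm x)) = X := by
  have hp := e.map_target hx
  have hs : MDifferentiableAt 𝓘(ℝ, Eu n) 𝓘(ℝ, Eu n) e.symm (e (e.symm x)) :=
    he.mdifferentiableAt_symm (by rwa [e.right_inv hx])
  have h1 := mfderiv_comp (e.symm x) hs (he.mdifferentiableAt hp)
  have h2 : e.symm ∘ e =ᶠ[𝓝 (e.symm x)] id := by
    filter_upwards [e.open_source.mem_nhds hp] with q hq
    exact e.left_inv hq
  rw [h2.mfderiv_eq, mfderiv_id] at h1
  have h3 := DFunLike.congr_fun h1 X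
  -- The base points e (e.symm x) and x are only propositionally equal, so the derivatives are
  -- compared as maps of the model space.
  have h4 : ∀ y, y = x → (mfderiv 𝓘(ℝ, Eu n) 𝓘(ℝ, Eu n) e.symm x : Eu n →L[ℝ] Eu n)
      = (mfderiv 𝓘(ℝ, Eu n) 𝓘(ℝ, Eu n) e.symm y : Eu n →L[ℝ] Eu n) := by
    rintro y rfl; rfl
  have h5 := h4 _ (e.right_inv hx)
  have h6 := DFunLike.congr_fun h5 (mfderiv 𝓘(ℝ, Eu n) 𝓘(ℝ, Eu n) e (e.symm x) X : Eu n)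
  exact h6.trans h3.symm

theorem mfderiv_symm_eq_sum (e : OpenPartialHomeomorph M (Eu n)) (x v : Eu n) :
    (mfderiv 𝓘(ℝ, Eu n) 𝓘(ℝ, Eu n) e.symm x v : TangentSpace 𝓘(ℝ, Eu n) (e.symm x))
      = ∑ i, v i • coordVec e x i := by
  have h : v = ∑ i, v i • EuclideanSpace.single i (1 : ℝ) := by
    ext j
    simp [Pi.single_apply]
  have h2 : ∀ L : Eu n →L[ℝ] Eu n, L v = ∑ i, v i • L (EuclideanSpace.single i (1 : ℝ)) := by
    intro L
    conv_lhs => rw [h]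
    simp only [map_sum, map_smul]
  exact h2 (mfderiv 𝓘(ℝ, Eu n) 𝓘(ℝ, Eu n) e.symm x)

theorem IsChart.exists_coordVec (he : IsChart e) (hx : x ∈ e.target)
    (X : TangentSpace 𝓘(ℝ, Eu n) (e.symm x)) : ∃ a : Fin n → ℝ, X = ∑ i, a i • coordVec e x i :=
  ⟨fun i => WithLp.ofLp (mfderiv 𝓘(ℝ, Eu n) 𝓘(ℝ, Eu n) e (e.symm x) X) i,
    (he.mfderiv_symm_comp hx X).symm.trans (mfderiv_symm_eq_sum e x _)⟩

theorem IsChart.coordVec_independent (he : IsChart e) (hx : x ∈ e.target) {a : Fin n → ℝ}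
    (h : ∑ i, a i • coordVec e x i = 0) : a = 0 := by
  have hp := e.map_target hx
  have h1 := mfderiv_comp x (he.mdifferentiableAt hp) (he.mdifferentiableAt_symm hx)
  have h2 : e ∘ e.symm =ᶠ[𝓝 x] id := by
    filter_upwards [e.open_target.mem_nhds hx] with q hq
    exact e.right_inv hq
  rw [h2.mfderiv_eq, mfderiv_id] at h1
  have h3 := DFunLike.congr_fun h1 (WithLp.toLp 2 a : Eu n)
  have h4 := mfderiv_symm_eq_sum e x (WithLp.toLp 2 a)
  have h5 : (mfderiv 𝓘(ℝ, Eu n) 𝓘(ℝ, Eu n) e.symm x (WithLp.toLp 2 a : Eu n) :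
      TangentSpace 𝓘(ℝ, Eu n) (e.symm x)) = 0 := by rw [h4]; exact h
  have h6 : (WithLp.toLp 2 a : Eu n) = 0 := by
    refine h3.trans ?_
    change mfderiv 𝓘(ℝ, Eu n) 𝓘(ℝ, Eu n) e (e.symm x)
      (mfderiv 𝓘(ℝ, Eu n) 𝓘(ℝ, Eu n) e.symm x (WithLp.toLp 2 a : Eu n) :
      TangentSpace 𝓘(ℝ, Eu n) (e.symm x)) = 0
    rw [h5, map_zero]
  ext i
  exact congrArg (fun v : Eu n => v i) h6

theorem PseudoMetric.isMetricOn (g : PseudoMetric n M) (he : IsChart e) :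
    IsMetricOn e.target (g.comp e) where
  isOpen := e.open_target
  smooth := fun i j => g.smooth e he i j
  symm := fun x _ => by
    ext i j
    exact g.symm _ _ _
  det_ne := fun x hx h0 => by
    obtain ⟨a, ha, h1⟩ := Matrix.exists_mulVec_eq_zero_iff.2 h0
    apply ha
    apply he.coordVec_independent hx
    apply g.nondegenerate
    intro Y
    obtain ⟨b, rfl⟩ := he.exists_coordVec hx Y
    rw [g.symm]
    simp only [map_sum, map_smul, LinearMap.sum_apply, LinearMap.smul_apply, smul_eq_mul]
    simp only [Finset.mul_sum]
    rw [Finset.sum_comm]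
    refine Finset.sum_eq_zero fun i _ => ?_
    have h2 := congrFun h1 i
    simp only [Matrix.mulVec, dotProduct, PseudoMetric.comp, Matrix.of_apply, Pi.zero_apply] at h2
    rw [← mul_zero (b i), ← h2, Finset.mul_sum]
    refine Finset.sum_congr rfl fun j _ => ?_
    rw [g.symm]
    ring

theorem RelativeConormalisation.isHypersurfaceOn {N : RelativeConormalisation n M}
    {g : PseudoMetric n M} {C : Tensor3 n M} (h : N.HasMetricAndCubic g C) (he : IsChart e) :
    IsHypersurfaceOn e.target (g.comp e) (C.comp e) (fun y => N.f (e.symm y))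
      (fun y => N.ξ (e.symm y)) (fun y => N.Ξ (e.symm y)) where
  metric := g.isMetricOn he
  smoothC := fun i j k => C.smooth e he i j k
  smoothF := he.contDiffOn_comp_symm' N.smooth_f
  smoothξ := he.contDiffOn_comp_symm' N.smooth_ξ
  smoothΞ := he.contDiffOn_comp_symm' N.smooth_Ξ
  immersion := fun x hx a ha => by
    apply he.coordVec_independent hx
    apply N.immersion
    simp only [← he.mfderiv_coordVec hx (N.smooth_f.mdifferentiable (by simp) _)] at ha
    rw [map_zero, map_sum]
    simp only [map_smul]
    exact ha
  conormal := fun x hx i => by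
    rw [← he.mfderiv_coordVec hx (N.smooth_f.mdifferentiable (by simp) _)]
    exact N.conormal _ _
  dual := fun x _ => N.dual _
  relative := fun x hx i => by
    obtain ⟨Y, hY⟩ := N.relative (e.symm x) (coordVec e x i)
    obtain ⟨a, rfl⟩ := he.exists_coordVec hx Y
    refine ⟨a, ?_⟩
    rw [he.mfderiv_coordVec hx (N.smooth_ξ.mdifferentiable (by simp) _)] at hY
    rw [hY, map_sum]
    refine Finset.sum_congr rfl fun k _ => ?_
    rw [map_smul, he.mfderiv_coordVec hx (N.smooth_f.mdifferentiable (by simp) _)]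
    rfl
  gauss := fun x hx i j => by
    rw [h e he x hx i j]
    rfl

end Charts

/-! ### Affine spheres have vanishing trace-free Schouten tensor. -/

section SpheresToSchouten

open Filter Topology Matrix IsHypersurfaceOn

variable {n : ℕ} {O : Set (Eu n)} {g : Eu n → Matrix (Fin n) (Fin n) ℝ} {x : Eu n}
  {C : Eu n → Fin n → Fin n → Fin n → ℝ} {F ξ : Eu n → Amb n} {Ξ : Eu n → (Amb n →L[ℝ] ℝ)}

theorem IsHypersurfaceOn.conormal_pd_transversal (h : IsHypersurfaceOn O g C F ξ Ξ) (hx : x ∈ O)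
    (i : Fin n) : Ξ x (pd i ξ x) = 0 := by
  obtain ⟨a, ha⟩ := h.relative x hx i
  rw [ha]
  simp [h.conormal x hx]

/-- For a proper relative sphere the shape operator is a multiple of the identity. -/
theorem IsHypersurfaceOn.pd_eq_of_proper (h : IsHypersurfaceOn O g C F ξ Ξ) {m : Eu n → ℝ}
    {x₀ : Amb n} (hm : ∀ y ∈ O, ξ y = m y • (F y - x₀)) (hx : x ∈ O) (i : Fin n) :
    pd i ξ x = m x • pd i F x := by
  have hO := h.metric.isOpen
  -- The factor m carries no regularity, so its inverse ν, smooth by this formula, is differentiated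
  -- instead. Pairing the derivative of F - x₀ = ν ξ with Ξ shows that dν = 0.
  set ν : Eu n → ℝ := fun y => Ξ y (F y - x₀) with hν
  have hF : ContDiffOn ℝ ∞ (fun y => F y - x₀) O := h.smoothF.sub contDiffOn_const
  have hνs : ContDiffOn ℝ ∞ ν O := h.smoothΞ.clm_apply hF
  have h1 : ∀ y ∈ O, m y * ν y = 1 := by
    intro y hy
    have h2 := h.dual y hy
    rw [hm y hy, map_smul, smul_eq_mul] at h2
    exact h2
  have h2 : ∀ y ∈ O, F y - x₀ = ν y • ξ y := by
    intro y hy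
    rw [hm y hy, smul_smul, mul_comm, h1 y hy, one_smul]
  have h3 : pd i F x = ν x • pd i ξ x + pd i ν x • ξ x := by
    rw [← pd_smul (differentiableAt_of_contDiffOn hO hνs hx)
      (differentiableAt_of_contDiffOn hO h.smoothξ hx),
      ← pd_congr_on hO h2 hx, pd_sub (G := fun _ => x₀) (differentiableAt_of_contDiffOn hO h.smoothF hx)
      (differentiableAt_const _), pd_const, sub_zero]
  have h4 := congrArg (Ξ x) h3
  rw [map_add, map_smul, map_smul, h.conormal x hx, h.dual x hx,
    h.conormal_pd_transversal hx] at h4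
  have h5 : pd i ν x = 0 := by simpa using h4.symm
  rw [h3, h5, zero_smul, add_zero, smul_smul, h1 x hx, one_smul]

variable {M : Type*} [TopologicalSpace M] [ChartedSpace (Eu n) M]
  [IsManifold 𝓘(ℝ, Eu n) ∞ M] {e : OpenPartialHomeomorph M (Eu n)}

theorem RelativeConormalisation.volume_coordVec (N : RelativeConormalisation n M) (he : IsChart e)
    (hx : x ∈ e.target) (c : ℝ) : N.volume c (e.symm x) (coordVec e x)
      = c * (frameMatrix (fun y => N.f (e.symm y)) (fun y => N.ξ (e.symm y)) x).det := by
  have h := fun i => he.mfderiv_coordVec hx (N.smooth_f.mdifferentiable (by simp) _) i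
  simp only [volume, ambientVolume, frameMatrix, ← h]

theorem RelativeConormalisation.dualVolume_coordVec (N : RelativeConormalisation n M)
    (he : IsChart e) (hx : x ∈ e.target) (c : ℝ) : N.dualVolume c (e.symm x) (coordVec e x)
      = c⁻¹ * (dualFrameMatrix (fun y => N.Ξ (e.symm y)) x).det := by
  have h := fun i => he.mfderiv_coordVec hx (N.smooth_Ξ.mdifferentiable (by simp) _) i
  simp only [dualVolume, ambientDualVolume, dualFrameMatrix, ← h]
  rfl

theorem schoutenTraceFreeVanishes_of_isAffineSphere (hn : 3 ≤ n) {N : RelativeConormalisation n M}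
    {g : PseudoMetric n M} {C : Tensor3 n M} {c : ℝ} (hc : c ≠ 0) (hN : N.IsAbundant g C)
    (hs : N.IsAffineSphere c) : g.SchoutenTraceFreeVanishes := by
  intro e he x hx i j
  have h := RelativeConormalisation.isHypersurfaceOn hN.1 he
  obtain ⟨⟨ε, -, hB⟩, hS⟩ := hs
  have hu : ∀ y ∈ e.target, ∀ i, cubicTrace (g.comp e y) (C.comp e y) i = 0 := fun y hy i =>
    h.cubicTrace_eq_zero (ε := ε) hc (fun z hz => by
      rw [← N.volume_coordVec he hz, ← N.dualVolume_coordVec he hz]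
      exact hB _ _) hy i
  have hμ : ∃ μ : ℝ, ∀ i, pd i (fun y => N.ξ (e.symm y)) x
      = μ • pd i (fun y => N.f (e.symm y)) x := by
    obtain ⟨μ, x₀, hμ⟩ | ⟨c₀, -, hc₀⟩ := hS
    · exact ⟨μ (e.symm x), h.pd_eq_of_proper (m := fun y => μ (e.symm y)) (fun y _ => hμ _) hx⟩
    · exact ⟨0, fun i => by simp only [hc₀, pd_const, zero_smul]⟩
  obtain ⟨μ, hμ⟩ := hμ
  exact h.schouten_eq hn hu hx hμ (fun i j => hN.2.condu e he x hx i j) i j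

end SpheresToSchouten

/-! ### Abundant manifolds in coordinates. -/

section AbundantCharts

open Filter Topology Matrix

variable {n : ℕ} {O O' : Set (Eu n)} {g : Eu n → Matrix (Fin n) (Fin n) ℝ} {x : Eu n}

theorem IsMetricOn.mono (hg : IsMetricOn O g) (hO' : IsOpen O') (h : O' ⊆ O) : IsMetricOn O' g where
  isOpen := hO'
  smooth := fun i j => (hg.smooth i j).mono h
  symm := fun x hx => hg.symm x (h hx)
  det_ne := fun x hx => hg.det_ne x (h hx)

variable {M : Type*} [TopologicalSpace M] [ChartedSpace (Eu n) M]
  [IsManifold 𝓘(ℝ, Eu n) ∞ M] {e : OpenPartialHomeomorph M (Eu n)}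

/-- A local conformal factor exhibits the curvature as a Kulkarni-Nomizu product with g, and the
Ricci contraction identifies the other factor as the Schouten tensor. Conformal flatness is used
only through this formula, in which the factor φ no longer occurs. -/
theorem PseudoMetric.curvM_of_isConformallyFlat {g : PseudoMetric n M} (h : g.IsConformallyFlat)
    (hn : 3 ≤ n) (he : IsChart e) (hx : x ∈ e.target) (i j : Fin n) :
    g.comp e x * curvM (LC (g.comp e)) i j x = knM (schouten (g.comp e) x) (g.comp e x) i j := by
  obtain ⟨O, φ, hO, hpO, hφ, hflat⟩ := h (e.symm x)
  have hO' : IsOpen (e.target ∩ e.symm ⁻¹' O) := e.isOpen_inter_preimage_symm hO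
  have hg := (g.isMetricOn he).mono hO' Set.inter_subset_left
  have h1 := hg.curvM_of_conformal_flat (he.contDiffOn_comp_symm hφ) ⟨hx, hpO⟩
    (fun l k i j => hflat e he x hx hpO l k i j)
  have h2 : conformalTensor (g.comp e) (fun y => φ (e.symm y)) x = schouten (g.comp e) x := by
    ext a b
    exact hg.eq_schoutenOf ⟨hx, hpO⟩ hn h1 a b
  rw [h1, h2]

theorem PseudoMetric.IsConformallyFlat.isWeylFlat {g : PseudoMetric n M} (h : g.IsConformallyFlat)
    (hn : 3 ≤ n) : g.IsWeylFlat := by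
  intro e he x hx i j k l
  rw [weyl, riem_eq, g.curvM_of_isConformallyFlat h hn he hx]
  exact sub_self _

theorem dFunComp_eq_zero {t : M → ℝ} (ht : ContMDiff 𝓘(ℝ, Eu n) 𝓘(ℝ, ℝ) ∞ t)
    (h : ∀ p X, dFun (n := n) t p X = 0) (he : IsChart e) (hx : x ∈ e.target) :
    dFunComp t e x = 0 := by
  ext i
  rw [dFunComp, ← he.mfderiv_coordVec hx (ht.mdifferentiable (by simp) _)]
  exact h _ _

variable {g : PseudoMetric n M} {S : Tensor3 n M} {t : M → ℝ}

theorem IsAbundantManifold.isCubicOn (h : IsAbundantManifold g S t) (he : IsChart e) :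
    IsCubicOn e.target (S.comp e) where
  smooth := fun i j k => S.smooth e he i j k
  symm₁₂ := fun _ _ _ _ _ => h.symmetric₁₂ _ _ _ _
  symm₂₃ := fun _ _ _ _ _ => h.symmetric₂₃ _ _ _ _

theorem IsAbundantManifold.isSphericalOn (h : IsAbundantManifold g S t) (hn : 3 ≤ n)
    (ht : ∀ p X, dFun (n := n) t p X = 0) (hP : g.SchoutenTraceFreeVanishes) (he : IsChart e) :
    IsSphericalOn e.target (g.comp e) (S.comp e) where
  metric := g.isMetricOn he
  cubic := h.isCubicOn he
  traceFree := h.traceFree e he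
  weyl := fun x hx i j => g.curvM_of_isConformallyFlat h.conformallyFlat hn he hx i j
  schouten_eq := fun x hx i j => sub_eq_zero.1 (hP e he x hx i j)
  hessian := fun x hx i j => by
    have h1 := h.hessian e he x hx i j
    have h2 : covDeriv1 (christoffel (g.comp e)) (dFunComp t e) x i j = 0 := by
      have h3 : pd i (fun y => dFunComp t e y j) x = 0 := by
        rw [pd_congr_on e.open_target (G := fun _ => 0)
          (fun y hy => congrFun (dFunComp_eq_zero h.smooth ht he hy) j) hx, pd_const]
      simp [covDeriv1, h3, dFunComp_eq_zero h.smooth ht he hx]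
    rw [h2, dFunComp_eq_zero h.smooth ht he hx] at h1
    simpa [normSq1] using h1.symm
  curvatureS := fun x hx => by
    refine ⟨schoutenOf (g.comp e) (fun y c a b =>
      christoffel (g.comp e) y c a b - raise3 (g.comp e y) (S.comp e y) c a b) x, fun i j => ?_⟩
    ext k l
    have h2 := h.curvatureS e he x hx i j k l
    simp only [riem_eq] at h2
    rw [← curvM_congr_on e.open_target (Γ := conM fun y c a b =>
      christoffel (g.comp e) y c a b - raise3 (g.comp e y) (S.comp e y) c a b) _ hx, h2]
    · rfl
    · intro a y hy
      ext c b
      simp only [conM, Matrix.of_apply, Matrix.sub_apply, (h.isCubicOn he).raise3_eq hy, raiseM]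

theorem IsCubicOfStructure.comp_eq {C : Tensor3 n M} (h : IsCubicOfStructure g S t C)
    (ht : ∀ p X, dFun (n := n) t p X = 0) (e : OpenPartialHomeomorph M (Eu n)) :
    C.comp e = fun y i j k => 1 / 3 * S.comp e y i j k := by
  ext y i j k
  rw [Tensor3.comp, h, ht, ht, ht]
  simp [Tensor3.comp]

end AbundantCharts

/-! ### Transformation laws under changes of coordinates. -/

section Transitions

open Filter Topology Matrix

variable {n : ℕ} {O O' : Set (Eu n)} {g g' : Eu n → Matrix (Fin n) (Fin n) ℝ} {x : Eu n}
  {C C' : Eu n → Fin n → Fin n → Fin n → ℝ} {τ : Eu n → Eu n}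
  {W : Type*} [NormedAddCommGroup W] [NormedSpace ℝ W]

/-- The Jacobian matrix of a change of coordinates. -/
def jac (τ : Eu n → Eu n) (x : Eu n) : Matrix (Fin n) (Fin n) ℝ :=
  Matrix.of fun i a => pd a τ x i

/-- A change of coordinates `τ`, transforming the metric `g` into `g'`. -/
structure IsTransition (O' O : Set (Eu n)) (τ : Eu n → Eu n)
    (g' g : Eu n → Matrix (Fin n) (Fin n) ℝ) : Prop where
  metric' : IsMetricOn O' g'
  metric : IsMetricOn O g
  mapsTo : ∀ y ∈ O', τ y ∈ O
  smooth : ContDiffOn ℝ ∞ τ O'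
  eq : ∀ y ∈ O', g' y = (jac τ y)ᵀ * g (τ y) * jac τ y

theorem pd_comp {F : Eu n → W} (hτ : DifferentiableAt ℝ τ x) (hF : DifferentiableAt ℝ F (τ x))
    (a : Fin n) : pd a (fun y => F (τ y)) x = ∑ i, jac τ x i a • pd i F (τ x) := by
  have h := (hF.hasFDerivAt.comp x hτ.hasFDerivAt).fderiv
  change fderiv ℝ (F ∘ τ) x _ = _
  rw [h]
  exact fderiv_eq_sum_pd _

theorem pd_apply_eu (hτ : DifferentiableAt ℝ τ x) (a i : Fin n) :
    pd a (fun y => τ y i) x = pd a τ x i := by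
  have h := ((EuclideanSpace.proj (𝕜 := ℝ) i).hasFDerivAt.comp x hτ.hasFDerivAt).fderiv
  have h2 : (fun y => τ y i) = (EuclideanSpace.proj (𝕜 := ℝ) i) ∘ τ := rfl
  rw [pd, h2, h]
  rfl

namespace IsTransition

theorem differentiableAt (h : IsTransition O' O τ g' g) (hx : x ∈ O') : DifferentiableAt ℝ τ x :=
  differentiableAt_of_contDiffOn h.metric'.isOpen h.smooth hx

theorem smooth_jac (h : IsTransition O' O τ g' g) : SmoothM O' (jac τ) := fun i a =>
  (EuclideanSpace.proj (𝕜 := ℝ) i).contDiff.comp_contDiffOn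
    (contDiffOn_pd h.metric'.isOpen h.smooth a)

theorem smoothM_comp (h : IsTransition O' O τ g' g) {G : Eu n → Matrix (Fin n) (Fin n) ℝ}
    (hG : SmoothM O G) : SmoothM O' fun y => G (τ y) := fun i j =>
  (hG i j).comp h.smooth h.mapsTo

theorem pdM_jac_symm (h : IsTransition O' O τ g' g) (hx : x ∈ O') (a b k : Fin n) :
    pdM a (jac τ) x k b = pdM b (jac τ) x k a := by
  have hO := h.metric'.isOpen
  have h1 : ∀ a b, pdM a (jac τ) x k b = pd a (pd b fun y => τ y k) x := fun a b =>
    pd_congr_on hO (fun y hy => (pd_apply_eu (h.differentiableAt hy) b k).symm) hx a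
  rw [h1, h1]
  exact pd_comm hO ((EuclideanSpace.proj (𝕜 := ℝ) k).contDiff.comp_contDiffOn h.smooth) hx a b

theorem pdM_comp (h : IsTransition O' O τ g' g) {G : Eu n → Matrix (Fin n) (Fin n) ℝ}
    (hG : SmoothM O G) (hx : x ∈ O') (a : Fin n) :
    pdM a (fun y => G (τ y)) x = ∑ i, jac τ x i a • pdM i G (τ x) := by
  ext k l
  rw [pdM_apply, pd_comp (F := fun z => G z k l) (h.differentiableAt hx)
    (hG.differentiableAt h.metric.isOpen (h.mapsTo x hx) k l), Matrix.sum_apply]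
  rfl

theorem det_jac_ne (h : IsTransition O' O τ g' g) (hx : x ∈ O') : (jac τ x).det ≠ 0 := fun h0 =>
  h.metric'.det_ne x hx (by rw [h.eq x hx, Matrix.det_mul, h0, mul_zero])

theorem left_cancel (h : IsTransition O' O τ g' g) (hx : x ∈ O')
    {A B : Matrix (Fin n) (Fin n) ℝ}
    (hAB : (jac τ x)ᵀ * g (τ x) * A = (jac τ x)ᵀ * g (τ x) * B) : A = B := by
  have hu : IsUnit ((jac τ x)ᵀ * g (τ x)) := by
    rw [Matrix.isUnit_iff_isUnit_det, Matrix.det_mul, Matrix.det_transpose]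
    exact (mul_ne_zero (h.det_jac_ne hx) (h.metric.det_ne _ (h.mapsTo x hx))).isUnit
  exact hu.mul_left_cancel hAB

/-- The transformation law of the Levi-Civita connection. -/
theorem jac_mul_LC (h : IsTransition O' O τ g' g) (hx : x ∈ O') (a : Fin n) :
    jac τ x * LC g' a x
      = pdM a (jac τ) x + (∑ i, jac τ x i a • LC g i (τ x)) * jac τ x := by
  have hO := h.metric'.isOpen
  have hJ := h.smooth_jac
  have hgτ := h.smoothM_comp h.metric.smooth
  have hτx := h.mapsTo x hx
  set J := jac τ x with hJx
  set P : Fin n → Matrix (Fin n) (Fin n) ℝ := fun a =>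
    pdM a (jac τ) x + (∑ i, J i a • LC g i (τ x)) * J with hP
  -- Uniqueness of the Levi-Civita connection: D is the lowered difference of two torsion-free
  -- metric connections, symmetric in one pair of indices and skew in another, hence zero.
  set D : Fin n → Matrix (Fin n) (Fin n) ℝ := fun a =>
    g' x * LC g' a x - Jᵀ * g (τ x) * P a with hD
  have hPs : ∀ a b k, P a k b = P b k a := by
    intro a b k
    simp only [hP, Matrix.add_apply, h.pdM_jac_symm hx a b k, Matrix.mul_apply, Matrix.sum_apply,
      Matrix.smul_apply, smul_eq_mul, Finset.sum_mul]
    congr 1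
    rw [Finset.sum_comm]
    refine Finset.sum_congr rfl fun i _ => Finset.sum_congr rfl fun j _ => ?_
    simp only [conM, Matrix.of_apply, h.metric.christoffel_symm hτx k i j]
    ring
  have hDs : ∀ a b c, D a c b = D b c a := by
    intro a b c
    simp only [hD, Matrix.sub_apply, Matrix.mul_apply (M := g' x),
      Matrix.mul_apply (M := Jᵀ * g (τ x)), hPs a b]
    congr 1
    refine Finset.sum_congr rfl fun d _ => ?_
    simp only [conM, Matrix.of_apply, h.metric'.christoffel_symm hx d a b]
  have hDt : ∀ a, (D a)ᵀ = -D a := by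
    intro a
    have h1 := h.metric'.pdM_eq hx a
    have h2 : pdM a g' x = (pdM a (jac τ) x)ᵀ * g (τ x) * J
        + Jᵀ * (∑ i, J i a • pdM i g (τ x)) * J + Jᵀ * g (τ x) * pdM a (jac τ) x := by
      rw [pdM_congr_on hO h.eq hx, pdM_mul hO (hJ.transpose.mul hgτ) hJ hx,
        pdM_mul hO hJ.transpose hgτ hx, pdM_transpose, h.pdM_comp h.metric.smooth hx,
        Matrix.add_mul]
    have h3 : (∑ i, J i a • pdM i g (τ x)) = g (τ x) * (∑ i, J i a • LC g i (τ x))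
        + (∑ i, J i a • LC g i (τ x))ᵀ * g (τ x) := by
      simp only [h.metric.pdM_eq hτx, Finset.mul_sum, Matrix.transpose_sum, Finset.sum_mul,
        Matrix.transpose_smul, Matrix.smul_mul, Matrix.mul_smul, smul_add, Finset.sum_add_distrib]
    have hgs := h.metric.symm _ hτx
    have hgs' := h.metric'.symm x hx
    rw [h1, h3] at h2
    simp only [hD, hP, Matrix.transpose_sub, Matrix.transpose_mul, Matrix.transpose_add,
      Matrix.transpose_transpose, hgs, hgs', Matrix.mul_add, Matrix.add_mul, Matrix.mul_assoc]
      at h2 ⊢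
    rw [← sub_eq_zero] at h2 ⊢
    rw [← h2]
    abel
  have hD0 : ∀ a b c, D a b c = 0 := by
    have hk : ∀ a b c, D a b c = -D a c b := fun a b c => congrFun (congrFun (hDt a) c) b
    intro a b c
    have e1 := hk a b c
    have e2 := hDs a b c
    have e3 := hk b c a
    have e4 := hDs b a c
    have e5 := hk c a b
    have e6 := hDs c b a
    have e7 := hDs a c b
    have e8 := hDs b c a
    have e9 := hk b a c
    linarith
  apply h.left_cancel hx
  have h4 : D a = 0 := by
    ext b c
    exact hD0 a b c
  rw [← Matrix.mul_assoc, ← h.eq x hx]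
  exact sub_eq_zero.1 h4

/-- `T'` is the transform of the cubic `T` under the change of coordinates. -/
def _root_.AbundantGeometry.IsCubicTransform (O' : Set (Eu n)) (τ : Eu n → Eu n)
    (T' T : Eu n → Fin n → Fin n → Fin n → ℝ) : Prop :=
  ∀ y ∈ O', ∀ a b c, T' y a b c
    = ∑ i, ∑ j, ∑ k, jac τ y i a * jac τ y j b * jac τ y k c * T (τ y) i j k

theorem jac_mul_raiseM (h : IsTransition O' O τ g' g) (hC : IsCubicTransform O' τ C' C)
    (hx : x ∈ O') (a : Fin n) :
    jac τ x * raiseM g' C' a x = (∑ i, jac τ x i a • raiseM g C i (τ x)) * jac τ x := by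
  have hτx := h.mapsTo x hx
  apply h.left_cancel hx
  rw [← Matrix.mul_assoc, ← h.eq x hx, h.metric'.mul_raiseM hx, Matrix.mul_assoc,
    ← Matrix.mul_assoc (g (τ x)), Finset.mul_sum]
  simp only [Matrix.mul_smul, h.metric.mul_raiseM hτx, Finset.sum_mul, Matrix.smul_mul,
    Finset.mul_sum]
  ext b c
  simp only [lowM, Matrix.of_apply, hC x hx, Matrix.sum_apply, Matrix.smul_apply, smul_eq_mul,
    Matrix.mul_apply, Matrix.transpose_apply, Finset.mul_sum]
  refine Finset.sum_congr rfl fun i _ => Finset.sum_congr rfl fun j _ =>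
    Finset.sum_congr rfl fun k _ => ?_
  ring

theorem jac_mul_hypCon (h : IsTransition O' O τ g' g) (hC : IsCubicTransform O' τ C' C)
    (hC₁ : IsCubicOn O' C') (hC₂ : IsCubicOn O C) (hx : x ∈ O') (a : Fin n) :
    jac τ x * hypCon g' C' a x
      = pdM a (jac τ) x + (∑ i, jac τ x i a • hypCon g C i (τ x)) * jac τ x := by
  simp only [hypCon_eq hC₁ hx, hypCon_eq hC₂ (h.mapsTo x hx), Matrix.mul_add, smul_add,
    Finset.sum_add_distrib, Matrix.add_mul, h.jac_mul_LC hx, h.jac_mul_raiseM hC hx, add_assoc]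

theorem trSq_eq (h : IsTransition O' O τ g' g) (hC : IsCubicTransform O' τ C' C)
    (hC₁ : IsCubicOn O' C') (hC₂ : IsCubicOn O C) (hx : x ∈ O') {m : ℝ}
    (hm : ∀ i j, trSq (g (τ x)) (C (τ x)) i j = m * g (τ x) i j) (a b : Fin n) :
    trSq (g' x) (C' x) a b = m * g' x a b := by
  have hJ : IsUnit (jac τ x).det := (h.det_jac_ne hx).isUnit
  have h1 : ∀ a, raiseM g' C' a x
      = (jac τ x)⁻¹ * ((∑ i, jac τ x i a • raiseM g C i (τ x)) * jac τ x) := by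
    intro a
    rw [← h.jac_mul_raiseM hC hx, Matrix.nonsing_inv_mul_cancel_left _ _ hJ]
  have h2 : trSq (g' x) (C' x) a b
      = ((∑ i, jac τ x i a • raiseM g C i (τ x)) * ∑ j, jac τ x j b • raiseM g C j (τ x)).trace := by
    rw [hC₁.trSq_eq hx, h1, h1, Matrix.mul_assoc, Matrix.mul_assoc _ (jac τ x),
      Matrix.mul_nonsing_inv_cancel_left _ _ hJ, Matrix.trace_mul_comm, Matrix.mul_assoc,
      Matrix.mul_assoc, Matrix.mul_nonsing_inv _ hJ, Matrix.mul_one]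
  rw [h2, h.eq x hx]
  simp only [Finset.sum_mul_sum, Matrix.trace_sum, Matrix.smul_mul, Matrix.mul_smul,
    Matrix.trace_smul, ← hC₂.trSq_eq (h.mapsTo x hx), hm, smul_eq_mul, Matrix.mul_apply,
    Matrix.transpose_apply, Finset.sum_mul, Finset.mul_sum]
  refine Finset.sum_congr rfl fun i _ => Finset.sum_congr rfl fun j _ => ?_
  ring

/-- When tr(T_X T_Y) is a multiple of g, the factor can be compared between charts through this
bilinear form, without transforming the sixfold sum |T|². The case n = 0 is excluded because the
empty matrix has determinant 1. -/
theorem eq_of_trSq (h : IsTransition O' O τ g' g) (hC : IsCubicTransform O' τ C' C)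
    (hC₁ : IsCubicOn O' C') (hC₂ : IsCubicOn O C) (hn : 0 < n) (hx : x ∈ O') {m m' : ℝ}
    (hm : ∀ i j, trSq (g (τ x)) (C (τ x)) i j = m * g (τ x) i j)
    (hm' : ∀ a b, trSq (g' x) (C' x) a b = m' * g' x a b) : m' = m := by
  by_contra hne
  apply h.metric'.det_ne x hx
  have h0 : g' x = 0 := by
    ext a b
    have h1 := h.trSq_eq hC hC₁ hC₂ hx hm a b
    rw [hm', ← sub_eq_zero, ← sub_mul] at h1
    exact (mul_eq_zero.1 h1).resolve_left (sub_ne_zero.2 hne)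
  rw [h0]
  have : Nonempty (Fin n) := ⟨⟨0, hn⟩⟩
  exact Matrix.det_zero

end IsTransition

/-- Pairs `(F, s)` of solutions of `∇dF = g s`, `ds = -λ dF` in coordinates, where `∇ = ∇^g + Ĉ`. -/
structure IsPotentialOn (O : Set (Eu n)) (g : Eu n → Matrix (Fin n) (Fin n) ℝ)
    (C : Eu n → Fin n → Fin n → Fin n → ℝ) (l : ℝ) (F s : Eu n → W) : Prop where
  smoothF : ContDiffOn ℝ ∞ F O
  smooths : ContDiffOn ℝ ∞ s O
  hess : ∀ x ∈ O, ∀ i j, pd i (pd j F) x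
    = (∑ k, hypCon g C i x k j • pd k F x) + g x i j • s x
  grad : ∀ x ∈ O, ∀ i, pd i s x = -l • pd i F x

/-- The second derivatives of τ that occur in the Hessian of F ∘ τ are those in the transformation
law of ∇ (`jac_mul_hypCon`). This independence of coordinates allows solutions found in different
charts to be compared. -/
theorem IsPotentialOn.transform {F s : Eu n → W} {l : ℝ} (hp : IsPotentialOn O g C l F s)
    (h : IsTransition O' O τ g' g) (hC : IsCubicTransform O' τ C' C)
    (hC₁ : IsCubicOn O' C') (hC₂ : IsCubicOn O C) :
    IsPotentialOn O' g' C' l (fun y => F (τ y)) (fun y => s (τ y)) := by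
  have hO := h.metric.isOpen
  have hO' := h.metric'.isOpen
  have hFd : ∀ y ∈ O', DifferentiableAt ℝ F (τ y) := fun y hy =>
    differentiableAt_of_contDiffOn hO hp.smoothF (h.mapsTo y hy)
  have h1 : ∀ y ∈ O', ∀ b, pd b (fun y => F (τ y)) y = ∑ i, jac τ y i b • pd i F (τ y) :=
    fun y hy b => pd_comp (h.differentiableAt hy) (hFd y hy) b
  refine ⟨hp.smoothF.comp h.smooth h.mapsTo, hp.smooths.comp h.smooth h.mapsTo, ?_, ?_⟩
  · intro x hx a b
    have hτx := h.mapsTo x hx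
    have hJ := fun j => h.smooth_jac.differentiableAt hO' hx j b
    have hdF : ∀ j, DifferentiableAt ℝ (pd j F) (τ x) := fun j =>
      differentiableAt_of_contDiffOn hO (contDiffOn_pd hO hp.smoothF j) hτx
    have hc : ∀ j, DifferentiableAt ℝ (fun y => pd j F (τ y)) x := fun j =>
      (hdF j).comp x (h.differentiableAt hx)
    rw [pd_congr_on hO' (fun y hy => h1 y hy b) hx, 
      pd_sum (F := fun j y => jac τ y j b • pd j F (τ y)) fun j _ => (hJ j).smul (hc j)]
    have h2 : ∀ j, pd a (fun y => jac τ y j b • pd j F (τ y)) x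
        = jac τ x j b • (∑ i, jac τ x i a • ((∑ k, hypCon g C i (τ x) k j • pd k F (τ x))
          + g (τ x) i j • s (τ x))) + pdM a (jac τ) x j b • pd j F (τ x) := by
      intro j
      rw [pd_smul (hJ j) (hc j), pd_comp (h.differentiableAt hx) (hdF j)]
      simp only [hp.hess _ hτx]
      rfl
    have h3 : ∀ k, ∑ c, jac τ x k c * hypCon g' C' a x c b
        = pdM a (jac τ) x k b + ∑ j, ∑ i, jac τ x i a * hypCon g C i (τ x) k j * jac τ x j b := by
      intro k
      have := congrFun (congrFun (h.jac_mul_hypCon hC hC₁ hC₂ hx a) k) b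
      simp only [Matrix.mul_apply, Matrix.add_apply, Matrix.sum_apply, Matrix.smul_apply,
        smul_eq_mul, Finset.sum_mul] at this
      rw [this, Finset.sum_comm]
    have h4 : g' x a b = ∑ j, ∑ i, jac τ x i a * g (τ x) i j * jac τ x j b := by
      rw [h.eq x hx]
      simp only [Matrix.mul_apply, Matrix.transpose_apply, Finset.sum_mul]
    have h5 : ∑ c, hypCon g' C' a x c b • ∑ k, jac τ x k c • pd k F (τ x)
        = ∑ k, (∑ c, jac τ x k c * hypCon g' C' a x c b) • pd k F (τ x) := by
      simp only [Finset.smul_sum, Finset.sum_smul, smul_smul]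
      rw [Finset.sum_comm]
      simp only [mul_comm]
    simp only [h2, h1 x hx]
    rw [h5]
    simp only [h3, h4, add_smul, Finset.sum_add_distrib, Finset.sum_smul, Finset.smul_sum,
      smul_add, smul_smul]
    rw [add_comm, ← add_assoc]
    congr 1
    · congr 1
      conv_rhs => rw [Finset.sum_comm]
      refine Finset.sum_congr rfl fun j _ => ?_
      conv_rhs => rw [Finset.sum_comm]
      refine Finset.sum_congr rfl fun i _ => Finset.sum_congr rfl fun k _ => ?_
      congr 1
      ring
    · refine Finset.sum_congr rfl fun j _ => Finset.sum_congr rfl fun i _ => ?_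
      congr 1
      ring
  · intro x hx a
    rw [pd_comp (h.differentiableAt hx)
      (differentiableAt_of_contDiffOn hO hp.smooths (h.mapsTo x hx)), h1 x hx, Finset.smul_sum]
    refine Finset.sum_congr rfl fun i _ => ?_
    rw [hp.grad _ (h.mapsTo x hx), smul_comm]

end Transitions

/-! ### Chart transitions and the constancy of |S|². -/

section ChartTransitions

open Filter Topology Matrix

variable {n : ℕ} {M : Type*} [TopologicalSpace M] [ChartedSpace (Eu n) M]
  {e e' : OpenPartialHomeomorph M (Eu n)} {x y : Eu n}

/-- The domain of the transition map from the chart `e'` to the chart `e`. -/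
def transDomain (e' e : OpenPartialHomeomorph M (Eu n)) : Set (Eu n) :=
  e'.target ∩ e'.symm ⁻¹' e.source

/-- The transition map from the chart `e'` to the chart `e`. -/
def transMap (e' e : OpenPartialHomeomorph M (Eu n)) (y : Eu n) : Eu n := e (e'.symm y)

theorem isOpen_transDomain (e' e : OpenPartialHomeomorph M (Eu n)) : IsOpen (transDomain e' e) :=
  e'.isOpen_inter_preimage_symm e.open_source

theorem transMap_mem (hy : y ∈ transDomain e' e) : transMap e' e y ∈ e.target := e.map_source hy.2

theorem symm_transMap (hy : y ∈ transDomain e' e) : e.symm (transMap e' e y) = e'.symm y :=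
  e.left_inv hy.2

theorem PseudoMetric.toFun_congr (g : PseudoMetric n M) {p q : M} (h : p = q) (X Y : Eu n) :
    g.toFun p X Y = g.toFun q X Y := by subst h; rfl

theorem Tensor3.toFun_congr (T : Tensor3 n M) {p q : M} (h : p = q) (X Y Z : Eu n) :
    T.toFun p X Y Z = T.toFun q X Y Z := by subst h; rfl

variable [IsManifold 𝓘(ℝ, Eu n) ∞ M]

theorem contDiffOn_transMap (he : IsChart e) (he' : IsChart e') :
    ContDiffOn ℝ ∞ (transMap e' e) (transDomain e' e) := by
  rw [← contMDiffOn_iff_contDiffOn]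
  exact (contMDiffOn_of_mem_maximalAtlas he).comp
    ((contMDiffOn_symm_of_mem_maximalAtlas he').mono Set.inter_subset_left) fun y hy => hy.2

theorem coordVec_transform (he : IsChart e) (he' : IsChart e') (hy : y ∈ transDomain e' e)
    (a : Fin n) : (coordVec e' y a : Eu n)
      = (∑ i, jac (transMap e' e) y i a • coordVec e (transMap e' e y) i : Eu n) := by
  have hτ : DifferentiableAt ℝ (transMap e' e) y :=
    differentiableAt_of_contDiffOn (isOpen_transDomain e' e) (contDiffOn_transMap he he') hy
  have h1 := mfderiv_comp y (he.mdifferentiableAt_symm (transMap_mem hy)) hτ.mdifferentiableAt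
  have h2 : e.symm ∘ transMap e' e =ᶠ[𝓝 y] e'.symm := by
    filter_upwards [(isOpen_transDomain e' e).mem_nhds hy] with z hz using symm_transMap hz
  rw [h2.mfderiv_eq, mfderiv_eq_fderiv] at h1
  have h3 := DFunLike.congr_fun h1 (EuclideanSpace.single a (1 : ℝ) : Eu n)
  exact h3.trans (mfderiv_symm_eq_sum e _ _)

theorem PseudoMetric.isTransition (g : PseudoMetric n M) (he : IsChart e) (he' : IsChart e') :
    IsTransition (transDomain e' e) e.target (transMap e' e) (g.comp e') (g.comp e) where
  metric' := (g.isMetricOn he').mono (isOpen_transDomain e' e) Set.inter_subset_left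
  metric := g.isMetricOn he
  mapsTo := fun _ hy => transMap_mem hy
  smooth := contDiffOn_transMap he he'
  eq := fun y hy => by
    ext a b
    have h1 : g.comp e' y a b = g.toFun (e.symm (transMap e' e y))
        (∑ i, jac (transMap e' e) y i a • coordVec e (transMap e' e y) i)
        (∑ j, jac (transMap e' e) y j b • coordVec e (transMap e' e y) j) := by
      rw [PseudoMetric.comp, Matrix.of_apply]
      refine (g.toFun_congr (symm_transMap hy).symm _ _).trans ?_
      congr 1
      · congr 1
        exact coordVec_transform he he' hy a
      · exact coordVec_transform he he' hy b
    rw [h1]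
    simp only [map_sum, map_smul, LinearMap.sum_apply, LinearMap.smul_apply, smul_eq_mul,
      Matrix.mul_apply, Matrix.transpose_apply, PseudoMetric.comp, Matrix.of_apply,
      Finset.sum_mul, Finset.mul_sum]
    refine Finset.sum_congr rfl fun i _ => Finset.sum_congr rfl fun j _ => ?_
    ring

theorem Tensor3.isCubicTransform (T : Tensor3 n M) (he : IsChart e) (he' : IsChart e') :
    IsCubicTransform (transDomain e' e) (transMap e' e) (T.comp e') (T.comp e) := by
  intro y hy a b c
  have h1 : T.comp e' y a b c = T.toFun (e.symm (transMap e' e y))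
      (∑ i, jac (transMap e' e) y i a • coordVec e (transMap e' e y) i)
      (∑ j, jac (transMap e' e) y j b • coordVec e (transMap e' e y) j)
      (∑ k, jac (transMap e' e) y k c • coordVec e (transMap e' e y) k) := by
    rw [Tensor3.comp]
    refine (T.toFun_congr (symm_transMap hy).symm _ _ _).trans ?_
    congr 1
    · congr 1
      · congr 1
        exact coordVec_transform he he' hy a
      · exact coordVec_transform he he' hy b
    · exact coordVec_transform he he' hy c
  rw [h1]
  simp only [map_sum, map_smul, LinearMap.sum_apply, LinearMap.smul_apply, smul_eq_mul,
    Tensor3.comp, Finset.mul_sum]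
  refine Eq.trans (Finset.sum_congr rfl fun k _ => Finset.sum_comm) (Finset.sum_comm.trans
    (Finset.sum_congr rfl fun i _ => Finset.sum_comm.trans (Finset.sum_congr rfl fun j _ =>
      Finset.sum_congr rfl fun k _ => ?_)))
  ring

theorem isLocallyConstant_of_pd_eq_zero {W : Type*} [NormedAddCommGroup W] [NormedSpace ℝ W]
    {ν : M → W} (h : ∀ e : OpenPartialHomeomorph M (Eu n), IsChart e → ∀ x ∈ e.target,
      DifferentiableAt ℝ (fun y => ν (e.symm y)) x ∧ ∀ i, pd i (fun y => ν (e.symm y)) x = 0) :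
    IsLocallyConstant ν := by
  rw [IsLocallyConstant.iff_eventually_eq]
  intro p
  set e := chartAt (Eu n) p
  have hec : IsChart e := isChart_chartAt p
  have hp : p ∈ e.source := mem_chart_source _ p
  obtain ⟨r, hr, hball⟩ := Metric.isOpen_iff.1 e.open_target (e p) (e.map_source hp)
  have hconst : ∀ z ∈ Metric.ball (e p) r, ν (e.symm z) = ν (e.symm (e p)) := by
    intro z hz
    refine (convex_ball (e p) r).is_const_of_fderivWithin_eq_zero (𝕜 := ℝ)
      (f := fun y => ν (e.symm y))
      (fun w hw => (h e hec w (hball hw)).1.differentiableWithinAt)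
      (fun w hw => ?_) hz (Metric.mem_ball_self hr)
    rw [fderivWithin_of_isOpen Metric.isOpen_ball hw]
    refine ContinuousLinearMap.ext fun v => ?_
    rw [fderiv_eq_sum_pd]
    simp [(h e hec w (hball hw)).2]
  filter_upwards [(e.continuousAt hp).eventually (Metric.ball_mem_nhds _ hr),
    e.open_source.mem_nhds hp] with q hq hqs
  have h3 := hconst _ hq
  rwa [e.left_inv hqs, e.left_inv hp] at h3

variable {g : PseudoMetric n M} {S : Tensor3 n M} {t : M → ℝ}

/-- The norm of `S`, computed in any chart, is a constant. -/
theorem IsAbundantManifold.exists_normSq3_eq [PreconnectedSpace M] (h : IsAbundantManifold g S t)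
    (hn : 3 ≤ n) (ht : ∀ p X, dFun (n := n) t p X = 0) (hP : g.SchoutenTraceFreeVanishes) :
    ∃ N : ℝ, ∀ e : OpenPartialHomeomorph M (Eu n), IsChart e → ∀ x ∈ e.target,
      normSq3 (g.comp e x) (S.comp e x) = N := by
  have hs : ∀ {e : OpenPartialHomeomorph M (Eu n)}, IsChart e → _ := fun he =>
    h.isSphericalOn hn ht hP he
  have n0 : (n : ℝ) ≠ 0 := by
    have : 0 < n := by omega
    positivity
  -- |S|² does not depend on the chart because |S|²/n is the factor of g in tr(S_X S_Y).
  have hinv : ∀ e e' : OpenPartialHomeomorph M (Eu n), IsChart e → IsChart e' →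
      ∀ p, p ∈ e.source → p ∈ e'.source → normSq3 (g.comp e' (e' p)) (S.comp e' (e' p))
        = normSq3 (g.comp e (e p)) (S.comp e (e p)) := by
    intro e e' he he' p hp hp'
    have hy : e' p ∈ transDomain e' e :=
      ⟨e'.map_source hp', by rw [Set.mem_preimage, e'.left_inv hp']; exact hp⟩
    have hτ : transMap e' e (e' p) = e p := by rw [transMap, e'.left_inv hp']
    have hcub := h.isCubicOn he'
    have h1 := (g.isTransition he he').eq_of_trSq (S.isCubicTransform he he')
      ⟨fun i j k => (hcub.smooth i j k).mono Set.inter_subset_left,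
        fun z hz => hcub.symm₁₂ z hz.1, fun z hz => hcub.symm₂₃ z hz.1⟩ (h.isCubicOn he)
      (by omega) hy
      (fun i j => by
        rw [hτ]
        exact ((hs he).trSq_eq_and_schouten hn (e.map_source hp) i j).1)
      (fun i j => ((hs he').trSq_eq_and_schouten hn (e'.map_source hp') i j).1)
    field_simp at h1
    exact h1
  set ν : M → ℝ := fun p => normSq3 (g.comp (chartAt (Eu n) p) (chartAt (Eu n) p p))
    (S.comp (chartAt (Eu n) p) (chartAt (Eu n) p p)) with hν
  have hνe : ∀ e : OpenPartialHomeomorph M (Eu n), IsChart e → ∀ x ∈ e.target,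
      normSq3 (g.comp e x) (S.comp e x) = ν (e.symm x) := by
    intro e he x hx
    have h1 := hinv (chartAt (Eu n) (e.symm x)) e (isChart_chartAt _) he (e.symm x)
      (mem_chart_source _ _) (e.map_target hx)
    rwa [e.right_inv hx] at h1
  have hloc : IsLocallyConstant ν := isLocallyConstant_of_pd_eq_zero fun e he x hx => by
    have h1 := fun z hz => (hνe e he z hz).symm
    refine ⟨?_, fun i => ?_⟩
    · refine (differentiableAt_of_contDiffOn e.open_target (hs he).smooth_normSq3 hx
        ).congr_of_eventuallyEq ?_
      filter_upwards [e.open_target.mem_nhds hx] with z hz using h1 z hz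
    · rw [pd_congr_on e.open_target h1 hx, (hs he).pd_normSq3 hn hx]
  by_cases hM : Nonempty M
  · obtain ⟨p₀⟩ := hM
    refine ⟨ν p₀, fun e he x hx => ?_⟩
    rw [hνe e he x hx]
    exact hloc.apply_eq_of_preconnectedSpace _ _
  · exact ⟨0, fun e he x _ => (hM ⟨e.symm x⟩).elim⟩

end ChartTransitions

/-! ### The system ∇dF = g s, ds = -λ dF as a flat connection on jets. -/

section LocalSolutions

open Filter Topology Matrix

variable {n : ℕ} {O : Set (Eu n)} {g : Eu n → Matrix (Fin n) (Fin n) ℝ} {x : Eu n}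
  {C : Eu n → Fin n → Fin n → Fin n → ℝ} {l : ℝ}
  {E : Type*} [NormedAddCommGroup E] [NormedSpace ℝ E] [FiniteDimensional ℝ E]
  {V : Type*} [NormedAddCommGroup V] [NormedSpace ℝ V]
  {W : Type*} [NormedAddCommGroup W] [NormedSpace ℝ W]

variable (n E) in
/-- The values `(F, dF, s)` of a pair of functions and of the differential of the first one. -/
abbrev Jet : Type _ := E × (Fin n → E) × E

theorem pd_clm (L : V →L[ℝ] W) {F : Eu n → V} (hF : DifferentiableAt ℝ F x) (i : Fin n) :
    pd i (fun y => L (F y)) x = L (pd i F x) := by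
  have h := (L.hasFDerivAt.comp x hF.hasFDerivAt).fderiv
  change fderiv ℝ (L ∘ F) x _ = _
  rw [h]
  rfl

/-- The endomorphism of the space of jets that gives their derivative in the `i`-th direction. -/
def jetOp (Γ : Matrix (Fin n) (Fin n) ℝ) (b : Fin n → ℝ) (l : ℝ) (i : Fin n) :
    Jet n E →L[ℝ] Jet n E :=
  LinearMap.toContinuousLinearMap
    { toFun := fun w =>
        (w.2.1 i, fun j => ∑ k, Γ k j • w.2.1 k + b j • w.2.2, -l • w.2.1 i)
      map_add' := fun v w => by
        ext <;> simp [smul_add, Finset.sum_add_distrib]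
        abel
      map_smul' := fun c w => by
        ext <;> simp [smul_comm c, Finset.smul_sum] }

@[simp] theorem jetOp_apply (Γ : Matrix (Fin n) (Fin n) ℝ) (b : Fin n → ℝ) (l : ℝ) (i : Fin n)
    (w : Jet n E) : jetOp Γ b l i w
      = (w.2.1 i, fun j => ∑ k, Γ k j • w.2.1 k + b j • w.2.2, -l • w.2.1 i) := rfl

/-- The connection form on jets whose parallel sections are the solutions of
`∇dF = g s`, `ds = -l dF`. -/
def jetForm (E : Type*) [NormedAddCommGroup E] [NormedSpace ℝ E] [FiniteDimensional ℝ E]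
    (g : Eu n → Matrix (Fin n) (Fin n) ℝ) (C : Eu n → Fin n → Fin n → Fin n → ℝ) (l : ℝ)
    (x : Eu n) : Eu n →L[ℝ] (Jet n E →L[ℝ] Jet n E) :=
  ∑ i, (EuclideanSpace.proj (𝕜 := ℝ) i : Eu n →L[ℝ] ℝ).smulRight
    (jetOp (hypCon g C i x) (g x i) l i)

theorem jetForm_apply (v : Eu n) (w : Jet n E) :
    jetForm E g C l x v w = ∑ i, v i • jetOp (hypCon g C i x) (g x i) l i w := by
  simp [jetForm, ContinuousLinearMap.sum_apply]

theorem contDiffOn_jetOp (hg : IsMetricOn O g) (hΓ : ∀ i, SmoothM O (hypCon g C i)) (i : Fin n)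
    (w : Jet n E) : ContDiffOn ℝ ∞ (fun x => jetOp (hypCon g C i x) (g x i) l i w) O := by
  simp only [jetOp_apply]
  refine contDiffOn_const.prodMk (ContDiffOn.prodMk (contDiffOn_pi.2 fun j => ?_)
    contDiffOn_const)
  exact (ContDiffOn.sum fun k _ => (hΓ i k j).smul contDiffOn_const).add
    ((hg.smooth i j).smul contDiffOn_const)

theorem contDiffOn_jetForm (hg : IsMetricOn O g) (hΓ : ∀ i, SmoothM O (hypCon g C i)) :
    ContDiffOn ℝ ∞ (jetForm E g C l) O := by
  refine contDiffOn_clm_apply.2 fun v => contDiffOn_clm_apply.2 fun w => ?_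
  simp only [jetForm_apply]
  exact ContDiffOn.sum fun i _ => (contDiffOn_jetOp (l := l) hg hΓ i w).const_smul (v i)

/-- This is the coefficient of s in the integrability conditions. The derivatives of g cancel
against the Levi-Civita part, and C drops out by its symmetry. -/
theorem IsMetricOn.codazzi (hg : IsMetricOn O g) (hC : IsCubicOn O C) (hx : x ∈ O)
    (i j m : Fin n) : pd i (fun y => g y j m) x - pd j (fun y => g y i m) x
      + ∑ k, hypCon g C j x k m * g x i k - ∑ k, hypCon g C i x k m * g x j k = 0 := by
  have h1 : ∀ i j, pd i (fun y => g y j m) x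
      = (g x * LC g i x) j m + ∑ k, LC g i x k j * g x k m := fun i j =>
    congrFun (congrFun (hg.pdM_eq hx i) j) m
  have h2 : ∀ i j, ∑ k, hypCon g C j x k m * g x i k = (g x * LC g j x) i m + C x j i m := by
    intro i j
    have h3 : C x j i m = (g x * raiseM g C j x) i m := by rw [hg.mul_raiseM hx]; rfl
    rw [h3, ← Matrix.add_apply, ← Matrix.mul_add, ← hypCon_eq hC hx, Matrix.mul_apply]
    exact Finset.sum_congr rfl fun k _ => mul_comm _ _
  rw [h1, h1, h2, h2, hC.symm₁₂ x hx j i]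
  have h4 : ∀ k, LC g j x k i = LC g i x k j := fun k => hg.christoffel_symm hx k j i
  simp only [h4]
  ring

/-- The integrability conditions. -/
theorem jetOp_integrable (hg : IsMetricOn O g) (hC : IsCubicOn O C) (hx : x ∈ O)
    (hΓ : ∀ i, SmoothM O (hypCon g C i))
    (hK : ∀ i j a b, curvM (hypCon g C) i j x a b
      = l * (g x j b * (if a = i then 1 else 0) - g x i b * (if a = j then 1 else 0)))
    (i j : Fin n) (w : Jet n E) :
    pd i (fun y => jetOp (hypCon g C j y) (g y j) l j w) x
      - pd j (fun y => jetOp (hypCon g C i y) (g y i) l i w) x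
      + jetOp (hypCon g C j x) (g x j) l j (jetOp (hypCon g C i x) (g x i) l i w)
      - jetOp (hypCon g C i x) (g x i) l i (jetOp (hypCon g C j x) (g x j) l j w) = 0 := by
  have hO := hg.isOpen
  have hd := fun i => differentiableAt_of_contDiffOn hO (contDiffOn_jetOp (l := l) hg hΓ i w) hx
  have hsymm : ∀ i j k, hypCon g C i x k j = hypCon g C j x k i := by
    intro i j k
    simp only [hypCon_eq hC hx, Matrix.add_apply, hC.raiseM_symm hx k i j]
    congr 1
    exact hg.christoffel_symm hx k i j
  have h1 : ∀ i j, (pd i (fun y => jetOp (hypCon g C j y) (g y j) l j w) x).1 = 0 := by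
    intro i j
    have := pd_clm (ContinuousLinearMap.fst ℝ E ((Fin n → E) × E)) (hd j) i
    refine this.symm.trans ?_
    exact pd_const _ _ _
  have h3 : ∀ i j, (pd i (fun y => jetOp (hypCon g C j y) (g y j) l j w) x).2.2 = 0 := by
    intro i j
    have := pd_clm ((ContinuousLinearMap.snd ℝ (Fin n → E) E).comp
      (ContinuousLinearMap.snd ℝ E ((Fin n → E) × E))) (hd j) i
    refine this.symm.trans ?_
    exact pd_const _ _ _
  have h2 : ∀ i j m, (pd i (fun y => jetOp (hypCon g C j y) (g y j) l j w) x).2.1 m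
      = ∑ k, pdM i (hypCon g C j) x k m • w.2.1 k + pd i (fun y => g y j m) x • w.2.2 := by
    intro i j m
    have := pd_clm ((ContinuousLinearMap.proj (R := ℝ) (φ := fun _ : Fin n => E) m).comp
      ((ContinuousLinearMap.fst ℝ (Fin n → E) E).comp
      (ContinuousLinearMap.snd ℝ E ((Fin n → E) × E)))) (hd j) i
    refine this.symm.trans ?_
    change pd i (fun y => ∑ k, hypCon g C j y k m • w.2.1 k + g y j m • w.2.2) x = _
    have hΓd := fun k => (hΓ j).differentiableAt hO hx k m
    have hgd := hg.smooth.differentiableAt hO hx j m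
    have hs : ∀ {c : Eu n → ℝ} (v : E), DifferentiableAt ℝ c x →
        pd i (fun y => c y • v) x = pd i c x • v := by
      intro c v hc
      rw [pd_smul (F := fun _ => v) hc (differentiableAt_const _), pd_const, smul_zero, zero_add]
    rw [pd_add (F := fun y => ∑ k, hypCon g C j y k m • w.2.1 k) (G := fun y => g y j m • w.2.2)
      (DifferentiableAt.fun_sum fun k _ => (hΓd k).smul_const _) (hgd.smul_const _),
      pd_sum (F := fun k y => hypCon g C j y k m • w.2.1 k) (fun k _ => (hΓd k).smul_const _), hs _ hgd]
    congr 1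
    exact Finset.sum_congr rfl fun k _ => hs _ (hΓd k)
  -- The components of F and s vanish because the connection and g are symmetric. In the component
  -- of dF the coefficients of dF are the curvature minus its prescribed value, and the coefficient
  -- of s is the Codazzi expression.
  refine Prod.ext ?_ (Prod.ext (funext fun m => ?_) ?_)
  · simp only [Prod.fst_sub, Prod.fst_add, h1]
    simp [hsymm j i, hg.symm_apply hx j i]
  · simp only [Prod.fst_sub, Prod.fst_add, Prod.snd_sub, Prod.snd_add, Pi.sub_apply, Pi.add_apply,
      h2]
    simp only [jetOp_apply]
    have h4 : ∀ i j, ∑ k, hypCon g C j x k m • (∑ p, hypCon g C i x p k • w.2.1 p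
        + g x i k • w.2.2) = ∑ k, (hypCon g C i x * hypCon g C j x) k m • w.2.1 k
          + (∑ k, hypCon g C j x k m * g x i k) • w.2.2 := by
      intro i j
      simp only [smul_add, Finset.sum_add_distrib, Finset.smul_sum, smul_smul, Matrix.mul_apply,
        Finset.sum_smul]
      rw [Finset.sum_comm]
      simp only [mul_comm]
    have h5 : ∀ i j, g x j m • -l • w.2.1 i
        = ∑ k, (-l * (g x j m * (if k = i then 1 else 0))) • w.2.1 k := by
      intro i j
      simp [smul_smul, mul_comm]
    rw [h4, h4, h5, h5]
    have h6 := hg.codazzi hC hx i j m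
    have h7 : (∑ k, (curvM (hypCon g C) i j x k m
        - l * (g x j m * (if k = i then 1 else 0) - g x i m * (if k = j then 1 else 0))) • w.2.1 k)
        + (pd i (fun y => g y j m) x - pd j (fun y => g y i m) x
      + ∑ k, hypCon g C j x k m * g x i k - ∑ k, hypCon g C i x k m * g x j k) • w.2.2 = 0 := by
      rw [h6, zero_smul, add_zero]
      exact Finset.sum_eq_zero fun k _ => by rw [hK, sub_self, zero_smul]
    refine Eq.trans ?_ h7
    simp only [curvM, Matrix.sub_apply, Matrix.add_apply, sub_smul, add_smul, mul_sub,
      Finset.sum_sub_distrib, Finset.sum_add_distrib, neg_mul, neg_smul, Finset.sum_neg_distrib]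
    abel
  · simp only [Prod.snd_sub, Prod.snd_add, h3]
    simp [hsymm j i, hg.symm_apply hx j i]

/-- Flatness is bilinear in u and v, so it reduces to the identity `jetOp_integrable` for coordinate
directions. -/
theorem isFlatOn_jetForm (hg : IsMetricOn O g) (hC : IsCubicOn O C)
    (hΓ : ∀ i, SmoothM O (hypCon g C i))
    (hK : ∀ x ∈ O, ∀ i j a b, curvM (hypCon g C) i j x a b
      = l * (g x j b * (if a = i then 1 else 0) - g x i b * (if a = j then 1 else 0))) :
    IsFlatOn (jetForm E g C l) O := by
  intro x hx u v
  have hO := hg.isOpen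
  have hd := fun i w => differentiableAt_of_contDiffOn hO
    (contDiffOn_jetOp (E := E) (l := l) hg hΓ i w) hx
  have hA := differentiableAt_of_contDiffOn hO (contDiffOn_jetForm (E := E) (l := l) hg hΓ) hx
  refine ContinuousLinearMap.ext fun w => ?_
  have h1 : ∀ u v : Eu n, fderiv ℝ (jetForm E g C l) x u v w
      = ∑ i, ∑ j, (u i * v j) • pd i (fun y => jetOp (hypCon g C j y) (g y j) l j w) x := by
    intro u v
    have h2 : ∀ i, pd i (jetForm E g C l) x v w
        = ∑ j, v j • pd i (fun y => jetOp (hypCon g C j y) (g y j) l j w) x := by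
      intro i
      have h3 := pd_clm ((ContinuousLinearMap.apply ℝ (Jet n E) w).comp
        (ContinuousLinearMap.apply ℝ (Jet n E →L[ℝ] Jet n E) v)) hA i
      refine h3.symm.trans ?_
      change pd i (fun y => jetForm E g C l y v w) x = _
      simp only [jetForm_apply]
      rw [pd_sum (F := fun j y => v j • jetOp (hypCon g C j y) (g y j) l j w)
        fun j _ => (hd j w).const_smul (v j)]
      exact Finset.sum_congr rfl fun j _ => pd_const_smul (v j) (hd j w) i
    have h5 := fderiv_eq_sum_pd (F := jetForm E g C l) (x := x) u
    refine (DFunLike.congr_fun (DFunLike.congr_fun h5 v) w).trans ?_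
    rw [ContinuousLinearMap.sum_apply, ContinuousLinearMap.sum_apply]
    refine Finset.sum_congr rfl fun i _ => ?_
    rw [ContinuousLinearMap.smul_apply, ContinuousLinearMap.smul_apply, h2, Finset.smul_sum]
    exact Finset.sum_congr rfl fun j _ => smul_smul _ _ _
  have h4 : ∀ u v : Eu n, (jetForm E g C l x v * jetForm E g C l x u) w
      = ∑ i, ∑ j, (u i * v j) • jetOp (hypCon g C j x) (g x j) l j
        (jetOp (hypCon g C i x) (g x i) l i w) := by
    intro u v
    rw [mul_apply_eq_comp, jetForm_apply, jetForm_apply]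
    rw [Finset.sum_comm]
    refine Finset.sum_congr rfl fun j _ => ?_
    rw [map_sum, Finset.smul_sum]
    refine Finset.sum_congr rfl fun i _ => ?_
    rw [map_smul, smul_smul, mul_comm]
  rw [_root_.sub_apply, _root_.add_apply, _root_.sub_apply,
    h1, h1 v u, h4, h4 v u, Finset.sum_comm (f := fun i j => (v i * u j) •
      pd i (fun y => jetOp (hypCon g C j y) (g y j) l j w) x),
    Finset.sum_comm (f := fun i j => (v i * u j) • jetOp (hypCon g C j x) (g x j) l j
        (jetOp (hypCon g C i x) (g x i) l i w))]
  simp only [← Finset.sum_sub_distrib, ← Finset.sum_add_distrib]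
  refine Finset.sum_eq_zero fun i _ => Finset.sum_eq_zero fun j _ => ?_
  rw [mul_comm (v j), ← smul_sub, ← smul_add, ← smul_sub,
    jetOp_integrable hg hC hx hΓ (hK x hx), smul_zero]

/-- The jet of a pair of functions. -/
def jetOf (F s : Eu n → E) (x : Eu n) : Jet n E := (F x, fun i => pd i F x, s x)

theorem IsPotentialOn.contDiffOn_jetOf {F s : Eu n → E} (h : IsPotentialOn O g C l F s)
    (hO : IsOpen O) : ContDiffOn ℝ ∞ (jetOf F s) O :=
  h.smoothF.prodMk ((contDiffOn_pi.2 fun i => contDiffOn_pd hO h.smoothF i).prodMk h.smooths)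

theorem IsPotentialOn.hasFDerivAt_jetOf {F s : Eu n → E} (h : IsPotentialOn O g C l F s)
    (hO : IsOpen O) (hx : x ∈ O) :
    HasFDerivAt (jetOf F s) ((ContinuousLinearMap.apply ℝ (Jet n E) (jetOf F s x)).comp
      (jetForm E g C l x)) x := by
  have hd := differentiableAt_of_contDiffOn hO (h.contDiffOn_jetOf hO) hx
  refine hd.hasFDerivAt.congr_fderiv (ContinuousLinearMap.ext fun v => Eq.symm ?_)
  refine Eq.trans ?_ (fderiv_eq_sum_pd v).symm
  refine (jetForm_apply v _).trans (Finset.sum_congr rfl fun i _ => ?_)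
  congr 1
  rw [jetOp_apply]
  refine Prod.ext ?_ (Prod.ext (funext fun m => ?_) ?_)
  · exact pd_clm (ContinuousLinearMap.fst ℝ E ((Fin n → E) × E)) hd i
  · have h1 := pd_clm ((ContinuousLinearMap.proj (R := ℝ) (φ := fun _ : Fin n => E) m).comp
      ((ContinuousLinearMap.fst ℝ (Fin n → E) E).comp
      (ContinuousLinearMap.snd ℝ E ((Fin n → E) × E)))) hd i
    refine Eq.trans ?_ h1
    exact (h.hess x hx i m).symm
  · have h1 := pd_clm ((ContinuousLinearMap.snd ℝ (Fin n → E) E).comp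
      (ContinuousLinearMap.snd ℝ E ((Fin n → E) × E))) hd i
    refine Eq.trans ?_ h1
    exact (h.grad x hx i).symm

theorem isPotentialOn_of_hasFDerivAt {J : Eu n → Jet n E} (hO : IsOpen O)
    (hJ : ContDiffOn ℝ ∞ J O) (hd : ∀ x ∈ O, ∀ i, pd i J x
      = jetOp (hypCon g C i x) (g x i) l i (J x)) :
    IsPotentialOn O g C l (fun x => (J x).1) (fun x => (J x).2.2) ∧
      ∀ x ∈ O, jetOf (fun x => (J x).1) (fun x => (J x).2.2) x = J x := by
  have hdiff := fun x hx => differentiableAt_of_contDiffOn hO hJ (x := x) hx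
  have h1 : ∀ x ∈ O, ∀ i, pd i (fun x => (J x).1) x = (J x).2.1 i := by
    intro x hx i
    have h := pd_clm (ContinuousLinearMap.fst ℝ E ((Fin n → E) × E)) (hdiff x hx) i
    refine h.trans ?_
    rw [hd x hx]
    rfl
  refine ⟨⟨hJ.fst, hJ.snd.snd, fun x hx i j => ?_, fun x hx i => ?_⟩, fun x hx => ?_⟩
  · rw [pd_congr_on hO (fun y hy => h1 y hy j) hx]
    have h2 := pd_clm ((ContinuousLinearMap.proj (R := ℝ) (φ := fun _ : Fin n => E) j).comp
      ((ContinuousLinearMap.fst ℝ (Fin n → E) E).comp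
      (ContinuousLinearMap.snd ℝ E ((Fin n → E) × E)))) (hdiff x hx) i
    refine h2.trans ?_
    rw [hd x hx]
    simp only [h1 x hx]
    rfl
  · have h2 := pd_clm ((ContinuousLinearMap.snd ℝ (Fin n → E) E).comp
      (ContinuousLinearMap.snd ℝ E ((Fin n → E) × E))) (hdiff x hx) i
    refine h2.trans ?_
    rw [hd x hx, h1 x hx]
    rfl
  · exact Prod.ext rfl (Prod.ext (funext fun i => h1 x hx i) rfl)

/-- The fundamental solution Y, applied to w, is the jet of the solution with initial jet w. For any
other solution near y the inverse of Y applied to its jet has zero derivative, and its constant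
value is the label w. So germs of solutions are labelled by jets, which is the input for gluing. -/
theorem exists_local_potentials (hg : IsMetricOn O g) (hC : IsCubicOn O C)
    (hΓ : ∀ i, SmoothM O (hypCon g C i))
    (hK : ∀ x ∈ O, ∀ i j a b, curvM (hypCon g C) i j x a b
      = l * (g x j b * (if a = i then 1 else 0) - g x i b * (if a = j then 1 else 0)))
    {x₀ : Eu n} (hx₀ : x₀ ∈ O) :
    ∃ r > 0, Metric.ball x₀ r ⊆ O ∧ ∃ F s : Jet n E → Eu n → E,
      (∀ w, IsPotentialOn (Metric.ball x₀ r) g C l (F w) (s w)) ∧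
      (∀ w, jetOf (F w) (s w) x₀ = w) ∧
      ∀ y ∈ Metric.ball x₀ r, ∀ F' s' : Eu n → E, ∀ O' ∈ 𝓝 y, IsPotentialOn O' g C l F' s' →
        ∃! w, ∀ᶠ z in 𝓝 y, (F' z, s' z) = (F w z, s w z) := by
  obtain ⟨r, hr, hball, Y, hY0, hYs, hY⟩ := exists_fundamentalSolution hg.isOpen hx₀
    (contDiffOn_jetForm (E := E) (l := l) hg hΓ) (isFlatOn_jetForm hg hC hΓ hK)
  have hbO : IsOpen (Metric.ball x₀ r) := Metric.isOpen_ball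
  have hsol := fun w => isPotentialOn_of_hasFDerivAt (O := Metric.ball x₀ r) (g := g) (C := C)
    (l := l) (J := fun y => Y y w) hbO (hYs.clm_apply contDiffOn_const) (fun y hy i => by
      have h1 := pd_clm (ContinuousLinearMap.apply ℝ (Jet n E) w) (hY y hy).1.differentiableAt i
      refine h1.trans ?_
      rw [pd, (hY y hy).1.fderiv, formMul_apply, ContinuousLinearMap.apply_apply,
        mul_apply_eq_comp, jetForm_apply]
      simp)
  refine ⟨r, hr, hball, fun w y => (Y y w).1, fun w y => (Y y w).2.2, fun w => (hsol w).1,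
    fun w => ?_, ?_⟩
  · rw [(hsol w).2 x₀ (Metric.mem_ball_self hr), hY0]
    rfl
  intro y hy F' s' O' hO' hp
  obtain ⟨ρ, hρ, hρO⟩ := Metric.mem_nhds_iff.1 (Filter.inter_mem hO' (hbO.mem_nhds hy))
  have hp' : IsPotentialOn (Metric.ball y ρ) g C l F' s' :=
    ⟨hp.smoothF.mono fun z hz => (hρO hz).1, hp.smooths.mono fun z hz => (hρO hz).1,
      fun z hz => hp.hess z (hρO hz).1, fun z hz => hp.grad z (hρO hz).1⟩
  have hyρ := Metric.mem_ball_self (x := y) hρ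
  have hderiv : ∀ z ∈ Metric.ball y ρ,
      HasFDerivAt (fun z => Ring.inverse (Y z) (jetOf F' s' z)) (0 : Eu n →L[ℝ] Jet n E) z := by
    intro z hz
    obtain ⟨hYz, u, hu⟩ := hY z (hρO hz).2
    have h1 := hp'.hasFDerivAt_jetOf Metric.isOpen_ball hz
    have h2 := hasFDerivAt_ringInverse (𝕜 := ℝ) u
    rw [hu] at h2
    have h3 := (h2.comp z hYz).clm_apply h1
    refine h3.congr_fderiv ?_
    refine ContinuousLinearMap.ext fun v => ?_
    have h4 : Y z ((↑u⁻¹ : Jet n E →L[ℝ] Jet n E) (jetOf F' s' z)) = jetOf F' s' z := by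
      rw [← hu, ← mul_apply_eq_comp, Units.mul_inv]
      rfl
    have h5 : Ring.inverse (Y z) = (↑u⁻¹ : Jet n E →L[ℝ] Jet n E) := by
      rw [← hu, Ring.inverse_unit]
    simp [h4, h5]
  have hconst : ∀ z ∈ Metric.ball y ρ,
      Ring.inverse (Y z) (jetOf F' s' z) = Ring.inverse (Y y) (jetOf F' s' y) := fun z hz =>
    (convex_ball y ρ).is_const_of_fderivWithin_eq_zero (𝕜 := ℝ)
      (f := fun z => Ring.inverse (Y z) (jetOf F' s' z))
      (fun w hw => (hderiv w hw).differentiableAt.differentiableWithinAt)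
      (fun w hw => by
        rw [fderivWithin_of_isOpen Metric.isOpen_ball hw, (hderiv w hw).fderiv]) hz hyρ
  have hmul : ∀ z ∈ Metric.ball y ρ, ∀ w : Jet n E, Y z (Ring.inverse (Y z) w) = w := by
    intro z hz w
    rw [← mul_apply_eq_comp, Ring.mul_inverse_cancel _ (hY z (hρO hz).2).2]
    rfl
  refine ⟨Ring.inverse (Y y) (jetOf F' s' y), ?_, fun w hw => ?_⟩
  · filter_upwards [Metric.ball_mem_nhds y hρ] with z hz
    rw [← hconst z hz, hmul z hz]
    rfl
  -- Solutions that agree near y have the same jet at y, and Y y is invertible, so the label is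
  -- unique.
  · have h1 : jetOf F' s' y = Y y w := by
      rw [← (hsol w).2 y hy]
      have hF : F' =ᶠ[𝓝 y] fun z => (Y z w).1 := hw.mono fun z hz => congrArg Prod.fst hz
      have hs : s' =ᶠ[𝓝 y] fun z => (Y z w).2.2 := hw.mono fun z hz => congrArg Prod.snd hz
      exact Prod.ext hF.eq_of_nhds (Prod.ext (funext fun i => pd_congr hF i) hs.eq_of_nhds)
    rw [h1, ← mul_apply_eq_comp, Ring.inverse_mul_cancel _ (hY y hy).2]
    rfl

end LocalSolutions

/-! ### The ratio V²/det g on the manifold. -/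

section VolumeRatio

open Filter Topology Matrix

variable {n : ℕ} {O O' : Set (Eu n)} {g g' : Eu n → Matrix (Fin n) (Fin n) ℝ} {x : Eu n}
  {τ : Eu n → Eu n} {F ξ : Eu n → Amb n}

/-- The block diagonal matrix with blocks `A` and `1`. -/
def extendM (A : Matrix (Fin n) (Fin n) ℝ) : Matrix (Fin (n + 1)) (Fin (n + 1)) ℝ :=
  Matrix.of fun a c => (Fin.snoc (α := fun _ => Fin (n + 1) → ℝ)
    (fun i => Fin.snoc (α := fun _ => ℝ) (fun k => A i k) 0)
    (Fin.snoc (α := fun _ => ℝ) 0 1) : Fin (n + 1) → Fin (n + 1) → ℝ) a c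

theorem det_extendM (A : Matrix (Fin n) (Fin n) ℝ) : (extendM A).det = A.det := by
  rw [Matrix.det_succ_row _ (Fin.last n), Fin.sum_univ_castSucc]
  have h3 : (extendM A).submatrix (Fin.last n).succAbove (Fin.last n).succAbove = A := by
    ext i k
    simp [extendM, Fin.succAbove_last]
  rw [h3]
  simp only [extendM, Matrix.of_apply, Fin.snoc_last, Fin.snoc_castSucc, Pi.zero_apply, mul_zero,
    zero_mul, Finset.sum_const_zero, zero_add, mul_one]
  rw [Fin.val_last, ← two_mul, pow_mul]
  simp

theorem extendM_mul_snoc {V : Type*} [AddCommGroup V] [Module ℝ V] (A : Matrix (Fin n) (Fin n) ℝ)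
    (v : Fin n → V) (w : V) (φ : Fin (n + 1) → V →ₗ[ℝ] ℝ) :
    extendM A * Matrix.of (fun a b => φ b ((Fin.snoc (α := fun _ => V) v w : Fin (n + 1) → V) a))
      = Matrix.of fun a b => φ b
        ((Fin.snoc (α := fun _ => V) (fun i => ∑ j, A i j • v j) w : Fin (n + 1) → V) a) := by
  ext a b
  rw [Matrix.mul_apply, Fin.sum_univ_castSucc]
  refine Fin.lastCases ?_ (fun i => ?_) a
  · simp [extendM]
  · simp [extendM]

theorem IsTransition.det_frameMatrix (h : IsTransition O' O τ g' g) (hF : ContDiffOn ℝ ∞ F O)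
    (hx : x ∈ O') : (frameMatrix (fun y => F (τ y)) (fun y => ξ (τ y)) x).det
      = (jac τ x).det * (frameMatrix F ξ (τ x)).det := by
  have h1 := extendM_mul_snoc (jac τ x)ᵀ (fun i => pd i F (τ x)) (ξ (τ x))
    (fun b => (EuclideanSpace.proj (𝕜 := ℝ) b : Amb n →L[ℝ] ℝ).toLinearMap)
  have h2 : frameMatrix (fun y => F (τ y)) (fun y => ξ (τ y)) x
      = extendM (jac τ x)ᵀ * frameMatrix F ξ (τ x) := by
    refine Eq.trans ?_ h1.symm
    have h3 : ∀ i, pd i (fun y => F (τ y)) x = ∑ j, (jac τ x)ᵀ i j • pd j F (τ x) := fun i =>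
      pd_comp (h.differentiableAt hx)
        (differentiableAt_of_contDiffOn h.metric.isOpen hF (h.mapsTo x hx)) i
    simp only [frameMatrix, h3]
    rfl
  rw [h2, Matrix.det_mul, det_extendM, Matrix.det_transpose]

variable {M : Type*} [TopologicalSpace M] [ChartedSpace (Eu n) M]
  [IsManifold 𝓘(ℝ, Eu n) ∞ M] {e : OpenPartialHomeomorph M (Eu n)}

/-- Under a change of chart V is multiplied by the Jacobian determinant and det g by its square, so
V²/det g is a function on M; for a trace-free cubic its derivative vanishes. Only the Gauss formula
is assumed, since the result has to show that the frame is non-degenerate before a co-normal exists.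
-/
theorem exists_volume_ratio [PreconnectedSpace M] {g : PseudoMetric n M} {C : Tensor3 n M}
    {f ξ : M → Amb n}
    (hG : ∀ e : OpenPartialHomeomorph M (Eu n), IsChart e → IsGaussOn e.target (g.comp e)
      (C.comp e) (fun y => f (e.symm y)) (fun y => ξ (e.symm y)))
    (hu : ∀ e : OpenPartialHomeomorph M (Eu n), IsChart e → ∀ x ∈ e.target, ∀ i,
      cubicTrace (g.comp e x) (C.comp e x) i = 0) :
    ∃ ρ : ℝ, ∀ e : OpenPartialHomeomorph M (Eu n), IsChart e → ∀ x ∈ e.target,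
      (frameMatrix (fun y => f (e.symm y)) (fun y => ξ (e.symm y)) x).det
        * (frameMatrix (fun y => f (e.symm y)) (fun y => ξ (e.symm y)) x).det
        = ρ * (g.comp e x).det := by
  set V : OpenPartialHomeomorph M (Eu n) → Eu n → ℝ := fun e x =>
    (frameMatrix (fun y => f (e.symm y)) (fun y => ξ (e.symm y)) x).det with hV
  set R : OpenPartialHomeomorph M (Eu n) → Eu n → ℝ := fun e x =>
    V e x * V e x * ((g.comp e x).det)⁻¹ with hR
  have hinv : ∀ e e' : OpenPartialHomeomorph M (Eu n), IsChart e → IsChart e' →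
      ∀ p, p ∈ e.source → p ∈ e'.source → R e' (e' p) = R e (e p) := by
    intro e e' he he' p hp hp'
    have hy : e' p ∈ transDomain e' e :=
      ⟨e'.map_source hp', by rw [Set.mem_preimage, e'.left_inv hp']; exact hp⟩
    have hτ : transMap e' e (e' p) = e p := by rw [transMap, e'.left_inv hp']
    have ht := g.isTransition he he'
    have h1 := ht.det_frameMatrix (ξ := fun y => ξ (e.symm y)) (hG e he).smoothF hy
    have h2 : V e' (e' p) = (jac (transMap e' e) (e' p)).det * V e (e p) := by
      rw [← hτ]
      refine Eq.trans ?_ h1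
      have h3 : ∀ {W : Type} (k : M → W), (fun y => k (e'.symm y)) =ᶠ[𝓝 (e' p)]
          fun y => k (e.symm (transMap e' e y)) := by
        intro W k
        filter_upwards [(isOpen_transDomain e' e).mem_nhds hy] with z hz
        rw [symm_transMap hz]
      simp only [hV, frameMatrix]
      rw [(h3 ξ).eq_of_nhds]
      simp only [pd_congr (h3 f)]
    have h4 := congrArg Matrix.det (ht.eq _ hy)
    rw [Matrix.det_mul, Matrix.det_mul, Matrix.det_transpose, hτ] at h4
    have h5 := ht.det_jac_ne hy
    have h6 := (g.isMetricOn he).det_ne _ (e.map_source hp)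
    simp only [hR]
    rw [h2, h4]
    field_simp
  set ν : M → ℝ := fun p => R (chartAt (Eu n) p) (chartAt (Eu n) p p) with hν
  have hνe : ∀ e : OpenPartialHomeomorph M (Eu n), IsChart e → ∀ x ∈ e.target,
      ν (e.symm x) = R e x := by
    intro e he x hx
    have h1 := hinv (chartAt (Eu n) (e.symm x)) e (isChart_chartAt _) he (e.symm x)
      (mem_chart_source _ _) (e.map_target hx)
    rw [e.right_inv hx] at h1
    exact h1.symm
  have hloc : IsLocallyConstant ν := isLocallyConstant_of_pd_eq_zero fun e he x hx => by
    have hg := g.isMetricOn he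
    refine ⟨?_, fun i => ?_⟩
    · have hVd := differentiableAt_of_contDiffOn e.open_target (hG e he).smooth_frameMatrix.det hx
      have hGd := differentiableAt_of_contDiffOn e.open_target hg.smooth.det hx
      refine ((hVd.mul hVd).mul (hGd.inv (hg.det_ne x hx))).congr_of_eventuallyEq ?_
      filter_upwards [e.open_target.mem_nhds hx] with z hz using hνe e he z hz
    · rw [pd_congr_on e.open_target (hνe e he) hx]
      exact (hG e he).pd_volume_ratio hx i (hu e he x hx i)
  by_cases hM : Nonempty M
  · obtain ⟨p₀⟩ := hM
    refine ⟨ν p₀, fun e he x hx => ?_⟩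
    rw [hloc.apply_eq_of_preconnectedSpace p₀ (e.symm x), hνe e he x hx]
    have h6 := (g.isMetricOn he).det_ne x hx
    simp only [hR]
    field_simp
    rfl
  · exact ⟨0, fun e he x _ => (hM ⟨e.symm x⟩).elim⟩

end VolumeRatio

/-! ### Gluing local solutions. -/

section GlobalSolutions

open Filter Topology Matrix

/-- Local sections that form a locally constant sheaf on a simply connected space extend to global
sections. -/
theorem exists_global_section {B X W : Type*} [TopologicalSpace B] [SimplyConnectedSpace B]
    [LocallyPathConnectedSpace B] (U : B → Set B) (hU : ∀ p, IsOpen (U p)) (hp : ∀ p, p ∈ U p)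
    (sol : B → W → B → X)
    (h : ∀ p q, ∀ r ∈ U p ∩ U q, ∀ w, ∃! w', sol p w =ᶠ[𝓝 r] sol q w') (p₀ : B) (w₀ : W) :
    ∃ Φ : B → X, Φ =ᶠ[𝓝 p₀] sol p₀ w₀ ∧ ∀ r, ∃ w, Φ =ᶠ[𝓝 r] sol r w := by
  -- T p r converts labels of germs at r from the family centred at p to the family centred at r.
  -- These maps trivialise a flat bundle; outside U p their value does not matter.
  have hT : ∀ p r, ∃ T : W ≃ W, r ∈ U p → ∀ w, sol p w =ᶠ[𝓝 r] sol r (T w) := by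
    intro p r
    by_cases hr : r ∈ U p
    · choose T hT hTu using h p r r ⟨hr, hp r⟩
      have hbij : Function.Bijective T := by
        refine ⟨fun w₁ w₂ h12 => ?_, fun w' => ?_⟩
        · have h1 : sol r (T w₁) =ᶠ[𝓝 r] sol p w₂ := by
            rw [h12]
            exact (hT w₂).symm
          exact (h r p r ⟨hp r, hr⟩ (T w₁)).unique (hT w₁).symm h1
        · obtain ⟨w, hw, -⟩ := h r p r ⟨hp r, hr⟩ w'
          exact ⟨w, (hTu w w' hw.symm).symm⟩
      exact ⟨Equiv.ofBijective T hbij, fun _ => hT⟩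
    · exact ⟨Equiv.refl W, fun hr' => (hr hr').elim⟩
  choose T hT using hT
  have hcomp : ∀ i j, ∀ r ∈ U i ∩ U j, ∀ w w',
      sol i w =ᶠ[𝓝 r] sol j w' ↔ T i r w = T j r w' := by
    intro i j r hr w w'
    constructor
    · intro hw
      exact (h i r r ⟨hr.1, hp r⟩ w).unique (hT i r hr.1 w) (hw.trans (hT j r hr.2 w'))
    · intro hw
      refine (hT i r hr.1 w).trans ?_
      rw [hw]
      exact (hT j r hr.2 w').symm
  -- Equality of two germs at r₀ persists at nearby points, which is the local constancy of the
  -- transition maps.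
  obtain ⟨σ, hσ₀, hσ⟩ := exists_parallel_section U hU id hp T (fun i j r₀ hr₀ w => by
    have h1 : sol i w =ᶠ[𝓝 r₀] sol j ((T j r₀).symm (T i r₀ w)) := by
      rw [hcomp i j r₀ hr₀]
      simp
    filter_upwards [eventually_eventually_nhds.2 h1, (hU i).mem_nhds hr₀.1, (hU j).mem_nhds hr₀.2]
      with r hr hri hrj
    rw [Equiv.symm_apply_eq]
    exact (hcomp i j r ⟨hri, hrj⟩ _ _).1 hr) p₀ (T p₀ p₀ w₀)
  have hΦ : ∀ r₀, (fun r => sol r (σ r) r) =ᶠ[𝓝 r₀] sol r₀ ((T r₀ r₀).symm (σ r₀)) := by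
    intro r₀
    filter_upwards [hσ r₀ r₀ (hp r₀), (hU r₀).mem_nhds (hp r₀)] with r hr hrU
    rw [Equiv.symm_apply_eq] at hr
    rw [hr]
    exact (hT r₀ r hrU _).eq_of_nhds.symm
  refine ⟨fun r => sol r (σ r) r, ?_, fun r => ⟨_, hΦ r⟩⟩
  have h1 := hΦ p₀
  rwa [hσ₀, Equiv.symm_apply_apply] at h1

variable {n : ℕ} {O O' : Set (Eu n)} {g' g : Eu n → Matrix (Fin n) (Fin n) ℝ} {x : Eu n}
  {C' C : Eu n → Fin n → Fin n → Fin n → ℝ} {l : ℝ} {τ : Eu n → Eu n}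
  {E : Type*} [NormedAddCommGroup E] [NormedSpace ℝ E]

theorem IsTransition.mono {V V' : Set (Eu n)} (h : IsTransition O' O τ g' g) (hV : IsOpen V)
    (hVO : V ⊆ O) (hV' : IsOpen V') (hVO' : V' ⊆ O') (hm : ∀ y ∈ V', τ y ∈ V) :
    IsTransition V' V τ g' g where
  metric' := h.metric'.mono hV' hVO'
  metric := h.metric.mono hV hVO
  mapsTo := hm
  smooth := h.smooth.mono hVO'
  eq := fun y hy => h.eq y (hVO' hy)

theorem IsCubicOn.mono {V : Set (Eu n)} (h : IsCubicOn O C) (hV : V ⊆ O) : IsCubicOn V C where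
  smooth := fun i j k => (h.smooth i j k).mono hV
  symm₁₂ := fun x hx => h.symm₁₂ x (hV hx)
  symm₂₃ := fun x hx => h.symm₂₃ x (hV hx)

theorem IsPotentialOn.mono {F s : Eu n → E} {V : Set (Eu n)} (h : IsPotentialOn O g C l F s)
    (hV : V ⊆ O) : IsPotentialOn V g C l F s where
  smoothF := h.smoothF.mono hV
  smooths := h.smooths.mono hV
  hess := fun x hx => h.hess x (hV hx)
  grad := fun x hx => h.grad x (hV hx)

theorem IsPotentialOn.congr {F s F' s' : Eu n → E} (h : IsPotentialOn O g C l F s) (hO : IsOpen O)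
    (hF : ∀ y ∈ O, F' y = F y) (hs : ∀ y ∈ O, s' y = s y) : IsPotentialOn O g C l F' s' where
  smoothF := h.smoothF.congr hF
  smooths := h.smooths.congr hs
  hess := fun x hx i j => by
    have h1 := fun y hy i => pd_congr_on hO hF (x := y) hy i
    rw [pd_congr_on hO (fun y hy => h1 y hy j) hx, h.hess x hx, hs x hx]
    simp only [h1 x hx]
  grad := fun x hx i => by
    rw [pd_congr_on hO hs hx, pd_congr_on hO hF hx, h.grad x hx]

theorem IsPotentialOn.of_local {F s : Eu n → E}
    (h : ∀ x ∈ O, ∃ V, IsOpen V ∧ x ∈ V ∧ IsPotentialOn V g C l F s) :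
    IsPotentialOn O g C l F s where
  smoothF := fun x hx => by
    obtain ⟨V, hV, hxV, hp⟩ := h x hx
    exact (hp.smoothF.contDiffAt (hV.mem_nhds hxV)).contDiffWithinAt
  smooths := fun x hx => by
    obtain ⟨V, hV, hxV, hp⟩ := h x hx
    exact (hp.smooths.contDiffAt (hV.mem_nhds hxV)).contDiffWithinAt
  hess := fun x hx => by
    obtain ⟨V, hV, hxV, hp⟩ := h x hx
    exact hp.hess x hxV
  grad := fun x hx => by
    obtain ⟨V, hV, hxV, hp⟩ := h x hx
    exact hp.grad x hxV

variable {M : Type*} [TopologicalSpace M] [ChartedSpace (Eu n) M] [IsManifold 𝓘(ℝ, Eu n) ∞ M]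

/-- The pair `Φ = (F, s)` of functions solves `∇dF = g s`, `ds = -l dF` near the point `p`. -/
def IsPotentialNear (g : PseudoMetric n M) (C : Tensor3 n M) (l : ℝ) (Φ : M → E × E) (p : M) :
    Prop :=
  ∃ U : Set M, IsOpen U ∧ p ∈ U ∧ ∀ e : OpenPartialHomeomorph M (Eu n), IsChart e →
    IsPotentialOn (e.target ∩ e.symm ⁻¹' U) (g.comp e) (C.comp e) l
      (fun y => (Φ (e.symm y)).1) (fun y => (Φ (e.symm y)).2)

theorem IsPotentialNear.congr {g : PseudoMetric n M} {C : Tensor3 n M} {Φ Ψ : M → E × E} {p : M}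
    (h : IsPotentialNear g C l Φ p) (hΨ : Ψ =ᶠ[𝓝 p] Φ) : IsPotentialNear g C l Ψ p := by
  obtain ⟨U, hU, hpU, hp⟩ := h
  obtain ⟨V, hV, hVo, hpV⟩ := mem_nhds_iff.1 hΨ
  refine ⟨U ∩ V, hU.inter hVo, ⟨hpU, hpV⟩, fun e he => ?_⟩
  have hsub : e.target ∩ e.symm ⁻¹' (U ∩ V) ⊆ e.target ∩ e.symm ⁻¹' U :=
    fun y hy => ⟨hy.1, hy.2.1⟩
  exact ((hp e he).mono hsub).congr (e.isOpen_inter_preimage_symm (hU.inter hVo))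
    (fun y hy => congrArg Prod.fst (hV hy.2.2)) (fun y hy => congrArg Prod.snd (hV hy.2.2))

theorem isPotentialOn_of_near {g : PseudoMetric n M} {C : Tensor3 n M} {Φ : M → E × E}
    (h : ∀ p, IsPotentialNear g C l Φ p) {e : OpenPartialHomeomorph M (Eu n)} (he : IsChart e) :
    IsPotentialOn e.target (g.comp e) (C.comp e) l
      (fun y => (Φ (e.symm y)).1) (fun y => (Φ (e.symm y)).2) :=
  IsPotentialOn.of_local fun x hx => by
    obtain ⟨U, hU, hpU, hp⟩ := h (e.symm x)
    exact ⟨_, e.isOpen_inter_preimage_symm hU, ⟨hx, hpU⟩, hp e he⟩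

/-- A solution in one chart is a solution in all charts. -/
theorem isPotentialNear_of_chart {g : PseudoMetric n M} {C : Tensor3 n M}
    (hC : ∀ e : OpenPartialHomeomorph M (Eu n), IsChart e → IsCubicOn e.target (C.comp e))
    {e : OpenPartialHomeomorph M (Eu n)} (he : IsChart e) {V : Set (Eu n)} (hV : IsOpen V)
    (hVe : V ⊆ e.target) {F s : Eu n → E} (hp : IsPotentialOn V (g.comp e) (C.comp e) l F s)
    {p : M} (hpe : p ∈ e.source) (hpV : e p ∈ V) :
    IsPotentialNear g C l (fun q => (F (e q), s (e q))) p := by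
  refine ⟨e.source ∩ e ⁻¹' V, e.isOpen_inter_preimage hV, ⟨hpe, hpV⟩, fun e' he' => ?_⟩
  have hsub : e'.target ∩ e'.symm ⁻¹' (e.source ∩ e ⁻¹' V) ⊆ transDomain e' e :=
    fun y hy => ⟨hy.1, hy.2.1⟩
  have ht := (g.isTransition he he').mono hV hVe
    (e'.isOpen_inter_preimage_symm (e.isOpen_inter_preimage hV)) hsub fun y hy => hy.2.2
  exact hp.transform ht (fun y hy => C.isCubicTransform he he' y (hsub hy))
    ((hC e' he').mono Set.inter_subset_left) ((hC e he).mono hVe)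

variable [FiniteDimensional ℝ E]

/-- A local solution in one chart is a solution in all charts, so on overlaps the families centred
at different points label the same germs and can be glued. The jet prescribed at p₀ selects the
global solution. -/
theorem exists_potential [SimplyConnectedSpace M] {g : PseudoMetric n M} {C : Tensor3 n M}
    (hC : ∀ e : OpenPartialHomeomorph M (Eu n), IsChart e → IsCubicOn e.target (C.comp e))
    (hK : ∀ e : OpenPartialHomeomorph M (Eu n), IsChart e → ∀ x ∈ e.target, ∀ i j a b,
      curvM (hypCon (g.comp e) (C.comp e)) i j x a b
        = l * (g.comp e x j b * (if a = i then 1 else 0)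
          - g.comp e x i b * (if a = j then 1 else 0)))
    (p₀ : M) (w₀ : Jet n E) :
    ∃ Φ : M → E × E, (∀ e : OpenPartialHomeomorph M (Eu n), IsChart e →
        IsPotentialOn e.target (g.comp e) (C.comp e) l
          (fun y => (Φ (e.symm y)).1) (fun y => (Φ (e.symm y)).2)) ∧
      jetOf (fun y => (Φ ((chartAt (Eu n) p₀).symm y)).1)
        (fun y => (Φ ((chartAt (Eu n) p₀).symm y)).2) (chartAt (Eu n) p₀ p₀) = w₀ := by
  have : LocallyPathConnectedSpace M := ChartedSpace.locallyPathConnectedSpace (Eu n) M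
  have hΓ : ∀ e : OpenPartialHomeomorph M (Eu n), IsChart e → ∀ i,
      SmoothM e.target (hypCon (g.comp e) (C.comp e) i) := fun e he i =>
    (((g.isMetricOn he).smooth_LC i).add ((hC e he).smooth_raiseM (g.isMetricOn he) i)).congr
      fun y hy => hypCon_eq (hC e he) hy i
  have hloc := fun p : M => exists_local_potentials (E := E) (g.isMetricOn (isChart_chartAt p))
    (hC _ (isChart_chartAt p)) (hΓ _ (isChart_chartAt p)) (hK _ (isChart_chartAt p))
    ((chartAt (Eu n) p).map_source (mem_chart_source _ p))
  choose r hr hball F s hsol hjet huniq using hloc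
  set U : M → Set M := fun p => (chartAt (Eu n) p).source ∩ chartAt (Eu n) p ⁻¹'
    Metric.ball (chartAt (Eu n) p p) (r p) with hU
  set sol : M → Jet n E → M → E × E := fun p w q =>
    (F p w (chartAt (Eu n) p q), s p w (chartAt (Eu n) p q)) with hsolM
  have hUo : ∀ p, IsOpen (U p) := fun p =>
    (chartAt (Eu n) p).isOpen_inter_preimage Metric.isOpen_ball
  have hUp : ∀ p, p ∈ U p := fun p => ⟨mem_chart_source _ p, Metric.mem_ball_self (hr p)⟩
  have hnear : ∀ p w, ∀ q ∈ U p, IsPotentialNear g C l (sol p w) q := fun p w q hq =>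
    isPotentialNear_of_chart hC (isChart_chartAt p) Metric.isOpen_ball (hball p) (hsol p w)
      hq.1 hq.2
  have hex : ∀ p q, ∀ r ∈ U p ∩ U q, ∀ w, ∃! w', sol p w =ᶠ[𝓝 r] sol q w' := by
    intro p q r hr w
    obtain ⟨V, hV, hrV, hp⟩ := hnear p w r hr.1
    set e := chartAt (Eu n) q with he
    have hre : r ∈ e.source := hr.2.1
    have h1 := huniq q (e r) hr.2.2 _ _ _ ((e.isOpen_inter_preimage_symm hV).mem_nhds
      ⟨e.map_source hre, by rw [Set.mem_preimage, e.left_inv hre]; exact hrV⟩)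
      (hp e (isChart_chartAt q))
    refine (existsUnique_congr fun w' => ?_).1 h1
    rw [EventuallyEq, ← e.eventually_nhds' _ hre]
    refine eventually_congr ?_
    filter_upwards [e.open_target.mem_nhds (e.map_source hre)] with z hz
    simp only [hsolM]
    rw [← he, e.right_inv hz]
  obtain ⟨Φ, hΦ₀, hΦ⟩ := exists_global_section U hUo hUp sol hex p₀ w₀
  refine ⟨Φ, fun e he => isPotentialOn_of_near (fun p => ?_) he, ?_⟩
  · obtain ⟨w, hw⟩ := hΦ p
    exact (hnear p w p (hUp p)).congr hw
  · set e := chartAt (Eu n) p₀ with he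
    have hp₀ : p₀ ∈ e.source := mem_chart_source _ p₀
    rw [← hjet p₀ w₀]
    have h1 : ∀ᶠ z in 𝓝 (e p₀), Φ (e.symm z) = (F p₀ w₀ z, s p₀ w₀ z) := by
      have h2 := (e.eventually_nhds' _ hp₀).2 hΦ₀
      filter_upwards [h2, e.open_target.mem_nhds (e.map_source hp₀)] with z hz hzt
      rw [hz]
      simp only [hsolM]
      rw [← he, e.right_inv hzt]
    have hF : (fun y => (Φ (e.symm y)).1) =ᶠ[𝓝 (e p₀)] F p₀ w₀ :=
      h1.mono fun z hz => congrArg Prod.fst hz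
    have hs : (fun y => (Φ (e.symm y)).2) =ᶠ[𝓝 (e p₀)] s p₀ w₀ :=
      h1.mono fun z hz => congrArg Prod.snd hz
    exact Prod.ext hF.eq_of_nhds (Prod.ext (funext fun i => pd_congr hF i) hs.eq_of_nhds)

end GlobalSolutions

/-! ### Existence of a corresponding co-normalisation. -/

section Existence

open Filter Topology Matrix

variable {n : ℕ} {x : Eu n} {F ξ : Eu n → Amb n}

/-- The last element of the basis dual to the rows of a matrix. -/
def conormalOf (A : Matrix (Fin (n + 1)) (Fin (n + 1)) ℝ) : Amb n →L[ℝ] ℝ :=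
  ∑ b, A⁻¹ b (Fin.last n) • (EuclideanSpace.proj (𝕜 := ℝ) b : Amb n →L[ℝ] ℝ)

theorem conormalOf_apply (A : Matrix (Fin (n + 1)) (Fin (n + 1)) ℝ) (v : Amb n) :
    conormalOf A v = ∑ b, v b * A⁻¹ b (Fin.last n) := by
  simp [conormalOf, ContinuousLinearMap.sum_apply, mul_comm]

theorem conormalOf_frameMatrix (h : (frameMatrix F ξ x).det ≠ 0) :
    (∀ i, conormalOf (frameMatrix F ξ x) (pd i F x) = 0) ∧
      conormalOf (frameMatrix F ξ x) (ξ x) = 1 := by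
  have h1 : ∀ a, ∑ b, frameMatrix F ξ x a b * (frameMatrix F ξ x)⁻¹ b (Fin.last n)
      = (1 : Matrix (Fin (n + 1)) (Fin (n + 1)) ℝ) a (Fin.last n) := by
    intro a
    rw [← Matrix.mul_apply, Matrix.mul_nonsing_inv _ h.isUnit]
  refine ⟨fun i => ?_, ?_⟩
  · rw [conormalOf_apply]
    have h2 := h1 i.castSucc
    rw [Matrix.one_apply_ne (Fin.castSucc_lt_last i).ne] at h2
    simpa [frameMatrix] using h2
  · rw [conormalOf_apply]
    have h2 := h1 (Fin.last n)
    rw [Matrix.one_apply_eq] at h2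
    simpa [frameMatrix] using h2

/-- Provides smoothness: the co-normal is chosen pointwise, and by uniqueness it agrees in every
chart with the last column of the inverse frame matrix. -/
theorem eq_conormalOf {α : Amb n →L[ℝ] ℝ} (h : (frameMatrix F ξ x).det ≠ 0)
    (h1 : ∀ i, α (pd i F x) = 0) (h2 : α (ξ x) = 1) : α = conormalOf (frameMatrix F ξ x) := by
  have hsum : ∀ v : Amb n, α v = ∑ b, v b * α (EuclideanSpace.single b 1) := by
    intro v
    have h1 : v = ∑ b, v b • EuclideanSpace.single b (1 : ℝ) := by
      ext j
      simp [Pi.single_apply]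
    conv_lhs => rw [h1]
    simp
  have h3 : frameMatrix F ξ x *ᵥ (fun b => α (EuclideanSpace.single b 1))
      = fun a => (1 : Matrix (Fin (n + 1)) (Fin (n + 1)) ℝ) a (Fin.last n) := by
    ext a
    refine Fin.lastCases ?_ (fun i => ?_) a
    · rw [Matrix.one_apply_eq]
      refine Eq.trans ?_ ((hsum _).symm.trans h2)
      simp [Matrix.mulVec, dotProduct, frameMatrix]
    · rw [Matrix.one_apply_ne (Fin.castSucc_lt_last i).ne]
      refine Eq.trans ?_ ((hsum _).symm.trans (h1 i))
      simp [Matrix.mulVec, dotProduct, frameMatrix]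
  have h4 := congrArg (fun v => (frameMatrix F ξ x)⁻¹ *ᵥ v) h3
  simp only [Matrix.mulVec_mulVec, Matrix.nonsing_inv_mul _ h.isUnit, Matrix.one_mulVec] at h4
  refine ContinuousLinearMap.ext fun v => ?_
  rw [hsum, conormalOf_apply]
  refine Finset.sum_congr rfl fun b _ => ?_
  congr 1
  rw [congrFun h4 b]
  simp [Matrix.mulVec, dotProduct, Matrix.one_apply]

theorem eq_zero_of_sum_pd (h : (frameMatrix F ξ x).det ≠ 0) {a : Fin n → ℝ}
    (ha : ∑ i, a i • pd i F x = 0) : a = 0 := by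
  have h1 : (Fin.snoc (α := fun _ => ℝ) a 0 : Fin (n + 1) → ℝ) ᵥ* frameMatrix F ξ x = 0 := by
    ext b
    have h2 := congrArg (fun v : Amb n => v b) ha
    rw [Matrix.vecMul, dotProduct, Fin.sum_univ_castSucc]
    simpa [frameMatrix] using h2
  have h3 := Matrix.eq_zero_of_vecMul_eq_zero h h1
  ext i
  have h4 := congrFun h3 i.castSucc
  simpa using h4

theorem frameMatrix_eq_one (h1 : ∀ i, pd i F x = EuclideanSpace.single i.castSucc 1)
    (h2 : ξ x = EuclideanSpace.single (Fin.last n) 1) : frameMatrix F ξ x = 1 := by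
  ext a b
  refine Fin.lastCases ?_ (fun i => ?_) a
  · by_cases hb : Fin.last n = b
    · subst hb
      simp [frameMatrix, h2]
    · simp [frameMatrix, h2, Matrix.one_apply_ne hb, Pi.single_apply, Ne.symm hb]
  · by_cases hb : i.castSucc = b
    · subst hb
      simp [frameMatrix, h1]
    · simp [frameMatrix, h1, Matrix.one_apply_ne hb, Pi.single_apply, Ne.symm hb]

variable {M : Type*} [TopologicalSpace M] [ChartedSpace (Eu n) M]
  [IsManifold 𝓘(ℝ, Eu n) ∞ M]

theorem contMDiff_of_charts {W : Type*} [NormedAddCommGroup W] [NormedSpace ℝ W] {f : M → W}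
    (hf : ∀ e : OpenPartialHomeomorph M (Eu n), IsChart e →
      ContDiffOn ℝ ∞ (fun y => f (e.symm y)) e.target) : ContMDiff 𝓘(ℝ, Eu n) 𝓘(ℝ, W) ∞ f := by
  intro p
  have hp := mem_chart_source (Eu n) p
  exact (isChart_chartAt p).contMDiffAt_of_comp_symm hp ((hf _ (isChart_chartAt p)).contDiffAt
    ((chartAt (Eu n) p).open_target.mem_nhds ((chartAt (Eu n) p).map_source hp)))

theorem exists_chart_eq (p : M) : ∃ e : OpenPartialHomeomorph M (Eu n), IsChart e ∧
    ∃ x ∈ e.target, e.symm x = p :=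
  ⟨chartAt (Eu n) p, isChart_chartAt p, chartAt (Eu n) p p,
    (chartAt (Eu n) p).map_source (mem_chart_source _ p),
    (chartAt (Eu n) p).left_inv (mem_chart_source _ p)⟩

/-- A map `f` and a field `ξ` along it that satisfy the Gauss formula and span the ambient space
are a relative normalisation. -/
theorem exists_relativeConormalisation {g : PseudoMetric n M} {C : Tensor3 n M}
    {f ξ : M → Amb n} {l : ℝ}
    (hp : ∀ e : OpenPartialHomeomorph M (Eu n), IsChart e →
        IsPotentialOn e.target (g.comp e) (C.comp e) l
          (fun y => f (e.symm y)) (fun y => ξ (e.symm y)))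
    (hdet : ∀ e : OpenPartialHomeomorph M (Eu n), IsChart e → ∀ x ∈ e.target,
      (frameMatrix (fun y => f (e.symm y)) (fun y => ξ (e.symm y)) x).det ≠ 0) :
    ∃ N : RelativeConormalisation n M, N.HasMetricAndCubic g C := by
  have hf : ContMDiff 𝓘(ℝ, Eu n) 𝓘(ℝ, Amb n) ∞ f :=
    contMDiff_of_charts fun e he => (hp e he).smoothF
  have hξ : ContMDiff 𝓘(ℝ, Eu n) 𝓘(ℝ, Amb n) ∞ ξ :=
    contMDiff_of_charts fun e he => (hp e he).smooths
  have hfd := fun p => hf.mdifferentiable (by simp) p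
  have hξd := fun p => hξ.mdifferentiable (by simp) p
  have hex : ∀ p, ∃ α : Amb n →L[ℝ] ℝ,
      (∀ X, α (mfderiv 𝓘(ℝ, Eu n) 𝓘(ℝ, Amb n) f p X) = 0) ∧ α (ξ p) = 1 := by
    intro p
    obtain ⟨e, he, x, hx, rfl⟩ := exists_chart_eq (n := n) p
    have h1 := conormalOf_frameMatrix (hdet e he x hx)
    refine ⟨_, fun X => ?_, h1.2⟩
    obtain ⟨a, rfl⟩ := he.exists_coordVec hx X
    rw [map_sum]
    simp only [map_smul, he.mfderiv_coordVec hx (hfd _)]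
    refine (map_sum _ _ _).trans (Finset.sum_eq_zero fun i _ => ?_)
    refine (map_smul _ _ _).trans ?_
    rw [h1.1, smul_zero]
  choose Ξ hΞ using hex
  have hΞe : ∀ e : OpenPartialHomeomorph M (Eu n), IsChart e → ∀ x ∈ e.target, Ξ (e.symm x)
      = conormalOf (frameMatrix (fun y => f (e.symm y)) (fun y => ξ (e.symm y)) x) :=
    fun e he x hx => eq_conormalOf (hdet e he x hx) (fun i => by
      rw [← he.mfderiv_coordVec hx (hfd _)]
      exact (hΞ _).1 _) (hΞ _).2
  have hframe : ∀ e : OpenPartialHomeomorph M (Eu n), IsChart e →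
      SmoothM e.target (frameMatrix (fun y => f (e.symm y)) (fun y => ξ (e.symm y))) := by
    intro e he a b
    have hpr : ∀ {G : Eu n → Amb n}, ContDiffOn ℝ ∞ G e.target →
        ContDiffOn ℝ ∞ (fun y => G y b) e.target :=
      fun hG => (EuclideanSpace.proj (𝕜 := ℝ) b).contDiff.comp_contDiffOn hG
    refine Fin.lastCases ?_ (fun i => ?_) a
    · simpa [frameMatrix] using hpr (hp e he).smooths
    · simpa [frameMatrix] using hpr (contDiffOn_pd e.open_target (hp e he).smoothF i)
  refine ⟨{ f := f, Ξ := Ξ, ξ := ξ, smooth_f := hf, smooth_ξ := hξ, smooth_Ξ := ?_,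
            immersion := ?_, conormal := fun p => (hΞ p).1, dual := fun p => (hΞ p).2,
            relative := ?_ }, fun e he x hx i j => ?_⟩
  · refine contMDiff_of_charts fun e he => ?_
    refine ContDiffOn.congr ?_ (hΞe e he)
    exact ContDiffOn.sum fun b _ => ((hframe e he).inv (hdet e he) b (Fin.last n)).smul
      contDiffOn_const
  · intro p
    obtain ⟨e, he, x, hx, rfl⟩ := exists_chart_eq (n := n) p
    rw [injective_iff_map_eq_zero]
    intro X hX
    obtain ⟨a, rfl⟩ := he.exists_coordVec hx X
    rw [map_sum] at hX
    simp only [map_smul, he.mfderiv_coordVec hx (hfd _)] at hX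
    have ha := eq_zero_of_sum_pd (hdet e he x hx) hX
    simp [ha]
  · intro p X
    obtain ⟨e, he, x, hx, rfl⟩ := exists_chart_eq (n := n) p
    obtain ⟨a, rfl⟩ := he.exists_coordVec hx X
    refine ⟨-l • ∑ i, a i • coordVec e x i, ?_⟩
    rw [map_smul, map_sum, map_sum, Finset.smul_sum]
    refine Finset.sum_congr rfl fun i _ => ?_
    rw [map_smul, map_smul, he.mfderiv_coordVec hx (hfd _), he.mfderiv_coordVec hx (hξd _),
      (hp e he).grad x hx]
    exact smul_comm (a i) (-l) (pd i (fun y => f (e.symm y)) x)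
  · rw [(hp e he).hess x hx]
    rfl

variable {g : PseudoMetric n M} {S : Tensor3 n M} {t : M → ℝ}

theorem IsAbundantManifold.cubicTrace_eq_zero (h : IsAbundantManifold g S t) {C : Tensor3 n M}
    (ht : ∀ p X, dFun (n := n) t p X = 0) (hC : IsCubicOfStructure g S t C)
    {e : OpenPartialHomeomorph M (Eu n)} (he : IsChart e) (hx : x ∈ e.target) (i : Fin n) :
    cubicTrace (g.comp e x) (C.comp e x) i = 0 := by
  have hcub := (h.isCubicOn he).smul (1 / 3)
  have h1 : ∑ a, raise3 (g.comp e x) (C.comp e x) a i a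
      = (raiseM (g.comp e) (fun y i j k => 1 / 3 * S.comp e y i j k) i x).trace := by
    rw [hC.comp_eq ht e]
    exact Finset.sum_congr rfl fun a _ => hcub.raise3_eq hx a i a
  rw [cubicTrace, h1, raiseM_smul, Matrix.trace_smul, (h.isCubicOn he).trace_raiseM
    (g.isMetricOn he) hx, h.traceFree e he x hx]
  simp

theorem IsAbundantManifold.curvM_hypCon (h : IsAbundantManifold g S t) (hn : 3 ≤ n)
    (ht : ∀ p X, dFun (n := n) t p X = 0) (hP : g.SchoutenTraceFreeVanishes)
    {C : Tensor3 n M} (hC : IsCubicOfStructure g S t C)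
    {e : OpenPartialHomeomorph M (Eu n)} (he : IsChart e) (hx : x ∈ e.target) (i j a b : Fin n) :
    curvM (hypCon (g.comp e) (C.comp e)) i j x a b
      = sphereConst n (normSq3 (g.comp e x) (S.comp e x))
        * (g.comp e x j b * (if a = i then 1 else 0) - g.comp e x i b * (if a = j then 1 else 0)) := by
  rw [hC.comp_eq ht e, curvM_congr_on e.open_target
    (fun k y hy => hypCon_eq ((h.isCubicOn he).smul (1 / 3)) hy k) hx,
    (h.isSphericalOn hn ht hP he).curvM_eq hn hx]

/-- The initial jet at p₀ is the standard basis of ℝ^{n+1}, so that V = 1 there. The constant ρ in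
V² = ρ det g is then non-zero, the frame is non-degenerate everywhere, and the solution (F, s) is an
immersion with a transversal field. -/
theorem IsAbundantManifold.exists_correspondsTo [SimplyConnectedSpace M]
    (h : IsAbundantManifold g S t) (hn : 3 ≤ n)
    (ht : ∀ p X, dFun (n := n) t p X = 0) (hP : g.SchoutenTraceFreeVanishes) :
    ∃ (N : RelativeConormalisation n M) (C : Tensor3 n M), N.CorrespondsTo g S t C := by
  let C : Tensor3 n M :=
    { toFun := fun p => (1 / 3 : ℝ) • S.toFun p
      smooth := fun e he i j k => contDiffOn_const.mul (S.smooth e he i j k) }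
  have hC : IsCubicOfStructure g S t C := fun p X Y Z => by
    simp [C, ht]
  have hcub : ∀ e : OpenPartialHomeomorph M (Eu n), IsChart e → IsCubicOn e.target (C.comp e) := by
    intro e he
    rw [hC.comp_eq ht e]
    exact (h.isCubicOn he).smul (1 / 3)
  obtain ⟨N, hN⟩ := h.exists_normSq3_eq hn ht hP
  have p₀ : M := Classical.choice inferInstance
  obtain ⟨Φ, hΦ, hjet⟩ := exists_potential (E := Amb n) (l := sphereConst n N) hcub
    (fun e he x hx i j a b => by
      rw [h.curvM_hypCon hn ht hP hC he hx, hN e he x hx]) p₀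
    (0, fun i => EuclideanSpace.single i.castSucc 1, EuclideanSpace.single (Fin.last n) 1)
  have hG : ∀ e : OpenPartialHomeomorph M (Eu n), IsChart e → IsGaussOn e.target (g.comp e)
      (C.comp e) (fun y => (Φ (e.symm y)).1) (fun y => (Φ (e.symm y)).2) := fun e he =>
    { metric := g.isMetricOn he
      smoothC := (hcub e he).smooth
      smoothF := (hΦ e he).smoothF
      smoothξ := (hΦ e he).smooths
      relative := fun x hx i => ⟨fun k => if k = i then -sphereConst n N else 0, by
        rw [(hΦ e he).grad x hx]
        simp⟩
      gauss := (hΦ e he).hess }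
  obtain ⟨ρ, hρ⟩ := exists_volume_ratio (f := fun p => (Φ p).1)
    (ξ := fun p => (Φ p).2) hG fun e he x hx i => h.cubicTrace_eq_zero ht hC he hx i
  have hρ0 : ρ ≠ 0 := by
    rintro rfl
    have hp₀ := (chartAt (Eu n) p₀).map_source (mem_chart_source _ p₀)
    have h1 := hρ _ (isChart_chartAt p₀) _ hp₀
    have h2 : frameMatrix (fun y => (Φ ((chartAt (Eu n) p₀).symm y)).1)
        (fun y => (Φ ((chartAt (Eu n) p₀).symm y)).2) (chartAt (Eu n) p₀ p₀) = 1 := by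
      simp only [jetOf, Prod.mk.injEq] at hjet
      exact frameMatrix_eq_one (congrFun hjet.2.1) hjet.2.2
    rw [h2] at h1
    simp at h1
  obtain ⟨N, hN⟩ := exists_relativeConormalisation (f := fun p => (Φ p).1)
    (ξ := fun p => (Φ p).2) hΦ fun e he x hx h0 => by
    have h1 := hρ e he x hx
    rw [h0, zero_mul] at h1
    exact mul_ne_zero hρ0 ((g.isMetricOn he).det_ne x hx) h1.symm
  exact ⟨N, C, hN, hC⟩

end Existence

/-! ### Totally symmetric trace-free projections. -/

section SymmetricProjections

open Matrix

variable {n : ℕ} {O : Set (Eu n)} {g : Eu n → Matrix (Fin n) (Fin n) ℝ} {x : Eu n}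
  {S : Eu n → Fin n → Fin n → Fin n → ℝ}

/-- With the sum over permutations written out, symmetrisation identities can be settled by `ring`.
-/
theorem sym4_eq (Φ : Fin n → Fin n → Fin n → Fin n → ℝ) (i j k l : Fin n) :
    sym4 Φ i j k l = (1 / 24) * (
      Φ i j k l + Φ i j l k + Φ i k j l + Φ i k l j + Φ i l j k + Φ i l k j
      + Φ j i k l + Φ j i l k + Φ j k i l + Φ j k l i + Φ j l i k + Φ j l k i
      + Φ k i j l + Φ k i l j + Φ k j i l + Φ k j l i + Φ k l i j + Φ k l j i
      + Φ l i j k + Φ l i k j + Φ l j i k + Φ l j k i + Φ l k i j + Φ l k j i) := by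
  rw [sym4]
  congr 1
  simp only [Finset.univ_perm_fin_succ (n := 3), Finset.univ_perm_fin_succ (n := 2),
    Finset.univ_perm_fin_succ (n := 1), Finset.sum_map, ← Finset.univ_product_univ,
    Finset.sum_product, Fin.sum_univ_four, Fin.sum_univ_three, Fin.sum_univ_two,
    Equiv.coe_toEmbedding, Finset.univ_unique, Finset.sum_singleton]
  refine Eq.trans (b := ((Φ i j k l + Φ i j l k) + (Φ i k j l + Φ i k l j) + (Φ i l k j + Φ i l j k))
        + ((Φ j i k l + Φ j i l k) + (Φ j k i l + Φ j k l i) + (Φ j l k i + Φ j l i k))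
        + ((Φ k j i l + Φ k j l i) + (Φ k i j l + Φ k i l j) + (Φ k l i j + Φ k l j i))
        + ((Φ l j k i + Φ l j i k) + (Φ l k j i + Φ l k i j) + (Φ l i k j + Φ l i j k))) rfl ?_
  ring

/-- The trace correction is built from `symTr4`, which only involves the symmetrisation. -/
theorem sym4TraceFree_congr {h : Matrix (Fin n) (Fin n) ℝ} {Φ Ψ : Fin n → Fin n → Fin n → Fin n → ℝ}
    (hs : ∀ i j k l, sym4 Φ i j k l = sym4 Ψ i j k l) (i j k l : Fin n) :
    sym4TraceFree h Φ i j k l = sym4TraceFree h Ψ i j k l := by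
  have h1 : symTr4 h Φ = symTr4 h Ψ := by
    funext a b
    simp only [symTr4, hs]
  have h2 : ∀ Φ, sym4TraceFree h Φ i j k l = sym4 Φ i j k l - sym4 (fun a b c d =>
      (6 / ((n : ℝ) + 4)) * (symTr4 h Φ a b - tr2 h (symTr4 h Φ) * h a b / (2 * ((n : ℝ) + 2)))
        * h c d) i j k l := by
    intro Φ
    rw [sym4TraceFree]
    simp only [sym4_eq (fun a b c d => Φ a b c d - _), sym4_eq Φ, sym4_eq (fun a b c d => _ * h c d)]
    ring
  rw [h2, h2, hs, h1]

theorem sym4TraceFree_smul (h : Matrix (Fin n) (Fin n) ℝ) (c : ℝ)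
    (Φ : Fin n → Fin n → Fin n → Fin n → ℝ) (i j k l : Fin n) :
    sym4TraceFree h (fun a b d e => c * Φ a b d e) i j k l = c * sym4TraceFree h Φ i j k l := by
  have h1 : symTr4 h (fun a b d e => c * Φ a b d e) = fun a b => c * symTr4 h Φ a b := by
    funext a b
    rw [symTr4, symTr4, ← tr2_smul]
    refine tr2_congr fun p q => ?_
    simp only [sym4_eq]
    ring
  rw [sym4TraceFree, sym4TraceFree, h1, tr2_smul, sym4_eq, sym4_eq]
  ring

theorem IsMetricOn.contract_left (hg : IsMetricOn O g) (hx : x ∈ O) (v : Fin n → ℝ) (i : Fin n) :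
    tr2 (g x) (fun p q => g x p i * v q) = v i := by
  have h1 : ∀ q, ∑ p, (g x)⁻¹ p q * (g x p i * v q) = if q = i then v q else 0 := by
    intro q
    simp only [← mul_assoc, ← Finset.sum_mul, hg.inv_symm_apply hx _ q, hg.sum_inv_mul hx]
    split_ifs <;> simp
  rw [tr2, Finset.sum_comm]
  simp only [h1]
  simp

theorem IsMetricOn.contract_right (hg : IsMetricOn O g) (hx : x ∈ O) (v : Fin n → ℝ) (i : Fin n) :
    tr2 (g x) (fun p q => g x q i * v p) = v i := by
  rw [← hg.contract_left hx v i, tr2, tr2, Finset.sum_comm]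
  refine Finset.sum_congr rfl fun p _ => Finset.sum_congr rfl fun q _ => ?_
  rw [hg.inv_symm_apply hx]

/-- The totally symmetric trace-free part of a tensor is not affected by multiples of the
metric. -/
theorem IsMetricOn.sym4TraceFree_add_mul (hg : IsMetricOn O g) (hx : x ∈ O)
    (Φ : Fin n → Fin n → Fin n → Fin n → ℝ) (B : Fin n → Fin n → ℝ) (i j k l : Fin n) :
    sym4TraceFree (g x) (fun a b c d => Φ a b c d + g x a b * B c d) i j k l
      = sym4TraceFree (g x) Φ i j k l := by
  have hs := hg.symm_apply hx
  set β : Fin n → Fin n → ℝ := fun i j => (B i j + B j i) / 2 with hβ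
  set s := tr2 (g x) β with hsd
  have hβs : ∀ i j, β i j = β j i := fun i j => by simp only [hβ]; ring
  have h1 : ∀ p q i j, sym4 (fun a b c d => Φ a b c d + g x a b * B c d) p q i j
      = sym4 Φ p q i j + (1 / 6) * (g x p q * β i j + g x p i * β q j + g x p j * β q i
        + g x q i * β p j + g x q j * β p i + β p q * g x i j) := by
    intro p q i j
    simp only [sym4_eq, hβ]
    rw [hs q p, hs i p, hs j p, hs i q, hs j q, hs j i]
    ring
  -- The symmetrised trace of g ⊗ B is ((n+4) β + tr(β) g)/6. The constants 6/(n+4) and 1/(2(n+2))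
  -- of the projection invert this map, so exactly g ⊗ β is subtracted.
  have h2 : symTr4 (g x) (fun a b c d => Φ a b c d + g x a b * B c d) = fun i j =>
      symTr4 (g x) Φ i j + (1 / 6) * (((n : ℝ) + 4) * β i j + s * g x i j) := by
    funext i j
    have h3 : ∀ (A : Fin n → Fin n → ℝ) (c : ℝ), tr2 (g x) (fun p q => A p q * c)
        = tr2 (g x) A * c := by
      intro A c
      rw [mul_comm, ← tr2_smul]
      exact tr2_congr fun _ _ => mul_comm _ _
    simp only [symTr4, h1, tr2_add, tr2_smul]
    rw [hg.contract_left hx (fun q => β q j), hg.contract_left hx (fun q => β q i),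
      hg.contract_right hx (fun q => β q j), hg.contract_right hx (fun q => β q i), h3 (fun p q => g x p q), h3 β,
      hg.tr2_self hx, ← hsd, hβs j i]
    ring
  have h4 : tr2 (g x) (fun i j => symTr4 (g x) Φ i j + (1 / 6) * (((n : ℝ) + 4) * β i j
      + s * g x i j)) = tr2 (g x) (symTr4 (g x) Φ) + (1 / 6) * ((2 * (n : ℝ) + 4) * s) := by
    rw [tr2_add, tr2_smul, tr2_add, tr2_smul, tr2_smul (g x) s (fun i j => g x i j),
      hg.tr2_self hx, ← hsd]
    ring
  have n2 : (n : ℝ) + 2 ≠ 0 := by positivity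
  have n4 : (n : ℝ) + 4 ≠ 0 := by positivity
  have h5 : ∀ a b c d, Φ a b c d + g x a b * B c d - (6 / ((n : ℝ) + 4)) *
      (symTr4 (g x) Φ a b + (1 / 6) * (((n : ℝ) + 4) * β a b + s * g x a b)
        - (tr2 (g x) (symTr4 (g x) Φ) + (1 / 6) * ((2 * (n : ℝ) + 4) * s)) * g x a b
          / (2 * ((n : ℝ) + 2))) * g x c d
      = (Φ a b c d - (6 / ((n : ℝ) + 4)) * (symTr4 (g x) Φ a b
        - tr2 (g x) (symTr4 (g x) Φ) * g x a b / (2 * ((n : ℝ) + 2))) * g x c d)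
        + (g x a b * B c d - β a b * g x c d) := by
    intro a b c d
    field_simp
    ring
  rw [sym4TraceFree, sym4TraceFree, h2, h4]
  simp only [h5]
  rw [sym4_eq, sym4_eq]
  simp only [hβ]
  ring

/-- Symmetrising three arguments is absorbed by symmetrising four, and the trace correction becomes
g times a bilinear form, which `IsMetricOn.sym4TraceFree_add_mul` will discard. -/
theorem sym4_sym3TraceFree (h : Matrix (Fin n) (Fin n) ℝ) (Φ : Fin n → Fin n → Fin n → Fin n → ℝ)
    (i j k l : Fin n) : sym4 (sym3TraceFree h Φ) i j k l
      = sym4 (fun a b c d => Φ a b c d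
        + h a b * (-(3 / ((n : ℝ) + 2)) * tr2 h (fun p q => sym3 Φ p q c d))) i j k l := by
  generalize hφ : (fun c d => tr2 h (fun p q => sym3 Φ p q c d)) = φ
  have h1 : ∀ c d, tr2 h (fun p q => sym3 Φ p q c d) = φ c d := fun c d => by rw [← hφ]
  simp only [sym4_eq, sym3TraceFree, h1]
  simp only [sym3]
  ring

theorem tensorS1_zero (h : Matrix (Fin n) (Fin n) ℝ) (T : Fin n → Fin n → Fin n → ℝ)
    (i j k l : Fin n) : tensorS1 h T 0 i j k l
      = quadU h T i j l k + 4 / ((n : ℝ) - 2) * trSq h T j k * h i l := by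
  simp [tensorS1, quadU]

/-- For dt = 0 the tensor S₁ is g(S_X S_Y Z, ·) plus a multiple of g, and the order of its arguments
is irrelevant after symmetrisation. The factor 1/9 arises on the left from U = S/3 and the 1/3 in
the equation for ∇S, on the right because 𝔘 is quadratic in U. -/
theorem IsMetricOn.sym4TraceFree_covDeriv3 (hg : IsMetricOn O g) (hx : x ∈ O)
    (hS : ∀ i j k, ContDiffOn ℝ ∞ (fun y => S y i j k) O)
    (hcov : ∀ i j k l, covDeriv3 (christoffel g) S x i j k l
      = (1 / 3) * sym3TraceFree (g x) (tensorS1 (g x) (S x) 0) i j k l) (i j k l : Fin n) :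
    sym4TraceFree (g x) (covDeriv3 (christoffel g) (fun y i j k => 1 / 3 * S y i j k) x) i j k l
      = sym4TraceFree (g x) (quadU (g x) fun i j k => 1 / 3 * S x i j k) i j k l := by
  have h1 : covDeriv3 (christoffel g) (fun y i j k => 1 / 3 * S y i j k) x
      = fun a b c d => 1 / 9 * sym3TraceFree (g x) (tensorS1 (g x) (S x) 0) a b c d := by
    funext a b c d
    have h2 := hcov a b c d
    rw [covDeriv3] at h2 ⊢
    rw [pd_const_mul _ (differentiableAt_of_contDiffOn hg.isOpen (hS a b c) hx)]
    have h3 : ∑ m, (christoffel g x m d a * (1 / 3 * S x m b c)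
        + christoffel g x m d b * (1 / 3 * S x a m c) + christoffel g x m d c * (1 / 3 * S x a b m))
        = 1 / 3 * ∑ m, (christoffel g x m d a * S x m b c
        + christoffel g x m d b * S x a m c + christoffel g x m d c * S x a b m) := by
      rw [Finset.mul_sum]
      exact Finset.sum_congr rfl fun m _ => by ring
    rw [h3]
    linear_combination (1 / 3) * h2
  have h2 : (quadU (g x) fun i j k => 1 / 3 * S x i j k)
      = fun a b c d => 1 / 9 * quadU (g x) (S x) a b c d := by
    have h3 : ∀ a b c, raise3 (g x) (fun i j k => 1 / 3 * S x i j k) a b c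
        = 1 / 3 * raise3 (g x) (S x) a b c := by
      intro a b c
      simp only [raise3, Finset.mul_sum]
      exact Finset.sum_congr rfl fun m _ => by ring
    funext a b c d
    simp only [quadU, h3, Finset.mul_sum]
    exact Finset.sum_congr rfl fun m _ => Finset.sum_congr rfl fun p _ => by ring
  rw [h1, h2, sym4TraceFree_smul, sym4TraceFree_smul]
  congr 1
  rw [← hg.sym4TraceFree_add_mul hx (quadU (g x) (S x)) (fun c d => 4 / ((n : ℝ) - 2)
    * trSq (g x) (S x) c d + -(3 / ((n : ℝ) + 2)) * tr2 (g x) (fun p q =>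
      sym3 (tensorS1 (g x) (S x) 0) p q c d))]
  refine sym4TraceFree_congr (fun a b c d => ?_) i j k l
  rw [sym4_sym3TraceFree]
  generalize (fun c d => tr2 (g x) (fun p q => sym3 (tensorS1 (g x) (S x) 0) p q c d)) = φ
  simp only [tensorS1_zero, sym4_eq]
  ring

end SymmetricProjections

/-! ### Abundance, the Blaschke condition and relative spheres. -/

section AffineSpheres

open Filter Topology Matrix

variable {n : ℕ} {x : Eu n} {M : Type*} [TopologicalSpace M] [ChartedSpace (Eu n) M]
  [IsManifold 𝓘(ℝ, Eu n) ∞ M] {g : PseudoMetric n M} {S C : Tensor3 n M} {t : M → ℝ}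
  {e : OpenPartialHomeomorph M (Eu n)}

theorem IsAbundantManifold.cubicTraceFree_eq (h : IsAbundantManifold g S t)
    (ht : ∀ p X, dFun (n := n) t p X = 0) (hC : IsCubicOfStructure g S t C)
    (he : IsChart e) (hx : x ∈ e.target) : cubicTraceFree (g.comp e x) (C.comp e x)
      = fun i j k => 1 / 3 * S.comp e x i j k := by
  funext i j k
  simp only [cubicTraceFree, h.cubicTrace_eq_zero ht hC he hx]
  rw [hC.comp_eq ht e]
  ring

theorem covDeriv3_congr_on {O : Set (Eu n)} (hO : IsOpen O) {Γ : Eu n → Fin n → Fin n → Fin n → ℝ}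
    {T T' : Eu n → Fin n → Fin n → Fin n → ℝ} (h : ∀ y ∈ O, T y = T' y) (hx : x ∈ O) :
    covDeriv3 Γ T x = covDeriv3 Γ T' x := by
  funext i j k l
  rw [covDeriv3, covDeriv3, h x hx, pd_congr_on hO (fun y hy => by rw [h y hy]) hx]

theorem trSq_third (h : Matrix (Fin n) (Fin n) ℝ) (T : Fin n → Fin n → Fin n → ℝ) (i j : Fin n) :
    trSq h (fun i j k => 1 / 3 * T i j k) i j = 1 / 9 * trSq h T i j := by
  have h3 : ∀ a b c, raise3 h (fun i j k => 1 / 3 * T i j k) a b c = 1 / 3 * raise3 h T a b c := by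
    intro a b c
    simp only [raise3, Finset.mul_sum]
    exact Finset.sum_congr rfl fun m _ => by ring
  simp only [trSq, h3, Finset.mul_sum]
  exact Finset.sum_congr rfl fun m _ => Finset.sum_congr rfl fun p _ => by ring

theorem normSq3_third (h : Matrix (Fin n) (Fin n) ℝ) (T : Fin n → Fin n → Fin n → ℝ) :
    normSq3 h (fun i j k => 1 / 3 * T i j k) = 1 / 9 * normSq3 h T := by
  simp only [normSq3, Finset.mul_sum]
  exact Finset.sum_congr rfl fun _ _ => Finset.sum_congr rfl fun _ _ => Finset.sum_congr rfl
    fun _ _ => Finset.sum_congr rfl fun _ _ => Finset.sum_congr rfl fun _ _ =>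
    Finset.sum_congr rfl fun _ _ => by ring

/-- With U = S/3 and u = 0, the Weyl condition comes from conformal flatness, the condition on U is
the Sym⁴₀ part of the equation for ∇S, and the condition on u is a third of the Hessian equation. -/
theorem IsAbundantManifold.satisfiesAbundanceConditions (h : IsAbundantManifold g S t)
    (hn : 3 ≤ n) (ht : ∀ p X, dFun (n := n) t p X = 0) (hP : g.SchoutenTraceFreeVanishes)
    (hC : IsCubicOfStructure g S t C) : SatisfiesAbundanceConditions g C where
  weylFlat := h.conformallyFlat.isWeylFlat hn
  condU := by
    intro e he x hx i j k l
    simp only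
    rw [covDeriv3_congr_on e.open_target (fun y hy => h.cubicTraceFree_eq ht hC he hy) hx,
      h.cubicTraceFree_eq ht hC he hx]
    simp only [h.cubicTrace_eq_zero ht hC he hx, mul_zero, add_zero]
    refine (g.isMetricOn he).sym4TraceFree_covDeriv3 hx (h.isCubicOn he).smooth
      (fun i j k l => ?_) i j k l
    rw [h.covDerivS e he x hx, dFunComp_eq_zero h.smooth ht he hx]
  condu := by
    intro e he x hx i j
    simp only
    have h1 := (h.isSphericalOn hn ht hP he).hessian x hx i j
    have h2 : pd i (fun y => cubicTrace (g.comp e y) (C.comp e y) j) x = 0 := by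
      rw [pd_congr_on e.open_target (fun y hy => h.cubicTrace_eq_zero ht hC he hy j) hx, pd_const]
    rw [h.cubicTraceFree_eq ht hC he hx, trSq_third, normSq3_third]
    simp only [covDeriv1, h2, h.cubicTrace_eq_zero ht hC he hx, normSq1]
    have hn' : (3 : ℝ) ≤ n := by exact_mod_cast hn
    have n2 : (n : ℝ) - 2 ≠ 0 := by linarith
    have n1 : (n : ℝ) - 1 ≠ 0 := by linarith
    have np : (n : ℝ) + 2 ≠ 0 := by linarith
    simp only [mul_zero, Finset.sum_const_zero, sub_zero, zero_div, zero_mul, add_zero]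
    field_simp at h1 ⊢
    linarith

namespace RelativeConormalisation

variable (N : RelativeConormalisation n M)

theorem volume_sum (c : ℝ) (p : M) (X : Fin n → TangentSpace 𝓘(ℝ, Eu n) p)
    (b : Matrix (Fin n) (Fin n) ℝ) :
    N.volume c p (fun i => ∑ j, b i j • X j) = b.det * N.volume c p X := by
  have h1 : ∀ i, (mfderiv 𝓘(ℝ, Eu n) 𝓘(ℝ, Amb n) N.f p (∑ j, b i j • X j) : Amb n)
      = ∑ j, b i j • (mfderiv 𝓘(ℝ, Eu n) 𝓘(ℝ, Amb n) N.f p (X j) : Amb n) := fun i => by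
    rw [map_sum]
    simp only [map_smul]
  have h2 := extendM_mul_snoc b
    (fun j => (mfderiv 𝓘(ℝ, Eu n) 𝓘(ℝ, Amb n) N.f p (X j) : Amb n)) (N.ξ p)
    (fun k => (EuclideanSpace.proj (𝕜 := ℝ) k : Amb n →L[ℝ] ℝ).toLinearMap)
  have h3 := congrArg Matrix.det h2
  rw [Matrix.det_mul, det_extendM] at h3
  simp only [volume, ambientVolume, h1]
  rw [mul_left_comm]
  exact congrArg (c * ·) h3.symm

theorem dualVolume_sum (c : ℝ) (p : M) (X : Fin n → TangentSpace 𝓘(ℝ, Eu n) p)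
    (b : Matrix (Fin n) (Fin n) ℝ) :
    N.dualVolume c p (fun i => ∑ j, b i j • X j) = b.det * N.dualVolume c p X := by
  have h1 : ∀ i, (-(mfderiv 𝓘(ℝ, Eu n) 𝓘(ℝ, Amb n →L[ℝ] ℝ) N.Ξ p (∑ j, b i j • X j)
        : Amb n →L[ℝ] ℝ) : Amb n →L[ℝ] ℝ)
      = ∑ j, b i j • (-(mfderiv 𝓘(ℝ, Eu n) 𝓘(ℝ, Amb n →L[ℝ] ℝ) N.Ξ p (X j) : Amb n →L[ℝ] ℝ)
        : Amb n →L[ℝ] ℝ) := fun i => by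
    rw [map_sum]
    simp only [map_smul, smul_neg, Finset.sum_neg_distrib]
  have h2 := extendM_mul_snoc b
    (fun j => (-(mfderiv 𝓘(ℝ, Eu n) 𝓘(ℝ, Amb n →L[ℝ] ℝ) N.Ξ p (X j) : Amb n →L[ℝ] ℝ)
      : Amb n →L[ℝ] ℝ)) (N.Ξ p)
    (fun k => (ContinuousLinearMap.apply ℝ ℝ (EuclideanSpace.single k (1 : ℝ) : Amb n)).toLinearMap)
  have h3 := congrArg Matrix.det h2
  rw [Matrix.det_mul, det_extendM] at h3
  simp only [dualVolume, ambientDualVolume, h1]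
  rw [mul_left_comm]
  exact congrArg (c⁻¹ * ·) h3.symm

/-- The Blaschke condition can be checked on coordinate frames. -/
theorem isBlaschke_of_frame {c ε : ℝ} (hε : ε = 1 ∨ ε = -1)
    (h : ∀ e : OpenPartialHomeomorph M (Eu n), IsChart e → ∀ x ∈ e.target,
      c * (frameMatrix (fun y => N.f (e.symm y)) (fun y => N.ξ (e.symm y)) x).det
        = ε * (c⁻¹ * (dualFrameMatrix (fun y => N.Ξ (e.symm y)) x).det)) : N.IsBlaschke c := by
  refine ⟨ε, hε, fun p Y => ?_⟩
  obtain ⟨e, he, x, hx, rfl⟩ := exists_chart_eq (n := n) p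
  choose b hb using fun i => he.exists_coordVec hx (Y i)
  obtain rfl : Y = fun i => ∑ j, b i j • coordVec e x j := funext hb
  have h1 := N.volume_sum c (e.symm x) (coordVec e x) (Matrix.of b)
  have h2 := N.dualVolume_sum c (e.symm x) (coordVec e x) (Matrix.of b)
  simp only [Matrix.of_apply] at h1 h2
  rw [h1, h2, N.volume_coordVec he hx, N.dualVolume_coordVec he hx, h e he x hx]
  ring

/-- A hypersurface with `dξ = -l df` is a relative sphere. -/
theorem isRelativeSphere_of_pd [PreconnectedSpace M] [Nonempty M] {l : ℝ}
    (h : ∀ e : OpenPartialHomeomorph M (Eu n), IsChart e → ∀ x ∈ e.target, ∀ i,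
      pd i (fun y => N.ξ (e.symm y)) x = (-l) • pd i (fun y => N.f (e.symm y)) x) :
    N.IsRelativeSphere := by
  have hloc : IsLocallyConstant fun p => N.ξ p + l • N.f p :=
    isLocallyConstant_of_pd_eq_zero (n := n) fun e he x hx => by
      have h1 := differentiableAt_of_contDiffOn e.open_target (he.contDiffOn_comp_symm' N.smooth_ξ) hx
      have h2 := differentiableAt_of_contDiffOn e.open_target (he.contDiffOn_comp_symm' N.smooth_f) hx
      refine ⟨h1.add (h2.const_smul l), fun i => ?_⟩
      have h3 : pd i (fun y => N.ξ (e.symm y) + l • N.f (e.symm y)) x = pd i (fun y => N.ξ (e.symm y)) x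
          + pd i (fun y => l • N.f (e.symm y)) x := by
        exact congrArg (fun A : Eu n →L[ℝ] Amb n => A (EuclideanSpace.single i 1))
          (fderiv_fun_add h1 (h2.const_smul l))
      rw [h3, pd_const_smul l h2, h e he x hx, neg_smul, neg_add_cancel]
  obtain ⟨p₀⟩ := ‹Nonempty M›
  have hd : ∀ p, N.ξ p + l • N.f p = N.ξ p₀ + l • N.f p₀ := fun p =>
    hloc.apply_eq_of_preconnectedSpace p p₀
  by_cases hl : l = 0
  · subst hl
    -- Improper case: ξ itself is constant, and non-zero because Ξ pairs to 1 with it.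
    refine Or.inr ⟨N.ξ p₀, fun h0 => ?_, fun p => by simpa using hd p⟩
    have h1 := N.dual p₀
    rw [h0, map_zero] at h1
    exact zero_ne_one h1
  -- If d denotes the constant ξ + l f, then ξ = -l (f - d/l), so the centre is d/l.
  · refine Or.inl ⟨fun _ => -l, l⁻¹ • (N.ξ p₀ + l • N.f p₀), fun p => ?_⟩
    rw [smul_sub, smul_smul, neg_mul, mul_inv_cancel₀ hl, ← hd p]
    module

/-- If `V² = ρ det g` for the volume `V` of the frame of the hypersurface, then the Blaschke
condition holds for a suitable ambient volume form. -/
theorem exists_isBlaschke [Nonempty M] {N : RelativeConormalisation n M}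
    (hN : N.HasMetricAndCubic g C) {ρ : ℝ}
    (hρ : ∀ e : OpenPartialHomeomorph M (Eu n), IsChart e → ∀ x ∈ e.target,
      (frameMatrix (fun y => N.f (e.symm y)) (fun y => N.ξ (e.symm y)) x).det
        * (frameMatrix (fun y => N.f (e.symm y)) (fun y => N.ξ (e.symm y)) x).det
        = ρ * (g.comp e x).det) : ∃ c : ℝ, 0 < c ∧ N.IsBlaschke c := by
  have hV : ∀ e : OpenPartialHomeomorph M (Eu n), IsChart e → ∀ x ∈ e.target,
      (frameMatrix (fun y => N.f (e.symm y)) (fun y => N.ξ (e.symm y)) x).det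
        = ρ * (dualFrameMatrix (fun y => N.Ξ (e.symm y)) x).det := fun e he x hx => by
    have h := RelativeConormalisation.isHypersurfaceOn hN he
    refine mul_left_cancel₀ (h.det_frameMatrix_ne_zero hx) ?_
    rw [hρ e he x hx, ← h.det_frameMatrix_mul hx]
    ring
  have hρ0 : ρ ≠ 0 := by
    rintro rfl
    obtain ⟨e, he, x, hx, -⟩ := exists_chart_eq (n := n) (Classical.arbitrary M)
    have h := RelativeConormalisation.isHypersurfaceOn hN he
    exact h.det_frameMatrix_ne_zero hx (by rw [hV e he x hx, zero_mul])
  have hpos : 0 < √|ρ| := Real.sqrt_pos.2 (abs_pos.2 hρ0)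
  have hsq : √|ρ| * √|ρ| = |ρ| := Real.mul_self_sqrt (abs_nonneg ρ)
  obtain ⟨ε, hε, hρε⟩ : ∃ ε : ℝ, (ε = 1 ∨ ε = -1) ∧ ρ = ε * |ρ| := by
    rcases le_total 0 ρ with h | h
    · exact ⟨1, Or.inl rfl, by rw [abs_of_nonneg h, one_mul]⟩
    · exact ⟨-1, Or.inr rfl, by rw [abs_of_nonpos h]; ring⟩
  -- For V = ρ V* the condition c V = ε c⁻¹ V* amounts to c² ρ = ε; hence ε is the sign of ρ and c =
  -- |ρ|^(-1/2).
  refine ⟨(√|ρ|)⁻¹, inv_pos.2 hpos, N.isBlaschke_of_frame hε fun e he x hx => ?_⟩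
  rw [hV e he x hx, inv_inv]
  generalize (dualFrameMatrix (fun y => N.Ξ (e.symm y)) x).det = W
  rw [inv_mul_eq_iff_eq_mul₀ hpos.ne']
  linear_combination W * hρε - ε * W * hsq

end RelativeConormalisation

/-- The co-normalisation is arbitrary, so its shape operator is not known beforehand. The Gauss
equation recovers it from the curvature of ∇^g + Ŝ/3, which depends on g and S alone, and the volume
ratio supplies the constant for the Blaschke condition. -/
theorem IsAbundantManifold.isAbundant_and_exists_isAffineSphere [SimplyConnectedSpace M]
    (h : IsAbundantManifold g S t) (hn : 3 ≤ n) (ht : ∀ p X, dFun (n := n) t p X = 0)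
    (hP : g.SchoutenTraceFreeVanishes) {N : RelativeConormalisation n M}
    (hN : N.CorrespondsTo g S t C) : N.IsAbundant g C ∧ ∃ c : ℝ, 0 < c ∧ N.IsAffineSphere c := by
  refine ⟨⟨hN.1, h.satisfiesAbundanceConditions hn ht hP hN.2⟩, ?_⟩
  have hG := fun (e : OpenPartialHomeomorph M (Eu n)) (he : IsChart e) =>
    RelativeConormalisation.isHypersurfaceOn hN.1 he
  obtain ⟨K, hK⟩ := h.exists_normSq3_eq hn ht hP
  obtain ⟨ρ, hρ⟩ := exists_volume_ratio (f := N.f) (ξ := N.ξ)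
    (fun e he => (hG e he).toIsGaussOn) fun e he x hx i => h.cubicTrace_eq_zero ht hN.2 he hx i
  obtain ⟨c, hc, hB⟩ := RelativeConormalisation.exists_isBlaschke hN.1 hρ
  exact ⟨c, hc, hB, N.isRelativeSphere_of_pd (l := sphereConst n K) fun e he x hx i =>
    (hG e he).umbilic_of_curvM hn hx (fun i j a b => by
      rw [h.curvM_hypCon hn ht hP hN.2 he hx, hK e he x hx]) i⟩

end AffineSpheres

end AbundantGeometry

end

theorem mainTheorem8 (n : ℕ) (hn : 3 ≤ n) (M : Type*) [TopologicalSpace M]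
    [ChartedSpace (Eu n) M] [IsManifold 𝓘(ℝ, Eu n) ∞ M] [T2Space M]
    [SecondCountableTopology M] [SimplyConnectedSpace M] :
    (∀ (g : PseudoMetric n M) (S : Tensor3 n M) (t : M → ℝ),
      IsAbundantManifold g S t → (∀ p X, dFun (n := n) t p X = 0) →
      g.SchoutenTraceFreeVanishes →
        (∃ (N : RelativeConormalisation n M) (C : Tensor3 n M), N.CorrespondsTo g S t C) ∧
        ∀ (N : RelativeConormalisation n M) (C : Tensor3 n M), N.CorrespondsTo g S t C →
          N.IsAbundant g C ∧ ∃ c : ℝ, 0 < c ∧ N.IsAffineSphere c) ∧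
    (∀ (N : RelativeConormalisation n M) (g : PseudoMetric n M) (C : Tensor3 n M) (c : ℝ),
      c ≠ 0 → N.IsAbundant g C → N.IsAffineSphere c →
        g.SchoutenTraceFreeVanishes) := by
  exact ⟨fun g S t h ht hP => ⟨h.exists_correspondsTo hn ht hP,
      fun N C hN => h.isAbundant_and_exists_isAffineSphere hn ht hP hN⟩,
    fun N g C c hc hN hs => schoutenTraceFreeVanishes_of_isAffineSphere hn hc hN hs⟩
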